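/- **Setting.** For $v\in\mathbb R^3$ put $\langle v\rangle=\sqrt{1+|v|^2}$, and for $\eta\in\mathbb R$ let $L^1_\eta$ be the Banach space of (classes of) measurable $f:\mathbb R^3\to\mathbb R$ with $\|f\|_{L^1_\eta}=\int_{\mathbb R^3}|f(v)|\langle v\rangle^\eta\,dv<\infty$. Fix constants $\tau\ge 0$, $\epsilon\in(0,1)$, $e\in(0,1]$, $\lambda>0$, $m_1>0$, and put $\zeta=\frac{1+\epsilon}2$, $\alpha=\frac{m_1}{1+m_1}$, $\beta=\frac{1-e}2$. Let $\mathbf F_1\ge 0$ be a function on $\mathbb R^3$ with $\int\mathbf F_1\,dv=1$, bulk velocity $\int v\,\mathbf F_1(v)\,dv=\mathbf u_1$, temperature $\frac{m_1}{3}\int|v-\mathbf u_1|^2\mathbf F_1(v)\,dv=\Theta_1>0$, finite entropy ($\mathbf F_1\log\mathbf F_1$ is integrable), and $\mathbf F_1\in H^k_\delta$ for all integers $k\ge0$ and all real $\delta\ge 0$, i.e. all weak partial derivatives $\partial^s\mathbf F_1$ exist and $\int|\partial^s\mathbf F_1|^2\langle v\rangle^{2\delta}dv<\infty$. For a test function $\psi\in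 C_c^\infty(\mathbb R^3)$ and $q=v-w$ let $$\mathcal A_\zeta[\psi](v,w)=\frac1{4\pi}\int_{\mathbb S^2}\big(\psi(v')+\psi(w')-\psi(v)-\psi(w)\big)d\sigma,\qquad v'=v+\tfrac\zeta2(|q|\sigma-q),\quad w'=w-\tfrac\zeta2(|q|\sigma-q),$$ $$\mathcal J_e[\psi](v,w)=\frac1{4\pi}\int_{\mathbb S^2}\big(\psi(\tilde v^\star)-\psi(v)\big)d\sigma,\qquad \tilde v^\star=v-\alpha(1-\beta)(q-|q|\sigma).$$ Let $T>0$ and $f_0\in L^1_3$. A *solution* on $[0,T]$ of the forced inelastic Boltzmann equation $\partial_t f=\tau\mathcal Q(f,f)+\mathcal L(f)$ with initial datum $f_0$ is a function $f\in C([0,T];L^1_2)\cap L^\infty(0,T;L^1_3)$ with $f(0)=f_0$ such that, for every $\psi\in C_c^\infty(\mathbb R^3)$ and every $t\in[0,T]$ (with one-sided derivatives at $t=0$ and $t=T$), $$\frac{d}{dt}\int f(v,t)\psi(v)\,dv=\frac\tau2\iint f(v,t)f(w,t)\,|v-w|\,\mathcal A_\zeta[\psi](v,w)\,dw\,dv+\frac1\lambda\iint|v-w|\,f(v,t)\,\mathbf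 F_1(w)\,\mathcal J_e[\psi](v,w)\,dw\,dv .$$ **Theorem 4.6 (existence and uniqueness for the Cauchy problem).** For every nonnegative $f_0\in L^1_3$ and every $T>0$ there exists a unique solution $f\in C([0,T];L^1_2)\cap L^\infty(0,T;L^1_3)$ on $[0,T]$ with initial datum $f_0$. Moreover this solution is nonnegative: $f(t)\ge0$ a.e. for every $t\in[0,T]$. (Uniqueness holds among all solutions in this class, without any sign condition.) -/

import Mathlib

open MeasureTheory Set

noncomputable section

namespace InelasticBoltzmann

/-- The velocity space `ℝ³` with its Euclidean norm. -/
abbrev V : Type := EuclideanSpace ℝ (Fin 3)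

/-- The bracket `⟨v⟩ = √(1 + |v|²)`. -/
def bracket (v : V) : ℝ := Real.sqrt (1 + ‖v‖ ^ 2)

/-- The measure `⟨v⟩^η dv`. -/
def weighted (η : ℝ) : Measure V :=
  volume.withDensity fun v => ENNReal.ofReal (bracket v ^ η)

/-- The Banach space `L¹_η`, with norm `‖f‖ = ∫ |f(v)| ⟨v⟩^η dv`. -/
abbrev L1 (η : ℝ) : Type := Lp ℝ 1 (weighted η)

/-- Smooth compactly supported test functions. -/
def IsTest (ψ : V → ℝ) : Prop := ContDiff ℝ (⊤ : ℕ∞) ψ ∧ HasCompactSupport ψ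

/-- `g` is the weak partial derivative `∂_{i₁} ⋯ ∂_{i_k} F`. -/
def HasWeakPartial (F : V → ℝ) {k : ℕ} (i : Fin k → Fin 3) (g : V → ℝ) : Prop :=
  LocallyIntegrable F volume ∧ LocallyIntegrable g volume ∧
    ∀ φ : V → ℝ, IsTest φ →
      ∫ v, F v * iteratedFDeriv ℝ k φ v (fun j => EuclideanSpace.single (i j) 1)
        = (-1) ^ k * ∫ v, g v * φ v

/-- The weighted Sobolev space `H^k_δ`: all weak partial derivatives of order at most `k` exist
and satisfy `∫ |∂F|² ⟨v⟩^(2δ) dv < ∞`. -/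
def MemSobolev (k : ℕ) (δ : ℝ) (F : V → ℝ) : Prop :=
  ∀ j ≤ k, ∀ i : Fin j → Fin 3, ∃ g : V → ℝ, HasWeakPartial F i g ∧ MemLp g 2 (weighted (2 * δ))

/-- The standing assumption on the distribution `F₁` of the host fluid, whose particles have mass
`m₁`: nonnegative, of unit mass, with bulk velocity `u₁`, temperature `Θ₁ > 0`, and finite entropy,
and lying in `H^s_δ` for all `s, δ ≥ 0` (it is the same to ask this for integers `s`, as these
spaces decrease in `s`). -/
structure IsHost (m₁ Θ₁ : ℝ) (u₁ : V) (F₁ : V → ℝ) : Prop where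
  nonneg : 0 ≤ᵐ[volume] F₁
  integrable : Integrable F₁ volume
  mass : ∫ v, F₁ v = 1
  bulk : ∫ v, F₁ v • v = u₁
  temp_pos : 0 < Θ₁
  temp : m₁ / 3 * ∫ v, ‖v - u₁‖ ^ 2 * F₁ v = Θ₁
  smooth : ∀ (k : ℕ) (δ : ℝ), 0 ≤ δ → MemSobolev k δ F₁
  entropy : Integrable (fun v => F₁ v * Real.log (F₁ v)) volume

/-- The surface measure `dσ` of the unit sphere `𝕊²` (of total mass `4π`). -/
def surface : Measure (Metric.sphere (0 : V) 1) := (volume : Measure V).toSphere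

/-- `𝒜_ζ[ψ](v,w) = (4π)⁻¹ ∫ (ψ(v') + ψ(w') - ψ(v) - ψ(w)) dσ`, where `ζ = (1 + ε)/2`,
`v' = v + ζ/2 (|q|σ - q)` and `w' = w - ζ/2 (|q|σ - q)`. -/
def granular (ε : ℝ) (ψ : V → ℝ) (v w : V) : ℝ :=
  let ζ : ℝ := (1 + ε) / 2
  1 / (4 * Real.pi) * ∫ σ : Metric.sphere (0 : V) 1,
    (ψ (v + (ζ / 2) • (‖v - w‖ • (σ : V) - (v - w)))
      + ψ (w - (ζ / 2) • (‖v - w‖ • (σ : V) - (v - w))) - ψ v - ψ w) ∂surface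

/-- `𝒥_e[ψ](v,w) = (4π)⁻¹ ∫ (ψ(v⋆) - ψ(v)) dσ`, where `v⋆ = v - α(1-β)(q - |q|σ)`,
`α = m₁/(1+m₁)` and `β = (1-e)/2`. -/
def scattering (m₁ e : ℝ) (ψ : V → ℝ) (v w : V) : ℝ :=
  let α : ℝ := m₁ / (1 + m₁)
  let β : ℝ := (1 - e) / 2
  1 / (4 * Real.pi) * ∫ σ : Metric.sphere (0 : V) 1,
    (ψ (v - (α * (1 - β)) • ((v - w) - ‖v - w‖ • (σ : V))) - ψ v) ∂surface

/-- The weak form `∫ (τ 𝒬(f,f) + ℒ(f)) ψ dv` of the right-hand side of the equation. -/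
def weakRHS (τ ε lam m₁ e : ℝ) (F₁ f ψ : V → ℝ) : ℝ :=
  τ / 2 * (∫ v, ∫ w, f v * f w * ‖v - w‖ * granular ε ψ v w)
    + 1 / lam * ∫ v, ∫ w, ‖v - w‖ * f v * F₁ w * scattering m₁ e ψ v w

/-- `f ∈ C([0,T]; L¹_2) ∩ L^∞(0,T; L¹_3)` solves `∂ₜ f = τ 𝒬(f,f) + ℒ(f)` in the weak form, with
`f(0) = f₀`. -/
structure IsSolution (τ ε lam m₁ e : ℝ) (F₁ : V → ℝ) {T : ℝ} (hT : 0 < T) (f₀ : L1 3)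
    (f : C(Icc (0 : ℝ) T, L1 2)) : Prop where
  /-- `f ∈ L^∞(0,T; L¹_3)`, in the sense of Bochner. -/
  bounded : ∃ g : ℝ → L1 3, MemLp g ⊤ (volume.restrict (Ioo 0 T)) ∧
    ∀ᵐ t ∂(volume.restrict (Ioo 0 T)), f (projIcc 0 T hT.le t) =ᵐ[volume] g t
  /-- The equation holds against every test function, at every time (one-sided derivatives
  at the end points). -/
  equation : ∀ ψ : V → ℝ, IsTest ψ → ∀ t : Icc (0 : ℝ) T,
    HasDerivWithinAt (fun s : ℝ => ∫ v, f (projIcc 0 T hT.le s) v * ψ v)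
      (weakRHS τ ε lam m₁ e F₁ (f t) ψ) (Icc 0 T) t
  initial : f ⟨0, left_mem_Icc.2 hT.le⟩ =ᵐ[volume] f₀

end InelasticBoltzmann

end

noncomputable section

namespace InelasticBoltzmann

/-! ### The bracket -/

/-! The theorem rests on a stability estimate in `L¹_2`. Formally, let h be the difference of a
solution w and a nonnegative solution u, and test its equation with sgn(h)⟨v⟩². Grain collisions do
not increase |v|² + |w|² (`post_energy`), and a collision with the host satisfies ⟨v⋆⟩² ≤ ⟨v⟩² +
m₁⟨w⟩² (`post_growth`). The gain carrying |h(v)|⟨v⟩² is therefore paid for exactly by the loss of h.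
What survives is |v - w| |h(v)| ⟨w⟩² against u(w) or F₁(w), which is at most ‖h‖ times a third
moment. The term quadratic in h is at most the third moment of h times ‖h‖, without using signs.
Only u has to be nonnegative, which is why uniqueness needs no sign condition.

Two obstacles make this formal: sgn(h)⟨v⟩² is not an admissible test function, and |v - w| is
unbounded. Hence u is taken to be a solution of a problem truncated to ⟨v⟩ ≤ r. For any ψ with |ψ| ≤
⟨v⟩² the computation leaves an extra term c(‖h‖ - ∫hψ), with c proportional to r (`Dom.stability`).
This term is absorbed by differentiating exp(ct)∫hψ. Taking the supremum over smooth ψ and applying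
Gronwall gives growth exp((c+b)t) for exp(ct)‖h‖, so the factor exp(ct) cancels and the rate b is
independent of r (`IsTruncSol.stability`). The price of truncation is a tail of third moments.

The truncated problem is an ordinary differential equation in `L¹_2` with a locally Lipschitz field.
The weak collision terms are represented by functions (`Params.exists_density`), because for a fixed
angle and relative velocity a collision translates v. Adding a multiple of the unknown makes the
field positive, and the energy bound excludes blow-up (`exists_truncSol`). The second and third
moments are bounded uniformly in r by linear Gronwall inequalities. The fourth moment then grows by
at most a constant.

Data are cut at radius k+1 and collisions at (k+1)². The fourth moments are then O(k+1), the
third-moment tails O(1/(k+1)), and stability makes the approximations Cauchy; their limit is a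
solution. The same estimate, with the tails of an arbitrary solution tending to zero by dominated
convergence, shows that the approximations converge to every solution (`IsApprox.tendsto_solution`).
Hence there is only one. -/

lemma bracket_sq (v : V) : bracket v ^ 2 = 1 + ‖v‖ ^ 2 := by
  unfold bracket; rw [Real.sq_sqrt]; positivity

lemma one_le_bracket (v : V) : 1 ≤ bracket v := by
  unfold bracket
  rw [Real.one_le_sqrt]
  nlinarith [norm_nonneg v]

lemma bracket_pos (v : V) : 0 < bracket v := lt_of_lt_of_le one_pos (one_le_bracket v)

lemma norm_le_bracket (v : V) : ‖v‖ ≤ bracket v := by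
  unfold bracket
  apply Real.le_sqrt_of_sq_le; linarith

lemma continuous_bracket : Continuous bracket := by
  unfold bracket; fun_prop

lemma measurable_bracket : Measurable bracket := continuous_bracket.measurable

lemma one_le_bracket_pow (k : ℕ) (v : V) : 1 ≤ bracket v ^ k := one_le_pow₀ (one_le_bracket v)

lemma bracket_pow_pos (k : ℕ) (v : V) : 0 < bracket v ^ k := pow_pos (bracket_pos v) k

lemma bracket_pow_mono {i j : ℕ} (h : i ≤ j) (v : V) : bracket v ^ i ≤ bracket v ^ j :=
  pow_le_pow_right₀ (one_le_bracket v) h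

lemma norm_sub_le_bracket_add (v w : V) : ‖v - w‖ ≤ bracket v + bracket w :=
  (norm_sub_le v w).trans (add_le_add (norm_le_bracket v) (norm_le_bracket w))

lemma norm_sub_le_bracket_mul (v w : V) : ‖v - w‖ ≤ 2 * (bracket v * bracket w) := by
  nlinarith [norm_sub_le_bracket_add v w, one_le_bracket v, one_le_bracket w]

/-! ### Polynomial moments -/

/-- `f` has a finite absolute moment of order `k`. -/
def Mom (k : ℕ) (f : V → ℝ) : Prop := Integrable (fun v => f v * bracket v ^ k) volume

/-- The weighted norm `∫ |f| ⟨v⟩^k dv`. -/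
def nrm (k : ℕ) (f : V → ℝ) : ℝ := ∫ v, |f v| * bracket v ^ k

lemma Mom.integrable_abs {k : ℕ} {f : V → ℝ} (h : Mom k f) :
    Integrable (fun v => |f v| * bracket v ^ k) volume := by
  refine h.norm.congr (Filter.Eventually.of_forall fun v => ?_)
  simp only [Real.norm_eq_abs, abs_mul, abs_of_pos (bracket_pow_pos k v)]

lemma Mom.aesm {k : ℕ} {f : V → ℝ} (h : Mom k f) : AEStronglyMeasurable f volume := by
  have h1 : AEStronglyMeasurable (fun v => f v * bracket v ^ k * (bracket v ^ k)⁻¹) volume :=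
    h.aestronglyMeasurable.mul
      (((measurable_bracket.pow_const k).inv).aestronglyMeasurable)
  refine h1.congr (Filter.Eventually.of_forall fun v => ?_)
  have := (bracket_pow_pos k v).ne'
  simp only []
  field_simp

lemma Mom.mono_fun {k : ℕ} {f g : V → ℝ} (h : Mom k f) (hg : AEStronglyMeasurable g volume)
    (hle : ∀ᵐ v, |g v| ≤ |f v|) : Mom k g := by
  refine Integrable.mono h (hg.mul (measurable_bracket.pow_const k).aestronglyMeasurable) ?_
  filter_upwards [hle] with v hv
  simp only [Real.norm_eq_abs, abs_mul]
  gcongr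

lemma Mom.of_le {i j : ℕ} (hij : i ≤ j) {f : V → ℝ} (h : Mom j f) : Mom i f := by
  refine Integrable.mono h
    (h.aesm.mul (measurable_bracket.pow_const i).aestronglyMeasurable) ?_
  refine Filter.Eventually.of_forall fun v => ?_
  simp only [Real.norm_eq_abs, abs_mul, abs_of_pos (bracket_pow_pos _ v)]
  exact mul_le_mul_of_nonneg_left (bracket_pow_mono hij v) (abs_nonneg _)

lemma Mom.integrable {k : ℕ} {f : V → ℝ} (h : Mom k f) : Integrable f volume := by
  have := h.of_le (Nat.zero_le k)
  simpa [Mom] using this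

lemma Mom.add {k : ℕ} {f g : V → ℝ} (hf : Mom k f) (hg : Mom k g) : Mom k (fun v => f v + g v) := by
  refine (Integrable.add hf hg).congr (Filter.Eventually.of_forall fun v => ?_)
  simp [add_mul]

lemma Mom.sub {k : ℕ} {f g : V → ℝ} (hf : Mom k f) (hg : Mom k g) : Mom k (fun v => f v - g v) := by
  refine (Integrable.sub hf hg).congr (Filter.Eventually.of_forall fun v => ?_)
  simp [sub_mul]

lemma Mom.congr {k : ℕ} {f g : V → ℝ} (hf : Mom k f) (h : f =ᵐ[volume] g) : Mom k g := by
  refine Integrable.congr hf ?_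
  filter_upwards [h] with v hv
  rw [hv]

lemma Mom.indicator {k : ℕ} {f : V → ℝ} (hf : Mom k f) {S : Set V} (hS : MeasurableSet S) :
    Mom k (S.indicator f) := by
  refine hf.mono_fun (hf.aesm.indicator hS) (Filter.Eventually.of_forall fun v => ?_)
  by_cases h : v ∈ S <;> simp [h]

lemma Mom.mul_dom {k : ℕ} {f ψ : V → ℝ} {C : ℝ} (hf : Mom k f) (hψ : Measurable ψ)
    (hb : ∀ v, |ψ v| ≤ C * bracket v ^ k) : Integrable (fun v => f v * ψ v) volume := by
  refine Integrable.mono (Integrable.const_mul hf C)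
    (hf.aesm.mul hψ.aestronglyMeasurable) ?_
  refine Filter.Eventually.of_forall fun v => ?_
  have h0 : 0 ≤ C := by
    have := (abs_nonneg _).trans (hb 0)
    exact nonneg_of_mul_nonneg_left this (bracket_pow_pos k 0)
  simp only [Real.norm_eq_abs, abs_mul, abs_of_pos (bracket_pow_pos k v), abs_of_nonneg h0]
  nlinarith [hb v, abs_nonneg (f v)]

lemma nrm_nonneg (k : ℕ) (f : V → ℝ) : 0 ≤ nrm k f :=
  integral_nonneg fun v => mul_nonneg (abs_nonneg _) (bracket_pow_pos k v).le

lemma nrm_congr {k : ℕ} {f g : V → ℝ} (h : f =ᵐ[volume] g) : nrm k f = nrm k g := by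
  refine integral_congr_ae ?_
  filter_upwards [h] with v hv
  rw [hv]

lemma nrm_le_of_abs_le {k : ℕ} {f g : V → ℝ} (hf : Mom k f) (hg : Mom k g)
    (h : ∀ᵐ v, |g v| ≤ |f v|) : nrm k g ≤ nrm k f := by
  refine integral_mono_ae hg.integrable_abs hf.integrable_abs ?_
  filter_upwards [h] with v hv
  exact mul_le_mul_of_nonneg_right hv (bracket_pow_pos k v).le

lemma nrm_indicator_le {k : ℕ} {f : V → ℝ} (hf : Mom k f) {S : Set V} (hS : MeasurableSet S) :
    nrm k (S.indicator f) ≤ nrm k f := by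
  refine nrm_le_of_abs_le hf (hf.indicator hS) (Filter.Eventually.of_forall fun v => ?_)
  by_cases h : v ∈ S <;> simp [h]

lemma nrm_mono {i j : ℕ} (hij : i ≤ j) {f : V → ℝ} (h : Mom j f) : nrm i f ≤ nrm j f := by
  refine integral_mono (h.of_le hij).integrable_abs h.integrable_abs fun v => ?_
  exact mul_le_mul_of_nonneg_left (bracket_pow_mono hij v) (abs_nonneg _)

lemma nrm_add_le {k : ℕ} {f g : V → ℝ} (hf : Mom k f) (hg : Mom k g) :
    nrm k (fun v => f v + g v) ≤ nrm k f + nrm k g := by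
  unfold nrm
  rw [← integral_add hf.integrable_abs hg.integrable_abs]
  refine integral_mono (hf.add hg).integrable_abs (hf.integrable_abs.add hg.integrable_abs) fun v => ?_
  simp only []
  rw [← add_mul]
  exact mul_le_mul_of_nonneg_right (abs_add_le _ _) (bracket_pow_pos k v).le

lemma nrm_sub_le {k : ℕ} {f g : V → ℝ} (hf : Mom k f) (hg : Mom k g) :
    nrm k (fun v => f v - g v) ≤ nrm k f + nrm k g := by
  unfold nrm
  rw [← integral_add hf.integrable_abs hg.integrable_abs]
  refine integral_mono (hf.sub hg).integrable_abs (hf.integrable_abs.add hg.integrable_abs) fun v => ?_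
  simp only []
  rw [← add_mul]
  exact mul_le_mul_of_nonneg_right (abs_sub _ _) (bracket_pow_pos k v).le

lemma abs_integral_mul_le {k : ℕ} {f ψ : V → ℝ} {C : ℝ} (hf : Mom k f)
    (hb : ∀ v, |ψ v| ≤ C * bracket v ^ k) : |∫ v, f v * ψ v| ≤ C * nrm k f := by
  rw [nrm, ← integral_const_mul, ← Real.norm_eq_abs]
  refine norm_integral_le_of_norm_le (hf.integrable_abs.const_mul C)
    (Filter.Eventually.of_forall fun v => ?_)
  rw [Real.norm_eq_abs, abs_mul]
  nlinarith [hb v, abs_nonneg (f v)]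

/-- The sublevel sets of the bracket. -/
def ballS (r : ℝ) : Set V := {v | bracket v ≤ r}

lemma measurableSet_ballS (r : ℝ) : MeasurableSet (ballS r) :=
  measurableSet_le measurable_bracket measurable_const

/-- On a bounded set higher moments are controlled by lower ones. -/
lemma mom_indicator_ballS {i j : ℕ} {r : ℝ} {f : V → ℝ} (hf : Mom i f) :
    Mom (i + j) ((ballS r).indicator f) := by
  have hS := measurableSet_ballS r
  refine Integrable.mono (Integrable.const_mul hf (|r| ^ j))
    ((hf.aesm.indicator hS).mul (measurable_bracket.pow_const _).aestronglyMeasurable) ?_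
  refine Filter.Eventually.of_forall fun v => ?_
  by_cases h : v ∈ ballS r
  · have hr : bracket v ≤ |r| := le_trans h (le_abs_self r)
    simp only [indicator_of_mem h, Real.norm_eq_abs, abs_mul, abs_of_pos (bracket_pow_pos _ v),
      pow_add, abs_pow, abs_abs]
    have := pow_le_pow_left₀ (bracket_pos v).le hr j
    have h2 : 0 ≤ |f v| * bracket v ^ i := mul_nonneg (abs_nonneg _) (bracket_pow_pos _ v).le
    nlinarith
  · simp only [indicator_of_notMem h, zero_mul, norm_zero]
    positivity

lemma nrm_indicator_ballS_le {i j : ℕ} {r : ℝ} (hr0 : 0 ≤ r) {f : V → ℝ} (hf : Mom i f) :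
    nrm (i + j) ((ballS r).indicator f) ≤ r ^ j * nrm i f := by
  rw [nrm, nrm, ← integral_const_mul]
  refine integral_mono (mom_indicator_ballS hf).integrable_abs (hf.integrable_abs.const_mul _) fun v => ?_
  have h2 : 0 ≤ |f v| * bracket v ^ i := mul_nonneg (abs_nonneg _) (bracket_pow_pos _ v).le
  by_cases h : v ∈ ballS r
  · have hr : bracket v ≤ r := h
    simp only [indicator_of_mem h, pow_add]
    have := pow_le_pow_left₀ (bracket_pos v).le hr j
    nlinarith
  · simp only [indicator_of_notMem h, abs_zero, zero_mul]
    positivity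

/-- Tails are controlled by higher moments. -/
lemma nrm_indicator_compl_ballS_le {k : ℕ} {r : ℝ} (hr0 : 0 < r) {f : V → ℝ} (hf : Mom (k + 1) f) :
    nrm k ((ballS r)ᶜ.indicator f) ≤ nrm (k + 1) f / r := by
  rw [le_div_iff₀ hr0, nrm, nrm, ← integral_mul_const]
  refine integral_mono (((hf.of_le (Nat.le_succ k)).indicator
    (measurableSet_ballS r).compl).integrable_abs.mul_const _) hf.integrable_abs fun v => ?_
  have h2 : 0 ≤ |f v| * bracket v ^ k := mul_nonneg (abs_nonneg _) (bracket_pow_pos _ v).le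
  by_cases h : v ∈ ballS r
  · simp only [indicator_of_notMem (show v ∉ (ballS r)ᶜ from fun hh => hh h), abs_zero, zero_mul]
    have := bracket_pow_pos (k + 1) v
    positivity
  · have hr : r ≤ bracket v := (not_le.mp h).le
    simp only [indicator_of_mem (show v ∈ (ballS r)ᶜ from h), pow_succ]
    nlinarith

/-! ### The weighted `L¹` spaces -/

lemma measurable_weight (η : ℝ) : Measurable fun v : V => ENNReal.ofReal (bracket v ^ η) :=
  (measurable_bracket.pow_const η).ennreal_ofReal

lemma weighted_ac (η : ℝ) : weighted η ≪ (volume : Measure V) := withDensity_absolutelyContinuous _ _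

lemma ac_weighted (η : ℝ) : (volume : Measure V) ≪ weighted η := by
  refine withDensity_absolutelyContinuous' (measurable_weight η).aemeasurable ?_
  refine Filter.Eventually.of_forall fun v => ?_
  have : 0 < bracket v ^ η := Real.rpow_pos_of_pos (bracket_pos v) η
  simp [this]

lemma ae_weighted_iff (η : ℝ) {p : V → Prop} :
    (∀ᵐ v ∂(weighted η), p v) ↔ ∀ᵐ v ∂(volume : Measure V), p v :=
  ⟨fun h => (ac_weighted η).ae_le h, fun h => (weighted_ac η).ae_le h⟩

/-- The spaces carry real exponents and the moments natural ones; `hk` is the bridge between the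
two. -/
lemma integrable_weighted_iff {η : ℝ} {k : ℕ} (hk : η = k) {f : V → ℝ} :
    Integrable f (weighted η) ↔ Mom k f := by
  subst hk
  unfold weighted Mom
  rw [integrable_withDensity_iff (measurable_weight _)
    (Filter.Eventually.of_forall fun v => ENNReal.ofReal_lt_top)]
  refine integrable_congr (Filter.Eventually.of_forall fun v => ?_)
  simp only [Real.rpow_natCast]
  rw [ENNReal.toReal_ofReal (bracket_pow_pos k v).le]

lemma integral_weighted {η : ℝ} {k : ℕ} (hk : η = k) (f : V → ℝ) :
    ∫ v, f v ∂(weighted η) = ∫ v, f v * bracket v ^ k := by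
  subst hk
  unfold weighted
  rw [integral_withDensity_eq_integral_toReal_smul (measurable_weight _)
    (Filter.Eventually.of_forall fun v => ENNReal.ofReal_lt_top)]
  refine integral_congr_ae (Filter.Eventually.of_forall fun v => ?_)
  simp only [Real.rpow_natCast, smul_eq_mul]
  rw [ENNReal.toReal_ofReal (bracket_pow_pos k v).le, mul_comm]

lemma mom_coe {η : ℝ} {k : ℕ} (hk : η = k) (f : L1 η) : Mom k f :=
  (integrable_weighted_iff hk).1 (L1.integrable_coeFn f)

lemma norm_eq_nrm {η : ℝ} {k : ℕ} (hk : η = k) (f : L1 η) : ‖f‖ = nrm k f := by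
  rw [L1.norm_eq_integral_norm, integral_weighted hk]
  rfl

lemma L_ext {η : ℝ} {f g : L1 η} (h : f =ᵐ[volume] g) : f = g :=
  Lp.ext ((ae_weighted_iff _).2 h)

lemma coe_sub' {η : ℝ} (f g : L1 η) : ⇑(f - g) =ᵐ[volume] fun v => f v - g v :=
  (ae_weighted_iff _).1 (Lp.coeFn_sub f g)

lemma coe_add' {η : ℝ} (f g : L1 η) : ⇑(f + g) =ᵐ[volume] fun v => f v + g v :=
  (ae_weighted_iff _).1 (Lp.coeFn_add f g)

lemma coe_smul' {η : ℝ} (c : ℝ) (f : L1 η) : ⇑(c • f) =ᵐ[volume] fun v => c * f v :=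
  (ae_weighted_iff _).1 (Lp.coeFn_smul c f)

lemma norm_sub_eq_nrm {η : ℝ} {k : ℕ} (hk : η = k) (f g : L1 η) :
    ‖f - g‖ = nrm k (fun v => f v - g v) := by
  rw [norm_eq_nrm hk, nrm_congr (coe_sub' f g)]

lemma L_nonneg_iff {η : ℝ} (f : L1 η) : 0 ≤ f ↔ 0 ≤ᵐ[volume] f := by
  rw [← Lp.coeFn_nonneg]
  exact ae_weighted_iff _

/-- The element of the weighted space given by a function with a finite moment. -/
def toL {η : ℝ} {k : ℕ} (hk : η = k) (f : V → ℝ) (hf : Mom k f) : L1 η :=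
  ((integrable_weighted_iff hk).2 hf).toL1 f

lemma coe_toL {η : ℝ} {k : ℕ} (hk : η = k) {f : V → ℝ} (hf : Mom k f) :
    toL hk f hf =ᵐ[volume] f :=
  (ae_weighted_iff _).1 (Integrable.coeFn_toL1 _)

/-! ### The host distribution -/

lemma integrable_bracket_inv : Integrable (fun v : V => (bracket v ^ 4)⁻¹) volume := by
  have h := integrable_rpow_neg_one_add_norm_sq (E := V) (μ := volume) (r := 4) (by simp; norm_num)
  refine h.congr (Filter.Eventually.of_forall fun v => ?_)
  simp only []
  have : (1 + ‖v‖ ^ 2) = bracket v ^ 2 := (bracket_sq v).symm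
  rw [this, ← Real.rpow_natCast, ← Real.rpow_mul (bracket_pos v).le, ← Real.rpow_natCast,
    ← Real.rpow_neg (bracket_pos v).le]
  norm_num

/-- A weak derivative of order zero is the function itself, so the Sobolev hypothesis contains every
weighted `L²` bound. The inequality xy ≤ x² + y² with x = |F₁|⟨v⟩^(k+2) and y = ⟨v⟩^(-2) turns this
into a weighted `L¹` bound, since ⟨v⟩^(-4) is integrable in dimension three. -/
lemma IsHost.mom {m₁ Θ₁ : ℝ} {u₁ : V} {F₁ : V → ℝ} (h : IsHost m₁ Θ₁ u₁ F₁) (k : ℕ) : Mom k F₁ := by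
  obtain ⟨g, ⟨_, hg, hw⟩, hL⟩ := h.smooth 0 (k + 2 : ℕ) (by positivity) 0 le_rfl Fin.elim0
  have hFg : F₁ =ᵐ[volume] g := by
    refine ae_eq_of_integral_contDiff_smul_eq h.integrable.locallyIntegrable hg fun φ h1 h2 => ?_
    have := hw φ ⟨h1, h2⟩
    simp only [iteratedFDeriv_zero_apply, pow_zero, one_mul] at this
    simpa [mul_comm] using this
  have hs : Mom (2 * (k + 2)) (fun v => g v ^ 2) := by
    exact (integrable_weighted_iff (by push_cast; ring)).1 hL.integrable_sq
  have hm : Mom k g := by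
    refine Integrable.mono' (Integrable.add hs integrable_bracket_inv)
      (hg.aestronglyMeasurable.mul (measurable_bracket.pow_const _).aestronglyMeasurable)
      (Filter.Eventually.of_forall fun v => ?_)
    have hb := bracket_pos v
    simp only [Real.norm_eq_abs, abs_mul, abs_of_pos (bracket_pow_pos _ v), Pi.add_apply]
    have e1 : g v ^ 2 * bracket v ^ (2 * (k + 2)) = (|g v| * bracket v ^ (k + 2)) ^ 2 := by
      rw [mul_pow, sq_abs]; ring
    have e2 : (bracket v ^ 4)⁻¹ = ((bracket v ^ 2)⁻¹) ^ 2 := by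
      field_simp
    have e3 : |g v| * bracket v ^ k = (|g v| * bracket v ^ (k + 2)) * (bracket v ^ 2)⁻¹ := by
      rw [pow_add]; field_simp
    rw [e1, e2, e3]
    nlinarith [sq_nonneg ((|g v| * bracket v ^ (k + 2)) - (bracket v ^ 2)⁻¹),
      sq_nonneg ((|g v| * bracket v ^ (k + 2)) + (bracket v ^ 2)⁻¹)]
  exact hm.congr hFg.symm

/-! ### Averages over the sphere -/

/-- The unit sphere. -/
abbrev Sph : Type := Metric.sphere (0 : V) 1

instance : IsFiniteMeasure surface := by unfold surface; infer_instance

lemma surface_univ : surface.real univ = 4 * Real.pi := by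
  unfold surface
  rw [Measure.real, Measure.toSphere_apply_univ, EuclideanSpace.volume_ball_fin_three]
  have : (0 : ℝ) ≤ Real.pi * 4 / 3 := by positivity
  simp [this]
  ring

/-- The mean over the unit sphere. -/
def avg (g : Sph → ℝ) : ℝ := 1 / (4 * Real.pi) * ∫ σ, g σ ∂surface

lemma avg_const (c : ℝ) : avg (fun _ => c) = c := by
  have := Real.pi_pos
  simp [avg, surface_univ]
  field_simp

lemma integrable_of_bound {g : Sph → ℝ} (hg : Measurable g) {C : ℝ} (h : ∀ σ, |g σ| ≤ C) :
    Integrable g surface :=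
  Integrable.of_bound hg.aestronglyMeasurable C (Filter.Eventually.of_forall h)

lemma avg_mono {f g : Sph → ℝ} (hf : Integrable f surface) (hg : Integrable g surface)
    (h : ∀ σ, f σ ≤ g σ) : avg f ≤ avg g := by
  have := Real.pi_pos
  exact mul_le_mul_of_nonneg_left (integral_mono hf hg h) (by positivity)

lemma avg_le {g : Sph → ℝ} (hg : Integrable g surface) {C : ℝ} (h : ∀ σ, g σ ≤ C) : avg g ≤ C := by
  have := avg_mono hg (integrable_const C) h
  rwa [avg_const] at this

lemma le_avg {g : Sph → ℝ} (hg : Integrable g surface) {C : ℝ} (h : ∀ σ, C ≤ g σ) : C ≤ avg g := by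
  have := avg_mono (integrable_const C) hg h
  rwa [avg_const] at this

lemma avg_sub_const {g : Sph → ℝ} (hg : Integrable g surface) (c : ℝ) :
    avg (fun σ => g σ - c) = avg g - c := by
  rw [avg, integral_sub hg (integrable_const _), mul_sub]
  exact congrArg (avg g - ·) (avg_const c)

/-! ### Collision geometry -/

/-- The post-collisional velocity `v + κ (|v - w| σ - (v - w))`. -/
def post (κ : ℝ) (v w : V) (σ : Sph) : V := v + κ • (‖v - w‖ • (σ : V) - (v - w))

/-- The post-collisional velocity `w - κ (|v - w| σ - (v - w))` of the partner. -/
def post' (κ : ℝ) (v w : V) (σ : Sph) : V := w - κ • (‖v - w‖ • (σ : V) - (v - w))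

lemma measurable_post (κ : ℝ) : Measurable fun p : (V × V) × Sph => post κ p.1.1 p.1.2 p.2 := by
  unfold post; fun_prop

lemma measurable_post' (κ : ℝ) : Measurable fun p : (V × V) × Sph => post' κ p.1.1 p.1.2 p.2 := by
  unfold post'; fun_prop

lemma measurable_post_right (κ : ℝ) (v w : V) : Measurable (post κ v w) := by
  unfold post; fun_prop

lemma measurable_post'_right (κ : ℝ) (v w : V) : Measurable (post' κ v w) := by
  unfold post'; fun_prop

/-- With z = |q|σ - q, the vectors q and q + z have equal length; expanding |q + z|² = |q|² gives
the identity. -/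
lemma inner_jump (q : V) (σ : Sph) :
    2 * inner ℝ q (‖q‖ • (σ : V) - q) = - ‖‖q‖ • (σ : V) - q‖ ^ 2 := by
  have hσ : ‖(σ : V)‖ = 1 := by simp
  rw [norm_sub_sq_real, norm_smul, hσ, inner_sub_right, real_inner_self_eq_norm_sq,
    real_inner_smul_right, real_inner_smul_left, real_inner_comm (σ : V) q]
  simp only [norm_norm]
  ring

/-- With z the jump of `inner_jump`, the energy changes by exactly -κ(1 - 2κ)|z|². -/
lemma post_energy {κ : ℝ} (h0 : 0 ≤ κ) (h1 : κ ≤ 1 / 2) (v w : V) (σ : Sph) :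
    bracket (post κ v w σ) ^ 2 + bracket (post' κ v w σ) ^ 2 ≤ bracket v ^ 2 + bracket w ^ 2 := by
  simp only [bracket_sq, post, post']
  have h := inner_jump (v - w) σ
  set z : V := ‖v - w‖ • (σ : V) - (v - w) with hz
  rw [norm_add_sq_real, norm_sub_sq_real, norm_smul, real_inner_smul_right, real_inner_smul_right]
  rw [inner_sub_left] at h
  have hκ : ‖κ‖ = κ := by rw [Real.norm_eq_abs, abs_of_nonneg h0]
  rw [hκ]
  have : κ * (2 * (inner ℝ v z - inner ℝ w z)) = κ * (-‖z‖ ^ 2) := by rw [h]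
  nlinarith [mul_nonneg h0 (sq_nonneg ‖z‖), mul_nonneg (mul_nonneg h0 (sub_nonneg.2 h1)) (sq_nonneg ‖z‖)]

/-- By `inner_jump` the change of |v|² is -κ(1 - κ)|z|² + 2κ⟨w, z⟩. Young's inequality absorbs the
last term into the first at the cost m|w|² as soon as κ² ≤ mκ(1 - κ), which `h1` guarantees. The
coefficient one in front of ⟨v⟩² is essential: it is what the loss term cancels. -/
lemma post_growth {κ m : ℝ} (h0 : 0 ≤ κ) (h1 : κ * (1 + m) ≤ m) (hm : 0 < m) (v w : V) (σ : Sph) :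
    bracket (post κ v w σ) ^ 2 ≤ bracket v ^ 2 + m * bracket w ^ 2 := by
  simp only [bracket_sq, post]
  have h := inner_jump (v - w) σ
  set z : V := ‖v - w‖ • (σ : V) - (v - w) with hz
  rw [norm_add_sq_real, norm_smul, real_inner_smul_right]
  rw [inner_sub_left] at h
  have hκ : ‖κ‖ = κ := by rw [Real.norm_eq_abs, abs_of_nonneg h0]
  rw [hκ]
  have hc : 2 * inner ℝ w z ≤ 2 * (‖w‖ * ‖z‖) := by
    linarith [real_inner_le_norm w z]
  have e : κ * (2 * (inner ℝ v z - inner ℝ w z)) = κ * (-‖z‖ ^ 2) := by rw [h]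
  have e2 := mul_le_mul_of_nonneg_left hc h0
  have hκ1 : κ ≤ m * (1 - κ) := by linarith
  have hk1 : 0 ≤ 1 - κ := by
    by_contra hneg
    push Not at hneg
    nlinarith
  have key : κ * (2 * (‖w‖ * ‖z‖)) ≤ κ * (1 - κ) * ‖z‖ ^ 2 + m * ‖w‖ ^ 2 := by
    have hA : κ * (2 * (‖w‖ * ‖z‖)) * m ≤ (κ * (1 - κ) * ‖z‖ ^ 2 + m * ‖w‖ ^ 2) * m := by
      nlinarith [sq_nonneg (κ * ‖z‖ - m * ‖w‖), mul_nonneg (mul_nonneg h0 (sub_nonneg.2 hκ1))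
        (sq_nonneg ‖z‖)]
    exact le_of_mul_le_mul_right hA hm
  nlinarith

/-- The parameters of the model. -/
structure Params (τ ε lam m₁ e : ℝ) : Prop where
  hτ : 0 ≤ τ
  hε₀ : 0 < ε
  hε₁ : ε < 1
  hlam : 0 < lam
  hm₁ : 0 < m₁
  he₀ : 0 < e
  he₁ : e ≤ 1

/-- The coefficient `ζ/2`. -/
def zc (ε : ℝ) : ℝ := (1 + ε) / 2 / 2

/-- The coefficient `α (1 - β)`. -/
def kc (m₁ e : ℝ) : ℝ := m₁ / (1 + m₁) * (1 - (1 - e) / 2)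

section
variable {τ ε lam m₁ e : ℝ}

lemma Params.zc_nonneg (hp : Params τ ε lam m₁ e) : 0 ≤ zc ε := by
  have := hp.hε₀; unfold zc; positivity

lemma Params.zc_le (hp : Params τ ε lam m₁ e) : zc ε ≤ 1 / 2 := by
  have := hp.hε₁; unfold zc; linarith

lemma Params.kc_nonneg (hp : Params τ ε lam m₁ e) : 0 ≤ kc m₁ e := by
  have h1 := hp.he₀; have h2 := hp.hm₁; unfold kc
  have : 0 ≤ 1 - (1 - e) / 2 := by linarith
  positivity

lemma Params.kc_le (hp : Params τ ε lam m₁ e) : kc m₁ e * (1 + m₁) ≤ m₁ := by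
  have h1 := hp.he₁; have h2 := hp.hm₁; unfold kc
  have : m₁ / (1 + m₁) * (1 - (1 - e) / 2) * (1 + m₁) = m₁ * (1 - (1 - e) / 2) := by field_simp
  rw [this]
  nlinarith

/-- The gain part of `granular`. -/
def gainA (ε : ℝ) (ψ : V → ℝ) (v w : V) : ℝ :=
  avg fun σ => ψ (post (zc ε) v w σ) + ψ (post' (zc ε) v w σ)

/-- The gain part of `scattering`. -/
def gainJ (m₁ e : ℝ) (ψ : V → ℝ) (v w : V) : ℝ := avg fun σ => ψ (post (kc m₁ e) v w σ)

lemma Params.sq_post_le (hp : Params τ ε lam m₁ e) (v w : V) (σ : Sph) :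
    bracket (post (zc ε) v w σ) ^ 2 + bracket (post' (zc ε) v w σ) ^ 2
      ≤ bracket v ^ 2 + bracket w ^ 2 :=
  post_energy hp.zc_nonneg hp.zc_le v w σ

lemma Params.sq_post_le' (hp : Params τ ε lam m₁ e) (v w : V) (σ : Sph) :
    bracket (post (kc m₁ e) v w σ) ^ 2 ≤ bracket v ^ 2 + m₁ * bracket w ^ 2 :=
  post_growth hp.kc_nonneg hp.kc_le hp.hm₁ v w σ

/-- A measurable test function of at most quadratic growth. -/
structure Dom (C : ℝ) (ψ : V → ℝ) : Prop where
  meas : Measurable ψ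
  le : ∀ v, |ψ v| ≤ C * bracket v ^ 2

lemma Dom.nonneg {C : ℝ} {ψ : V → ℝ} (h : Dom C ψ) : 0 ≤ C :=
  nonneg_of_mul_nonneg_left ((abs_nonneg _).trans (h.le 0)) (bracket_pow_pos 2 0)

lemma dom_sq : Dom 1 (fun v => bracket v ^ 2) :=
  ⟨measurable_bracket.pow_const 2, fun v => by rw [abs_of_pos (bracket_pow_pos 2 v), one_mul]⟩

lemma Dom.abs_post (hp : Params τ ε lam m₁ e) {C : ℝ} {ψ : V → ℝ} (h : Dom C ψ) (v w : V)
    (σ : Sph) : |ψ (post (zc ε) v w σ) + ψ (post' (zc ε) v w σ)| ≤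
      C * (bracket v ^ 2 + bracket w ^ 2) := by
  have := mul_le_mul_of_nonneg_left (hp.sq_post_le v w σ) h.nonneg
  have h1 := abs_add_le (ψ (post (zc ε) v w σ)) (ψ (post' (zc ε) v w σ))
  linarith [h.le (post (zc ε) v w σ), h.le (post' (zc ε) v w σ)]

lemma Dom.abs_postJ (hp : Params τ ε lam m₁ e) {C : ℝ} {ψ : V → ℝ} (h : Dom C ψ) (v w : V)
    (σ : Sph) : |ψ (post (kc m₁ e) v w σ)| ≤ C * (bracket v ^ 2 + m₁ * bracket w ^ 2) :=
  (h.le _).trans (mul_le_mul_of_nonneg_left (hp.sq_post_le' v w σ) h.nonneg)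

lemma Dom.integrable_A (hp : Params τ ε lam m₁ e) {C : ℝ} {ψ : V → ℝ} (h : Dom C ψ) (v w : V) :
    Integrable (fun σ => ψ (post (zc ε) v w σ) + ψ (post' (zc ε) v w σ)) surface :=
  integrable_of_bound ((h.meas.comp (measurable_post_right _ v w)).add
    (h.meas.comp (measurable_post'_right _ v w))) (h.abs_post hp v w)

lemma Dom.integrable_J (hp : Params τ ε lam m₁ e) {C : ℝ} {ψ : V → ℝ} (h : Dom C ψ) (v w : V) :
    Integrable (fun σ => ψ (post (kc m₁ e) v w σ)) surface :=
  integrable_of_bound (h.meas.comp (measurable_post_right _ v w)) (h.abs_postJ hp v w)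

lemma Dom.granular_eq (hp : Params τ ε lam m₁ e) {C : ℝ} {ψ : V → ℝ} (h : Dom C ψ) (v w : V) :
    granular ε ψ v w = gainA ε ψ v w - ψ v - ψ w := by
  have := avg_sub_const (h.integrable_A hp v w) (ψ v + ψ w)
  rw [sub_sub, gainA, ← this]
  simp only [granular, avg, post, post', zc, sub_sub]

lemma Dom.scattering_eq (hp : Params τ ε lam m₁ e) {C : ℝ} {ψ : V → ℝ} (h : Dom C ψ) (v w : V) :
    scattering m₁ e ψ v w = gainJ m₁ e ψ v w - ψ v := by
  have := avg_sub_const (h.integrable_J hp v w) (ψ v)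
  rw [gainJ, ← this]
  have key : ∀ σ : Sph, v - (m₁ / (1 + m₁) * (1 - (1 - e) / 2)) • ((v - w) - ‖v - w‖ • (σ : V))
      = v + (m₁ / (1 + m₁) * (1 - (1 - e) / 2)) • (‖v - w‖ • (σ : V) - (v - w)) := by
    intro σ
    module
  simp only [scattering, avg, post, kc, key]

lemma measurable_gainA {ψ : V → ℝ} (h : Measurable ψ) :
    Measurable fun p : V × V => gainA ε ψ p.1 p.2 := by
  unfold gainA avg
  refine Measurable.const_mul ?_ _
  have hm : Measurable fun p : (V × V) × Sph =>
      ψ (post (zc ε) p.1.1 p.1.2 p.2) + ψ (post' (zc ε) p.1.1 p.1.2 p.2) :=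
    (h.comp (measurable_post _)).add (h.comp (measurable_post' _))
  exact (hm.stronglyMeasurable.integral_prod_right (ν := surface)).measurable

lemma measurable_gainJ {ψ : V → ℝ} (h : Measurable ψ) :
    Measurable fun p : V × V => gainJ m₁ e ψ p.1 p.2 := by
  unfold gainJ avg
  refine Measurable.const_mul ?_ _
  have hm : Measurable fun p : (V × V) × Sph => ψ (post (kc m₁ e) p.1.1 p.1.2 p.2) :=
    h.comp (measurable_post _)
  exact (hm.stronglyMeasurable.integral_prod_right (ν := surface)).measurable

lemma Dom.gainA_le (hp : Params τ ε lam m₁ e) {C : ℝ} {ψ : V → ℝ} (h : Dom C ψ) (v w : V) :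
    |gainA ε ψ v w| ≤ C * (bracket v ^ 2 + bracket w ^ 2) := by
  rw [abs_le]
  exact ⟨le_avg (h.integrable_A hp v w) fun σ => (abs_le.1 (h.abs_post hp v w σ)).1,
    avg_le (h.integrable_A hp v w) fun σ => (abs_le.1 (h.abs_post hp v w σ)).2⟩

lemma Dom.gainJ_le (hp : Params τ ε lam m₁ e) {C : ℝ} {ψ : V → ℝ} (h : Dom C ψ) (v w : V) :
    |gainJ m₁ e ψ v w| ≤ C * (bracket v ^ 2 + m₁ * bracket w ^ 2) := by
  rw [abs_le]
  exact ⟨le_avg (h.integrable_J hp v w) fun σ => (abs_le.1 (h.abs_postJ hp v w σ)).1,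
    avg_le (h.integrable_J hp v w) fun σ => (abs_le.1 (h.abs_postJ hp v w σ)).2⟩

end

/-! ### Bilinear forms -/

/-- The bilinear form with kernel `K`. -/
def form (K : V → V → ℝ) (f g : V → ℝ) : ℝ := ∫ p : V × V, f p.1 * g p.2 * K p.1 p.2

/-- A measurable kernel bounded by `C ⟨v⟩^k ⟨w⟩^k`. -/
structure KBound (k : ℕ) (C : ℝ) (K : V → V → ℝ) : Prop where
  meas : Measurable fun p : V × V => K p.1 p.2
  le : ∀ v w, |K v w| ≤ C * (bracket v ^ k * bracket w ^ k)

lemma ae_fst {p : V → Prop} (h : ∀ᵐ v, p v) : ∀ᵐ x : V × V, p x.1 :=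
  Measure.quasiMeasurePreserving_fst.ae h

lemma ae_snd {p : V → Prop} (h : ∀ᵐ v, p v) : ∀ᵐ x : V × V, p x.2 :=
  Measure.quasiMeasurePreserving_snd.ae h

lemma integrable_prod_nrm {i j : ℕ} {f g : V → ℝ} (hf : Mom i f) (hg : Mom j g) (C : ℝ) :
    Integrable (fun p : V × V => C * ((|f p.1| * bracket p.1 ^ i) * (|g p.2| * bracket p.2 ^ j))) :=
  (Integrable.mul_prod hf.integrable_abs hg.integrable_abs).const_mul C

lemma integral_prod_nrm {i j : ℕ} (f g : V → ℝ) (C : ℝ) :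
    ∫ p : V × V, C * ((|f p.1| * bracket p.1 ^ i) * (|g p.2| * bracket p.2 ^ j))
      = C * (nrm i f * nrm j g) := by
  rw [integral_const_mul]
  congr 1
  exact integral_prod_mul (fun v => |f v| * bracket v ^ i) (fun v => |g v| * bracket v ^ j)

section form
variable {k : ℕ} {C : ℝ} {K : V → V → ℝ} {f g f' g' : V → ℝ}

lemma KBound.norm_le (hK : KBound k C K) (f g : V → ℝ) (p : V × V) :
    ‖f p.1 * g p.2 * K p.1 p.2‖ ≤
      C * ((|f p.1| * bracket p.1 ^ k) * (|g p.2| * bracket p.2 ^ k)) := by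
  rw [Real.norm_eq_abs, abs_mul, abs_mul]
  calc _ ≤ |f p.1| * |g p.2| * (C * (bracket p.1 ^ k * bracket p.2 ^ k)) := by
        gcongr; exact hK.le _ _
    _ = _ := by ring

lemma KBound.aesm (hK : KBound k C K) (hf : Mom k f) (hg : Mom k g) :
    AEStronglyMeasurable (fun p : V × V => f p.1 * g p.2 * K p.1 p.2) :=
  ((hf.aesm.comp_fst).mul (hg.aesm.comp_snd)).mul hK.meas.aestronglyMeasurable

lemma KBound.integrable (hK : KBound k C K) (hf : Mom k f) (hg : Mom k g) :
    Integrable (fun p : V × V => f p.1 * g p.2 * K p.1 p.2) :=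
  (integrable_prod_nrm hf hg C).mono' (hK.aesm hf hg)
    (Filter.Eventually.of_forall fun p => hK.norm_le f g p)

lemma KBound.form_le (hK : KBound k C K) (hf : Mom k f) (hg : Mom k g) :
    |form K f g| ≤ C * (nrm k f * nrm k g) := by
  rw [← integral_prod_nrm, ← Real.norm_eq_abs, form]
  exact norm_integral_le_of_norm_le (integrable_prod_nrm hf hg C)
    (Filter.Eventually.of_forall fun p => hK.norm_le f g p)

lemma KBound.form_sub_left (hK : KBound k C K) (hf : Mom k f) (hf' : Mom k f') (hg : Mom k g) :
    form K (fun v => f v - f' v) g = form K f g - form K f' g := by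
  rw [form, form, form, ← integral_sub (hK.integrable hf hg) (hK.integrable hf' hg)]
  congr 1; ext p; ring

lemma KBound.form_sub_right (hK : KBound k C K) (hf : Mom k f) (hg : Mom k g) (hg' : Mom k g') :
    form K f (fun v => g v - g' v) = form K f g - form K f g' := by
  rw [form, form, form, ← integral_sub (hK.integrable hf hg) (hK.integrable hf hg')]
  congr 1; ext p; ring

lemma form_swap (K : V → V → ℝ) (f g : V → ℝ) : form K f g = form (fun v w => K w v) g f := by
  rw [form, form, Measure.volume_eq_prod, ← integral_prod_swap]
  congr 1; ext p; simp only [Prod.fst_swap, Prod.snd_swap]; ring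

lemma KBound.swap (hK : KBound k C K) : KBound k C (fun v w => K w v) :=
  ⟨hK.meas.comp measurable_swap, fun v w => by rw [mul_comm (bracket v ^ k)]; exact hK.le w v⟩

lemma KBound.abs_form_sub_le (hK : KBound k C K) (hf : Mom k f) (hf' : Mom k f') (hg : Mom k g)
    (hg' : Mom k g') : |form K f g - form K f' g'| ≤
      C * (nrm k (fun v => f v - f' v) * nrm k g + nrm k f' * nrm k (fun v => g v - g' v)) := by
  have e : form K f g - form K f' g' =
      form K (fun v => f v - f' v) g + form K f' (fun v => g v - g' v) := by
    rw [hK.form_sub_left hf hf' hg, hK.form_sub_right hf' hg hg']; ring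
  rw [e, mul_add]
  exact (abs_add_le _ _).trans (add_le_add (hK.form_le (hf.sub hf') hg)
    (hK.form_le hf' (hg.sub hg')))

end form

/-! ### The collision kernels -/

section kernels
variable {τ ε lam m₁ e : ℝ}

/-- The kernel of the quadratic part. -/
def qK (ε : ℝ) (ψ : V → ℝ) (v w : V) : ℝ := ‖v - w‖ * granular ε ψ v w

/-- The kernel of the linear part. -/
def lK (m₁ e : ℝ) (ψ : V → ℝ) (v w : V) : ℝ := ‖v - w‖ * scattering m₁ e ψ v w

/-- Test functions for which both collision kernels are controlled by moments of order `k`. -/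
structure Ker (ε m₁ e : ℝ) (k : ℕ) (A J : ℝ) (ψ : V → ℝ) : Prop where
  q : KBound k A (qK ε ψ)
  l : KBound k J (lK m₁ e ψ)

lemma Dom.measurable_qK (hp : Params τ ε lam m₁ e) {C : ℝ} {ψ : V → ℝ} (h : Dom C ψ) :
    Measurable fun p : V × V => qK ε ψ p.1 p.2 := by
  simp only [qK, h.granular_eq hp]
  have h1 := measurable_gainA (ε := ε) h.meas
  have h2 := h.meas
  fun_prop

lemma Dom.measurable_lK (hp : Params τ ε lam m₁ e) {C : ℝ} {ψ : V → ℝ} (h : Dom C ψ) :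
    Measurable fun p : V × V => lK m₁ e ψ p.1 p.2 := by
  simp only [lK, h.scattering_eq hp]
  have h1 := measurable_gainJ (m₁ := m₁) (e := e) h.meas
  have h2 := h.meas
  fun_prop

lemma Dom.abs_granular_le (hp : Params τ ε lam m₁ e) {C : ℝ} {ψ : V → ℝ} (h : Dom C ψ) (v w : V) :
    |granular ε ψ v w| ≤ 2 * C * (bracket v ^ 2 + bracket w ^ 2) := by
  rw [h.granular_eq hp]
  have h1 := h.gainA_le hp v w
  have h2 := h.le v
  have h3 := h.le w
  rw [abs_le] at *
  constructor <;> linarith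

lemma Dom.abs_scattering_le (hp : Params τ ε lam m₁ e) {C : ℝ} {ψ : V → ℝ} (h : Dom C ψ)
    (v w : V) : |scattering m₁ e ψ v w| ≤ C * (2 * bracket v ^ 2 + m₁ * bracket w ^ 2) := by
  rw [h.scattering_eq hp]
  have h1 := h.gainJ_le hp v w
  have h2 := h.le v
  rw [abs_le] at *
  constructor <;> linarith

lemma add_le_two_mul {x y : ℝ} (hx : 1 ≤ x) (hy : 1 ≤ y) : x + y ≤ 2 * (x * y) := by nlinarith

lemma Dom.ker (hp : Params τ ε lam m₁ e) {C : ℝ} {ψ : V → ℝ} (h : Dom C ψ) :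
    Ker ε m₁ e 3 (8 * C) (2 * (2 + m₁) * C) ψ := by
  have hC := h.nonneg
  have hm := hp.hm₁.le
  refine ⟨⟨h.measurable_qK hp, fun v w => ?_⟩, ⟨h.measurable_lK hp, fun v w => ?_⟩⟩
  · have ha := one_le_bracket_pow 2 v
    have hb := one_le_bracket_pow 2 w
    have ha0 := bracket_pos v
    have hb0 := bracket_pos w
    rw [qK, abs_mul, abs_norm]
    calc ‖v - w‖ * |granular ε ψ v w|
        ≤ (2 * (bracket v * bracket w)) * (2 * C * (2 * (bracket v ^ 2 * bracket w ^ 2))) := by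
          refine mul_le_mul (norm_sub_le_bracket_mul v w) ((h.abs_granular_le hp v w).trans ?_)
            (abs_nonneg _) (by positivity)
          exact mul_le_mul_of_nonneg_left (add_le_two_mul ha hb) (by positivity)
      _ = _ := by ring
  · have ha := one_le_bracket_pow 2 v
    have hb := one_le_bracket_pow 2 w
    have ha0 := bracket_pos v
    have hb0 := bracket_pos w
    rw [lK, abs_mul, abs_norm]
    calc ‖v - w‖ * |scattering m₁ e ψ v w|
        ≤ (2 * (bracket v * bracket w)) * (C * ((2 + m₁) * (bracket v ^ 2 * bracket w ^ 2))) := by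
          refine mul_le_mul (norm_sub_le_bracket_mul v w) ((h.abs_scattering_le hp v w).trans ?_)
            (abs_nonneg _) (by positivity)
          refine mul_le_mul_of_nonneg_left ?_ hC
          nlinarith [mul_nonneg hm (mul_nonneg (sub_nonneg.2 ha) (sub_nonneg.2 hb)),
            mul_nonneg hm (sub_nonneg.2 ha), mul_nonneg hm (sub_nonneg.2 hb),
            mul_nonneg (sub_nonneg.2 ha) (sub_nonneg.2 hb)]
      _ = _ := by ring

lemma dom_of_bounded {C : ℝ} {ψ : V → ℝ} (hm : Measurable ψ) (h : ∀ v, |ψ v| ≤ C) : Dom C ψ := by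
  refine ⟨hm, fun v => (h v).trans ?_⟩
  have hC : 0 ≤ C := (abs_nonneg _).trans (h v)
  nlinarith [one_le_bracket_pow 2 v]

/-- For bounded ψ only the factor |v - w| grows, so second moments suffice, against third ones in
`Dom.ker`. This is what makes the weak right-hand side continuous on `L¹_2`. -/
lemma ker_of_bounded (hp : Params τ ε lam m₁ e) {C : ℝ} {ψ : V → ℝ} (hm : Measurable ψ)
    (h : ∀ v, |ψ v| ≤ C) : Ker ε m₁ e 2 (8 * C) (4 * C) ψ := by
  have hd := dom_of_bounded hm h
  have hC := hd.nonneg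
  refine ⟨⟨hd.measurable_qK hp, fun v w => ?_⟩, ⟨hd.measurable_lK hp, fun v w => ?_⟩⟩
  · have ha := one_le_bracket v
    have hb := one_le_bracket w
    have h1 : |granular ε ψ v w| ≤ 4 * C := by
      rw [hd.granular_eq hp]
      have h1 : |gainA ε ψ v w| ≤ 2 * C := by
        have hx : ∀ σ, |ψ (post (zc ε) v w σ) + ψ (post' (zc ε) v w σ)| ≤ 2 * C := fun σ => by
          linarith [abs_add_le (ψ (post (zc ε) v w σ)) (ψ (post' (zc ε) v w σ)),
            h (post (zc ε) v w σ), h (post' (zc ε) v w σ)]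
        rw [abs_le]
        exact ⟨le_avg (hd.integrable_A hp v w) fun σ => (abs_le.1 (hx σ)).1,
          avg_le (hd.integrable_A hp v w) fun σ => (abs_le.1 (hx σ)).2⟩
      have h2 := h v
      have h3 := h w
      rw [abs_le] at *
      constructor <;> linarith
    rw [qK, abs_mul, abs_norm]
    have hab : bracket v * bracket w ≤ bracket v ^ 2 * bracket w ^ 2 := by
      rw [← mul_pow]; nlinarith [one_le_mul_of_one_le_of_one_le ha hb]
    calc ‖v - w‖ * |granular ε ψ v w|
        ≤ (2 * (bracket v ^ 2 * bracket w ^ 2)) * (4 * C) :=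
          mul_le_mul ((norm_sub_le_bracket_mul v w).trans (by linarith)) h1
            (abs_nonneg _) (by positivity)
      _ = _ := by ring
  · have ha := one_le_bracket v
    have hb := one_le_bracket w
    have h1 : |scattering m₁ e ψ v w| ≤ 2 * C := by
      rw [hd.scattering_eq hp]
      have h1 : |gainJ m₁ e ψ v w| ≤ C := by
        rw [abs_le]
        exact ⟨le_avg (hd.integrable_J hp v w) fun σ => (abs_le.1 (h _)).1,
          avg_le (hd.integrable_J hp v w) fun σ => (abs_le.1 (h _)).2⟩
      have h2 := h v
      rw [abs_le] at *
      constructor <;> linarith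
    rw [lK, abs_mul, abs_norm]
    have hab : bracket v * bracket w ≤ bracket v ^ 2 * bracket w ^ 2 := by
      rw [← mul_pow]; nlinarith [one_le_mul_of_one_le_of_one_le ha hb]
    calc ‖v - w‖ * |scattering m₁ e ψ v w|
        ≤ (2 * (bracket v ^ 2 * bracket w ^ 2)) * (2 * C) :=
          mul_le_mul ((norm_sub_le_bracket_mul v w).trans (by linarith)) h1
            (abs_nonneg _) (by positivity)
      _ = _ := by ring

/-! ### The weak right-hand side -/

lemma Ker.weakRHS_eq {k : ℕ} {A J : ℝ} {ψ F f : V → ℝ} (h : Ker ε m₁ e k A J ψ) (hF : Mom k F)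
    (hf : Mom k f) : weakRHS τ ε lam m₁ e F f ψ =
      τ / 2 * form (qK ε ψ) f f + 1 / lam * form (lK m₁ e ψ) f F := by
  rw [weakRHS, form, form]
  rw [Measure.volume_eq_prod, integral_prod _ (h.q.integrable hf hf),
    integral_prod _ (h.l.integrable hf hF)]
  simp only [qK, lK]
  congr 2
  · congr 1; ext v; congr 1; ext w; ring
  · congr 1; ext v; congr 1; ext w; ring

/-- The weak right-hand side is locally Lipschitz. -/
lemma Ker.abs_weakRHS_sub_le (hp : Params τ ε lam m₁ e) {k : ℕ} {A J : ℝ} {ψ F F' f f' : V → ℝ}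
    (h : Ker ε m₁ e k A J ψ) (hF : Mom k F) (hF' : Mom k F') (hf : Mom k f) (hf' : Mom k f') :
    |weakRHS τ ε lam m₁ e F f ψ - weakRHS τ ε lam m₁ e F' f' ψ| ≤
      (τ / 2 * A * (nrm k f + nrm k f') + 1 / lam * J * nrm k F) * nrm k (fun v => f v - f' v)
        + 1 / lam * J * nrm k f' * nrm k (fun v => F v - F' v) := by
  rw [h.weakRHS_eq hF hf, h.weakRHS_eq hF' hf']
  have h1 := h.q.abs_form_sub_le hf hf' hf hf'
  have h2 := h.l.abs_form_sub_le hf hf' hF hF'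
  have hτ : 0 ≤ τ / 2 := by have := hp.hτ; linarith
  have hl : 0 ≤ 1 / lam := by have := hp.hlam; positivity
  have e1 := mul_le_mul_of_nonneg_left h1 hτ
  have e2 := mul_le_mul_of_nonneg_left h2 hl
  rw [← abs_of_nonneg hτ, ← abs_mul, abs_of_nonneg hτ] at e1
  rw [← abs_of_nonneg hl, ← abs_mul, abs_of_nonneg hl] at e2
  have e3 := abs_add_le (τ / 2 * (form (qK ε ψ) f f - form (qK ε ψ) f' f'))
    (1 / lam * (form (lK m₁ e ψ) f F - form (lK m₁ e ψ) f' F'))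
  calc _ = |τ / 2 * (form (qK ε ψ) f f - form (qK ε ψ) f' f') +
      1 / lam * (form (lK m₁ e ψ) f F - form (lK m₁ e ψ) f' F')| := by congr 1; ring
    _ ≤ _ := e3
    _ ≤ _ := add_le_add e1 e2
    _ = _ := by ring

/-- The loss terms are dominated by a multiple of the density. -/
lemma Dom.weakRHS_lower (hp : Params τ ε lam m₁ e) {C : ℝ} {ψ : V → ℝ} (h : Dom C ψ)
    (hψ : ∀ v, 0 ≤ ψ v) {F g : V → ℝ} (hF : Mom 3 F) (hF0 : 0 ≤ᵐ[volume] F) (hg : Mom 2 g)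
    (hg0 : 0 ≤ᵐ[volume] g) {r : ℝ} (hr : 0 ≤ r) :
    - (2 * r * (τ * nrm 0 g + 1 / lam * nrm 0 F)) * ∫ v, g v * ψ v ≤
      weakRHS τ ε lam m₁ e ((ballS r).indicator F) ((ballS r).indicator g) ψ := by
  have hk := h.ker hp
  have hS := measurableSet_ballS r
  have hχg : Mom 3 ((ballS r).indicator g) := mom_indicator_ballS (j := 1) hg
  have hχF := hF.indicator hS
  rw [hk.weakRHS_eq hχF hχg]
  have hgψ : Integrable (fun v => g v * ψ v) := hg.mul_dom h.meas h.le
  have hq : ∀ v ∈ ballS r, ∀ w ∈ ballS r, ‖v - w‖ ≤ 2 * r := fun v hv w hw => by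
    have h1 : bracket v ≤ r := hv
    have h2 : bracket w ≤ r := hw
    linarith [norm_sub_le_bracket_add v w]
  have n0 : ∀ f : V → ℝ, 0 ≤ᵐ[volume] f → ∫ v, f v = nrm 0 f := fun f hf => by
    refine integral_congr_ae ?_
    filter_upwards [hf] with v hv
    have hv' : 0 ≤ f v := hv
    simp [abs_of_nonneg hv']
  have b1 : - (2 * r) * ((∫ v, g v * ψ v) * nrm 0 g + nrm 0 g * ∫ v, g v * ψ v) ≤
      form (qK ε ψ) ((ballS r).indicator g) ((ballS r).indicator g) := by
    rw [← n0 g hg0]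
    have i1 : Integrable (fun p : V × V => g p.1 * ψ p.1 * g p.2) := hgψ.mul_prod hg.integrable
    have i2 : Integrable (fun p : V × V => g p.1 * (g p.2 * ψ p.2)) := hg.integrable.mul_prod hgψ
    have e1 : (∫ v, g v * ψ v) * (∫ v, g v) = ∫ p : V × V, g p.1 * ψ p.1 * g p.2 :=
      (integral_prod_mul (fun v => g v * ψ v) g).symm
    have e2 : (∫ v, g v) * (∫ v, g v * ψ v) = ∫ p : V × V, g p.1 * (g p.2 * ψ p.2) :=
      (integral_prod_mul g (fun v => g v * ψ v)).symm
    rw [e1, e2, ← integral_add i1 i2, ← integral_const_mul]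
    refine integral_mono_ae ((i1.add i2).const_mul _) (hk.q.integrable hχg hχg) ?_
    filter_upwards [ae_fst hg0, ae_snd hg0] with p hp1 hp2
    have h1 : 0 ≤ g p.1 := hp1
    have h2 : 0 ≤ g p.2 := hp2
    have k1 := hψ p.1
    have k2 := hψ p.2
    have hpos : 0 ≤ g p.1 * ψ p.1 * g p.2 + g p.1 * (g p.2 * ψ p.2) := by positivity
    -- On the ball the gain is nonnegative and is dropped, while the loss is bounded with |v - w| ≤
    -- 2r. Off the ball the truncated integrand vanishes.
    by_cases m1 : p.1 ∈ ballS r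
    · by_cases m2 : p.2 ∈ ballS r
      · simp only [indicator_of_mem m1, indicator_of_mem m2, qK, h.granular_eq hp]
        have hG : 0 ≤ gainA ε ψ p.1 p.2 := le_avg (h.integrable_A hp _ _) fun σ =>
          add_nonneg (hψ _) (hψ _)
        have := hq _ m1 _ m2
        have a1 : 0 ≤ g p.1 * g p.2 * (‖p.1 - p.2‖ * gainA ε ψ p.1 p.2) := by positivity
        nlinarith [mul_nonneg (sub_nonneg.2 this) hpos]
      · simp only [indicator_of_notMem m2, mul_zero, zero_mul]
        nlinarith
    · simp only [indicator_of_notMem m1, zero_mul]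
      nlinarith
  have b2 : - (2 * r) * ((∫ v, g v * ψ v) * nrm 0 F) ≤
      form (lK m₁ e ψ) ((ballS r).indicator g) ((ballS r).indicator F) := by
    rw [← n0 F hF0]
    have i1 : Integrable (fun p : V × V => g p.1 * ψ p.1 * F p.2) := hgψ.mul_prod hF.integrable
    have e1 : (∫ v, g v * ψ v) * (∫ v, F v) = ∫ p : V × V, g p.1 * ψ p.1 * F p.2 :=
      (integral_prod_mul (fun v => g v * ψ v) F).symm
    rw [e1, ← integral_const_mul]
    refine integral_mono_ae (i1.const_mul _) (hk.l.integrable hχg hχF) ?_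
    filter_upwards [ae_fst hg0, ae_snd hF0] with p hp1 hp2
    have h1 : 0 ≤ g p.1 := hp1
    have h2 : 0 ≤ F p.2 := hp2
    have k1 := hψ p.1
    have hpos : 0 ≤ g p.1 * ψ p.1 * F p.2 := by positivity
    by_cases m1 : p.1 ∈ ballS r
    · by_cases m2 : p.2 ∈ ballS r
      · simp only [indicator_of_mem m1, indicator_of_mem m2, lK, h.scattering_eq hp]
        have hG : 0 ≤ gainJ m₁ e ψ p.1 p.2 := le_avg (h.integrable_J hp _ _) fun σ => hψ _
        have := hq _ m1 _ m2
        have a1 : 0 ≤ g p.1 * F p.2 * (‖p.1 - p.2‖ * gainJ m₁ e ψ p.1 p.2) := by positivity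
        nlinarith [mul_nonneg (sub_nonneg.2 this) hpos]
      · simp only [indicator_of_notMem m2, mul_zero, zero_mul]
        nlinarith
    · simp only [indicator_of_notMem m1, zero_mul]
      nlinarith
  have hτ : 0 ≤ τ / 2 := by have := hp.hτ; linarith
  have hl : 0 ≤ 1 / lam := by have := hp.hlam; positivity
  have e1 := mul_le_mul_of_nonneg_left b1 hτ
  have e2 := mul_le_mul_of_nonneg_left b2 hl
  linarith

/-- An upper bound from pointwise bounds on the kernels. -/
lemma Dom.weakRHS_upper (hp : Params τ ε lam m₁ e) {C : ℝ} {ψ : V → ℝ} (h : Dom C ψ)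
    {F f : V → ℝ} {i j l : ℕ} {A J : ℝ} (hA : 0 ≤ A) (hJ : 0 ≤ J) {r : ℝ}
    (hF3 : Mom 3 F) (hF : Mom l F) (hF0 : 0 ≤ᵐ[volume] F)
    (hf2 : Mom 2 f) (hfj : Mom j f) (hfi : Mom i ((ballS r).indicator f)) (hf0 : 0 ≤ᵐ[volume] f)
    (hq : ∀ v ∈ ballS r, ∀ w ∈ ballS r, qK ε ψ v w ≤
      A * (bracket v ^ i * bracket w ^ j + bracket v ^ j * bracket w ^ i))
    (hl : ∀ v ∈ ballS r, ∀ w ∈ ballS r, lK m₁ e ψ v w ≤ J * (bracket v ^ i * bracket w ^ l)) :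
    weakRHS τ ε lam m₁ e ((ballS r).indicator F) ((ballS r).indicator f) ψ ≤
      (τ * A * nrm j f + 1 / lam * J * nrm l F) * nrm i ((ballS r).indicator f) := by
  have hk := h.ker hp
  have hS := measurableSet_ballS r
  have hχf : Mom 3 ((ballS r).indicator f) := mom_indicator_ballS (j := 1) hf2
  have hχF := hF3.indicator hS
  rw [hk.weakRHS_eq hχF hχf]
  -- The two terms of the symmetric majorant integrate to the same product, which turns τ/2 into τ.
  -- The truncation is kept only in the factor of order i.
  have b1 : form (qK ε ψ) ((ballS r).indicator f) ((ballS r).indicator f) ≤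
      A * (nrm i ((ballS r).indicator f) * nrm j f) +
        A * (nrm j f * nrm i ((ballS r).indicator f)) := by
    rw [← integral_prod_nrm, ← integral_prod_nrm,
      ← integral_add (integrable_prod_nrm hfi hfj A) (integrable_prod_nrm hfj hfi A)]
    refine integral_mono_ae (hk.q.integrable hχf hχf)
      ((integrable_prod_nrm hfi hfj A).add (integrable_prod_nrm hfj hfi A)) ?_
    filter_upwards [ae_fst hf0, ae_snd hf0] with p hp1 hp2
    have h1 : 0 ≤ f p.1 := hp1
    have h2 : 0 ≤ f p.2 := hp2
    have w1 := bracket_pos p.1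
    have w2 := bracket_pos p.2
    by_cases m1 : p.1 ∈ ballS r
    · by_cases m2 : p.2 ∈ ballS r
      · simp only [indicator_of_mem m1, indicator_of_mem m2, abs_of_nonneg h1, abs_of_nonneg h2]
        have := mul_le_mul_of_nonneg_left (hq _ m1 _ m2) (mul_nonneg h1 h2)
        linarith
      · simp only [indicator_of_notMem m2, mul_zero, zero_mul]
        positivity
    · simp only [indicator_of_notMem m1, zero_mul]
      positivity
  have b2 : form (lK m₁ e ψ) ((ballS r).indicator f) ((ballS r).indicator F) ≤
      J * (nrm i ((ballS r).indicator f) * nrm l F) := by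
    rw [← integral_prod_nrm]
    refine integral_mono_ae (hk.l.integrable hχf hχF) (integrable_prod_nrm hfi hF J) ?_
    filter_upwards [ae_fst hf0, ae_snd hF0] with p hp1 hp2
    have h1 : 0 ≤ f p.1 := hp1
    have h2 : 0 ≤ F p.2 := hp2
    have w1 := bracket_pos p.1
    have w2 := bracket_pos p.2
    by_cases m1 : p.1 ∈ ballS r
    · by_cases m2 : p.2 ∈ ballS r
      · simp only [indicator_of_mem m1, indicator_of_mem m2, abs_of_nonneg h1, abs_of_nonneg h2]
        have := mul_le_mul_of_nonneg_left (hl _ m1 _ m2) (mul_nonneg h1 h2)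
        linarith
      · simp only [indicator_of_notMem m2, mul_zero, zero_mul]
        positivity
    · simp only [indicator_of_notMem m1, zero_mul]
      positivity
  have hτ : 0 ≤ τ / 2 := by have := hp.hτ; linarith
  have hl : 0 ≤ 1 / lam := by have := hp.hlam; positivity
  have e1 := mul_le_mul_of_nonneg_left b1 hτ
  have e2 := mul_le_mul_of_nonneg_left b2 hl
  linarith

end kernels

/-! ### Stability and moment inequalities for the truncated weak form -/

section estimates
variable {τ ε lam m₁ e : ℝ}

/-- The constant of the stability estimate. -/
def stabC (τ lam m₁ : ℝ) (F u h : V → ℝ) : ℝ :=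
  4 * τ * nrm 3 u + 2 * m₁ * (1 / lam) * nrm 3 F + 4 * τ * nrm 3 h

/-- The defect d = |h|⟨v⟩² - hψ is nonnegative and would vanish for ψ = sgn(h)⟨v⟩². Replacing the
loss -hψ by d - |h|⟨v⟩² cancels the dangerous part of the gain. The defect is then multiplied by |v
- w| ≤ 2r, and everything else is controlled by third moments independently of r. -/
lemma Dom.stability (hp : Params τ ε lam m₁ e) {ψ : V → ℝ} (hd : Dom 1 ψ) {F u h : V → ℝ}
    (hF : Mom 3 F) (hF0 : 0 ≤ᵐ[volume] F) (hu : Mom 3 u) (hu0 : 0 ≤ᵐ[volume] u) (hh : Mom 3 h)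
    {r : ℝ} (hr : 0 ≤ r) :
    weakRHS τ ε lam m₁ e ((ballS r).indicator F) ((ballS r).indicator (fun v => u v + h v)) ψ
      - weakRHS τ ε lam m₁ e ((ballS r).indicator F) ((ballS r).indicator u) ψ ≤
    2 * r * (τ * nrm 0 u + 1 / lam * nrm 0 F) * (nrm 2 h - ∫ v, h v * ψ v) +
      stabC τ lam m₁ F u h * nrm 2 h := by
  have hk := hd.ker hp
  have hS := measurableSet_ballS r
  have hχu := hu.indicator hS
  have hχh := hh.indicator hS
  have hχF := hF.indicator hS
  have hm := hp.hm₁.le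
  have hind : (ballS r).indicator (fun v => u v + h v) =
      fun v => (ballS r).indicator u v + (ballS r).indicator h v := by
    rw [← indicator_add]
  rw [hind, hk.weakRHS_eq hχF (hχu.add hχh), hk.weakRHS_eq hχF hχu]
  set χu := (ballS r).indicator u with hχu'
  set χh := (ballS r).indicator h with hχh'
  set χF := (ballS r).indicator F with hχF'
  set d : V → ℝ := fun v => |h v| * bracket v ^ 2 - h v * ψ v with hdd
  have h2 : Mom 2 h := hh.of_le (by norm_num)
  have hhψ : Integrable (fun v => h v * ψ v) := h2.mul_dom hd.meas hd.le
  have hdi : Integrable d := h2.integrable_abs.sub hhψ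
  have hd0 : ∀ v, 0 ≤ d v := fun v => by
    have h1 := hd.le v
    rw [one_mul] at h1
    have h2 : h v * ψ v ≤ |h v| * |ψ v| := by rw [← abs_mul]; exact le_abs_self _
    have := mul_le_mul_of_nonneg_left h1 (abs_nonneg (h v))
    simp only [hdd]; linarith
  have hdint : ∫ v, d v = nrm 2 h - ∫ v, h v * ψ v := integral_sub h2.integrable_abs hhψ
  rw [← hdint]
  have hq : ∀ v ∈ ballS r, ∀ w ∈ ballS r, ‖v - w‖ ≤ 2 * r := fun v hv w hw => by
    have h1 : bracket v ≤ r := hv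
    have h2 : bracket w ≤ r := hw
    linarith [norm_sub_le_bracket_add v w]
  have n0 : ∀ f : V → ℝ, 0 ≤ᵐ[volume] f → ∫ v, f v = nrm 0 f := fun f hf => by
    refine integral_congr_ae ?_
    filter_upwards [hf] with v hv
    have hv' : 0 ≤ f v := hv
    simp [abs_of_nonneg hv']
  -- bilinear expansion
  have ex1 : form (qK ε ψ) (fun v => χu v + χh v) (fun v => χu v + χh v) - form (qK ε ψ) χu χu =
      form (fun v w => qK ε ψ v w + qK ε ψ w v) χh χu + form (qK ε ψ) χh χh := by
    have s1 := form_swap (qK ε ψ) χu χh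
    have i1 := hk.q.integrable hχu hχu
    have i2 := hk.q.integrable hχh hχu
    have i3 := hk.q.swap.integrable hχh hχu
    have i4 := hk.q.integrable hχh hχh
    have i5 := hk.q.integrable hχu hχh
    have e1 : form (fun v w => qK ε ψ v w + qK ε ψ w v) χh χu =
        form (qK ε ψ) χh χu + form (fun v w => qK ε ψ w v) χh χu := by
      rw [form, form, form, ← integral_add i2 i3]
      congr 1; ext p; ring
    have e2 : form (qK ε ψ) (fun v => χu v + χh v) (fun v => χu v + χh v) =
        form (qK ε ψ) χu χu + form (qK ε ψ) χu χh + (form (qK ε ψ) χh χu + form (qK ε ψ) χh χh) := by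
      have j1 : Integrable (fun p : V × V => χu p.1 * χu p.2 * qK ε ψ p.1 p.2 +
          χu p.1 * χh p.2 * qK ε ψ p.1 p.2) := i1.add i5
      have j2 : Integrable (fun p : V × V => χh p.1 * χu p.2 * qK ε ψ p.1 p.2 +
          χh p.1 * χh p.2 * qK ε ψ p.1 p.2) := i2.add i4
      simp only [form]
      rw [← integral_add i1 i5, ← integral_add i2 i4, ← integral_add j1 j2]
      congr 1; ext p; ring
    rw [e1, e2, s1]; ring
  have ex2 : form (lK m₁ e ψ) (fun v => χu v + χh v) χF - form (lK m₁ e ψ) χu χF =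
      form (lK m₁ e ψ) χh χF := by
    rw [← hk.l.form_sub_left (hχu.add hχh) hχu hχF]
    congr 1; ext v; ring
  have b1 : form (fun v w => qK ε ψ v w + qK ε ψ w v) χh χu ≤
      4 * r * ((∫ v, d v) * nrm 0 u) + 8 * (nrm 2 h * nrm 3 u) := by
    have i1 : Integrable (fun p : V × V => 4 * r * (d p.1 * u p.2)) :=
      (hdi.mul_prod hu.integrable).const_mul _
    have e1 : 4 * r * ((∫ v, d v) * (∫ v, u v)) = ∫ p : V × V, 4 * r * (d p.1 * u p.2) := by
      rw [integral_const_mul]; congr 1; exact (integral_prod_mul d u).symm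
    rw [← n0 u hu0, e1, ← integral_prod_nrm, ← integral_add i1 (integrable_prod_nrm h2 hu 8)]
    have hi : Integrable (fun p : V × V => χh p.1 * χu p.2 * (qK ε ψ p.1 p.2 + qK ε ψ p.2 p.1)) := by
      refine ((hk.q.integrable hχh hχu).add (hk.q.swap.integrable hχh hχu)).congr
        (Filter.Eventually.of_forall fun p => ?_)
      simp only [Pi.add_apply]; ring
    refine integral_mono_ae hi (i1.add (integrable_prod_nrm h2 hu 8)) ?_
    filter_upwards [ae_snd hu0] with p hp2
    have hu2 : 0 ≤ u p.2 := hp2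
    have w1 := bracket_pos p.1
    have w2 := bracket_pos p.2
    have d1 := hd0 p.1
    by_cases m1 : p.1 ∈ ballS r
    · by_cases m2 : p.2 ∈ ballS r
      · simp only [hχh', hχu', indicator_of_mem m1, indicator_of_mem m2, abs_of_nonneg hu2, qK,
          hd.granular_eq hp, norm_sub_rev p.2 p.1]
        have g1 := hd.gainA_le hp p.1 p.2
        have g2 := hd.gainA_le hp p.2 p.1
        have q1 := hq _ m1 _ m2
        have q2 := norm_sub_le_bracket_mul p.1 p.2
        have l2 := hd.le p.2
        set x := bracket p.1
        set y := bracket p.2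
        set G := gainA ε ψ p.1 p.2
        set G' := gainA ε ψ p.2 p.1
        -- Each of the two gains contributes x² + y², and the loss at the partner contributes 2y².
        -- The remaining loss -2hψ equals 2d - 2|h|x² and removes the x² term.
        have hb : h p.1 * (G + G' - 2 * ψ p.2) ≤ |h p.1| * (2 * x ^ 2 + 4 * y ^ 2) := by
          calc h p.1 * (G + G' - 2 * ψ p.2) ≤ |h p.1| * |G + G' - 2 * ψ p.2| := by
                rw [← abs_mul]; exact le_abs_self _
            _ ≤ _ := by
                refine mul_le_mul_of_nonneg_left ?_ (abs_nonneg _)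
                rw [abs_le] at *
                constructor <;> linarith
        have hb2 : h p.1 * (G + G' - 2 * ψ p.2 - 2 * ψ p.1) ≤ 2 * d p.1 + 4 * |h p.1| * y ^ 2 := by
          simp only [hdd]; linarith
        calc _ = u p.2 * ‖p.1 - p.2‖ * (h p.1 * (G + G' - 2 * ψ p.2 - 2 * ψ p.1)) := by ring
          _ ≤ u p.2 * ‖p.1 - p.2‖ * (2 * d p.1 + 4 * |h p.1| * y ^ 2) :=
            mul_le_mul_of_nonneg_left hb2 (by positivity)
          _ = u p.2 * (2 * d p.1) * ‖p.1 - p.2‖ + u p.2 * (4 * |h p.1| * y ^ 2) * ‖p.1 - p.2‖ := by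
            ring
          _ ≤ u p.2 * (2 * d p.1) * (2 * r) + u p.2 * (4 * |h p.1| * y ^ 2) * (2 * (x * y)) := by
            gcongr
          _ ≤ _ := by
            have hx : x ≤ x ^ 2 := by nlinarith [one_le_bracket p.1]
            have hn : 0 ≤ u p.2 * |h p.1| * y ^ 3 := by positivity
            nlinarith [mul_le_mul_of_nonneg_left hx hn]
      · simp only [hχu', indicator_of_notMem m2, mul_zero, zero_mul]
        positivity
    · simp only [hχh', indicator_of_notMem m1, zero_mul]
      positivity
  -- The part quadratic in h needs no cancellation: (x + y)(x² + y²) ≤ 2(x³ + y³) leaves one third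
  -- moment and one second moment.
  have b2 : form (qK ε ψ) χh χh ≤ 4 * (nrm 3 h * nrm 2 h) + 4 * (nrm 2 h * nrm 3 h) := by
    rw [← integral_prod_nrm, ← integral_prod_nrm,
      ← integral_add (integrable_prod_nrm hh h2 4) (integrable_prod_nrm h2 hh 4)]
    refine integral_mono_ae (hk.q.integrable hχh hχh)
      ((integrable_prod_nrm hh h2 4).add (integrable_prod_nrm h2 hh 4)) ?_
    refine Filter.Eventually.of_forall fun p => ?_
    have w1 := one_le_bracket p.1
    have w2 := one_le_bracket p.2
    have o1 := bracket_pos p.1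
    have o2 := bracket_pos p.2
    simp only []
    have key : |qK ε ψ p.1 p.2| ≤ 4 * (bracket p.1 ^ 3 * bracket p.2 ^ 2) +
        4 * (bracket p.1 ^ 2 * bracket p.2 ^ 3) := by
      rw [qK, abs_mul, abs_norm]
      have g := hd.abs_granular_le hp p.1 p.2
      have n := norm_sub_le_bracket_add p.1 p.2
      set x := bracket p.1
      set y := bracket p.2
      calc ‖p.1 - p.2‖ * |granular ε ψ p.1 p.2| ≤ (x + y) * (2 * 1 * (x ^ 2 + y ^ 2)) :=
            mul_le_mul n g (abs_nonneg _) (by positivity)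
        _ ≤ 4 * (x ^ 3 + y ^ 3) := by nlinarith [mul_nonneg (add_pos o1 o2).le (sq_nonneg (x - y))]
        _ ≤ _ := by
          have hy : 1 ≤ y ^ 2 := one_le_pow₀ w2
          have hx : 1 ≤ x ^ 2 := one_le_pow₀ w1
          have := mul_le_mul_of_nonneg_left hy (pow_nonneg o1.le 3)
          have := mul_le_mul_of_nonneg_right hx (pow_nonneg o2.le 3)
          linarith
    have hi : ∀ v, |χh v| ≤ |h v| := fun v => by
      by_cases hv : v ∈ ballS r <;> simp [hχh', hv]
    calc χh p.1 * χh p.2 * qK ε ψ p.1 p.2 ≤ |χh p.1| * |χh p.2| * |qK ε ψ p.1 p.2| := by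
          rw [← abs_mul, ← abs_mul]; exact le_abs_self _
      _ ≤ |h p.1| * |h p.2| * (4 * (bracket p.1 ^ 3 * bracket p.2 ^ 2) +
        4 * (bracket p.1 ^ 2 * bracket p.2 ^ 3)) := by
          exact mul_le_mul (mul_le_mul (hi _) (hi _) (abs_nonneg _) (abs_nonneg _)) key
            (abs_nonneg _) (by positivity)
      _ = _ := by ring
  have b3 : form (lK m₁ e ψ) χh χF ≤ 2 * r * ((∫ v, d v) * nrm 0 F) +
      2 * m₁ * (nrm 2 h * nrm 3 F) := by
    have i1 : Integrable (fun p : V × V => 2 * r * (d p.1 * F p.2)) :=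
      (hdi.mul_prod hF.integrable).const_mul _
    have e1 : 2 * r * ((∫ v, d v) * (∫ v, F v)) = ∫ p : V × V, 2 * r * (d p.1 * F p.2) := by
      rw [integral_const_mul]; congr 1; exact (integral_prod_mul d F).symm
    rw [← n0 F hF0, e1, ← integral_prod_nrm, ← integral_add i1 (integrable_prod_nrm h2 hF _)]
    refine integral_mono_ae (hk.l.integrable hχh hχF) (i1.add (integrable_prod_nrm h2 hF _)) ?_
    filter_upwards [ae_snd hF0] with p hp2
    have hF2 : 0 ≤ F p.2 := hp2
    have w1 := bracket_pos p.1
    have w2 := bracket_pos p.2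
    have d1 := hd0 p.1
    by_cases m1 : p.1 ∈ ballS r
    · by_cases m2 : p.2 ∈ ballS r
      · simp only [hχh', hχF', indicator_of_mem m1, indicator_of_mem m2, abs_of_nonneg hF2, lK,
          hd.scattering_eq hp]
        have g1 := hd.gainJ_le hp p.1 p.2
        have q1 := hq _ m1 _ m2
        have q2 := norm_sub_le_bracket_mul p.1 p.2
        set x := bracket p.1
        set y := bracket p.2
        set G := gainJ m₁ e ψ p.1 p.2
        have hb : h p.1 * G ≤ |h p.1| * (x ^ 2 + m₁ * y ^ 2) := by
          calc h p.1 * G ≤ |h p.1| * |G| := by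
                rw [← abs_mul]; exact le_abs_self _
            _ ≤ _ := mul_le_mul_of_nonneg_left (by linarith) (abs_nonneg _)
        have hb2 : h p.1 * (G - ψ p.1) ≤ d p.1 + m₁ * |h p.1| * y ^ 2 := by
          simp only [hdd]; linarith
        calc _ = F p.2 * ‖p.1 - p.2‖ * (h p.1 * (G - ψ p.1)) := by ring
          _ ≤ F p.2 * ‖p.1 - p.2‖ * (d p.1 + m₁ * |h p.1| * y ^ 2) :=
            mul_le_mul_of_nonneg_left hb2 (by positivity)
          _ = F p.2 * (d p.1) * ‖p.1 - p.2‖ + F p.2 * (m₁ * |h p.1| * y ^ 2) * ‖p.1 - p.2‖ := by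
            ring
          _ ≤ F p.2 * (d p.1) * (2 * r) + F p.2 * (m₁ * |h p.1| * y ^ 2) * (2 * (x * y)) := by
            gcongr
          _ ≤ _ := by
            have hx : x ≤ x ^ 2 := by nlinarith [one_le_bracket p.1]
            have hn : 0 ≤ m₁ * (F p.2 * |h p.1| * y ^ 3) := by positivity
            nlinarith [mul_le_mul_of_nonneg_left hx hn]
      · simp only [hχF', indicator_of_notMem m2, mul_zero, zero_mul]
        positivity
    · simp only [hχh', indicator_of_notMem m1, zero_mul]
      positivity
  have hτ : 0 ≤ τ / 2 := by have := hp.hτ; linarith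
  have hl : 0 ≤ 1 / lam := by have := hp.hlam; positivity
  have f1 := mul_le_mul_of_nonneg_left (add_le_add b1 b2) hτ
  have f2 := mul_le_mul_of_nonneg_left b3 hl
  rw [← ex1] at f1
  rw [← ex2] at f2
  unfold stabC
  linarith

/-! ### Moment estimates -/

/-- Grain collisions contribute nothing positive (A = 0), and the host adds at most m₁⟨w⟩² per
collision. The growth rate is therefore linear and independent of r. -/
lemma Params.weakRHS_energy (hp : Params τ ε lam m₁ e) {F f : V → ℝ} (hF : Mom 3 F)
    (hF0 : 0 ≤ᵐ[volume] F) (hf : Mom 2 f) (hf0 : 0 ≤ᵐ[volume] f) (r : ℝ) :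
    weakRHS τ ε lam m₁ e ((ballS r).indicator F) ((ballS r).indicator f)
      (fun v => bracket v ^ 2) ≤ 2 * m₁ * (1 / lam) * nrm 3 F * nrm 2 f := by
  have hm := hp.hm₁.le
  have hl : 0 ≤ 1 / lam := by have := hp.hlam; positivity
  have h := dom_sq.weakRHS_upper hp (i := 2) (j := 2) (l := 3) (A := 0) (J := 2 * m₁) le_rfl
    (by positivity) (r := r) hF hF hF0 hf hf (hf.indicator (measurableSet_ballS r)) hf0
    (fun v _ w _ => ?_) (fun v _ w _ => ?_)
  · refine h.trans ?_
    have := nrm_indicator_le hf (measurableSet_ballS r)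
    have h2 := nrm_nonneg 3 F
    have : 2 * m₁ * (1 / lam) * nrm 3 F * nrm 2 ((ballS r).indicator f) ≤
      2 * m₁ * (1 / lam) * nrm 3 F * nrm 2 f := by gcongr
    linarith
  · rw [zero_mul, qK, dom_sq.granular_eq hp]
    have : gainA ε (fun v => bracket v ^ 2) v w ≤ bracket v ^ 2 + bracket w ^ 2 :=
      avg_le (dom_sq.integrable_A hp v w) (hp.sq_post_le v w)
    exact mul_nonpos_of_nonneg_of_nonpos (norm_nonneg _) (by linarith)
  · rw [lK, dom_sq.scattering_eq hp]
    have : gainJ m₁ e (fun v => bracket v ^ 2) v w ≤ bracket v ^ 2 + m₁ * bracket w ^ 2 :=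
      avg_le (dom_sq.integrable_J hp v w) (hp.sq_post_le' v w)
    have o1 := bracket_pos v
    have o2 := bracket_pos w
    calc _ ≤ ‖v - w‖ * (m₁ * bracket w ^ 2) := by gcongr; linarith
      _ ≤ (2 * (bracket v * bracket w)) * (m₁ * bracket w ^ 2) := by
        gcongr; exact norm_sub_le_bracket_mul v w
      _ = 2 * m₁ * bracket w ^ 3 * bracket v := by ring
      _ ≤ 2 * m₁ * bracket w ^ 3 * bracket v ^ 2 := by
        gcongr; nlinarith [one_le_bracket v]
      _ = _ := by ring

/-- The truncated moment weight. -/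
def capW (k : ℕ) (R : ℝ) (v : V) : ℝ := min (bracket v ^ k) R

lemma capW_nonneg {k : ℕ} {R : ℝ} (hR : 0 ≤ R) (v : V) : 0 ≤ capW k R v :=
  le_min (bracket_pow_pos k v).le hR

lemma dom_capW {k : ℕ} {R : ℝ} (hR : 0 ≤ R) : Dom R (capW k R) := by
  refine dom_of_bounded ((measurable_bracket.pow_const k).min measurable_const) fun v => ?_
  rw [abs_of_nonneg (capW_nonneg hR v)]
  exact min_le_right _ _

/-- Once R ≥ r^k the cap is inactive on the truncation ball. The loss then sees the exact weight;
the gain, whose velocities may leave the ball, only needs the upper bound ⟨v⟩^k. -/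
lemma capW_eq {k : ℕ} {R r : ℝ} (hR : r ^ k ≤ R) {v : V} (hv : v ∈ ballS r) :
    capW k R v = bracket v ^ k :=
  min_eq_left ((pow_le_pow_left₀ (bracket_pos v).le hv k).trans hR)

/-- With a = ⟨v⟩ and b = ⟨w⟩, both post-collisional brackets are at most a + b. Hence their cubes
add up to at most (a² + b²)(a + b), which exceeds a³ + b³ only by ab(a + b). After multiplication by
|v - w| each term has at most one cube, so the bound is linear in the third moment with a
coefficient of second order. For the host, expanding (a² + s²b²)(a + sb) with s = 1 + m₁ and
removing a³ leaves three terms, each at most s³a²b³. -/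
lemma Params.weakRHS_cubic (hp : Params τ ε lam m₁ e) {F f : V → ℝ} (hF : Mom 4 F)
    (hF0 : 0 ≤ᵐ[volume] F) (hf : Mom 2 f) (hf0 : 0 ≤ᵐ[volume] f) {r R : ℝ}
    (hR0 : 0 ≤ R) (hR : r ^ 3 ≤ R) :
    weakRHS τ ε lam m₁ e ((ballS r).indicator F) ((ballS r).indicator f) (capW 3 R) ≤
      (τ * 2 * nrm 2 f + 1 / lam * (6 * (1 + m₁) ^ 3) * nrm 4 F) *
        nrm 3 ((ballS r).indicator f) := by
  have hm := hp.hm₁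
  have hd := dom_capW (k := 3) hR0
  have hcap : ∀ v, capW 3 R v ≤ bracket v ^ 3 := fun v => min_le_left _ _
  refine hd.weakRHS_upper hp (by norm_num) (by positivity) (hF.of_le (by norm_num)) hF hF0 hf hf
    (mom_indicator_ballS (j := 1) hf) hf0 (fun v hv w hw => ?_) (fun v hv w hw => ?_)
  · rw [qK, hd.granular_eq hp, capW_eq hR hv, capW_eq hR hw]
    have n := norm_sub_le_bracket_add v w
    have w1 := one_le_bracket v
    have w2 := one_le_bracket w
    have hG : gainA ε (capW 3 R) v w ≤
        (bracket v ^ 2 + bracket w ^ 2) * (bracket v + bracket w) := by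
      refine avg_le (hd.integrable_A hp v w) fun σ => ?_
      have hs := hp.sq_post_le v w σ
      have c1 := hcap (post (zc ε) v w σ)
      have c2 := hcap (post' (zc ε) v w σ)
      have p1 := bracket_pos (post (zc ε) v w σ)
      have p2 := bracket_pos (post' (zc ε) v w σ)
      set a := bracket v
      set b := bracket w
      set x := bracket (post (zc ε) v w σ)
      set y := bracket (post' (zc ε) v w σ)
      have hx : x ≤ a + b := abs_le_of_sq_le_sq' (by nlinarith) (by linarith) |>.2
      have hy : y ≤ a + b := abs_le_of_sq_le_sq' (by nlinarith) (by linarith) |>.2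
      have e1 := mul_le_mul_of_nonneg_left hx (sq_nonneg x)
      have e2 := mul_le_mul_of_nonneg_left hy (sq_nonneg y)
      have e3 := mul_le_mul_of_nonneg_right hs (show (0 : ℝ) ≤ a + b by linarith)
      linarith
    set a := bracket v
    set b := bracket w
    have hz : 0 ≤ a * b * (a + b) := by positivity
    calc _ ≤ ‖v - w‖ * (a * b * (a + b)) := by
          refine mul_le_mul_of_nonneg_left ?_ (norm_nonneg _); linarith
      _ ≤ (a + b) * (a * b * (a + b)) := mul_le_mul_of_nonneg_right n hz
      _ ≤ (a + b) * (a * b * (2 * (a * b))) := by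
          gcongr
          exact add_le_two_mul w1 w2
      _ = _ := by ring
  · rw [lK, hd.scattering_eq hp, capW_eq hR hv]
    have n := norm_sub_le_bracket_mul v w
    have w1 := one_le_bracket v
    have w2 := one_le_bracket w
    set s := 1 + m₁ with hs
    have hs1 : 1 ≤ s := by linarith
    have hG : gainJ m₁ e (capW 3 R) v w ≤
        (bracket v ^ 2 + s ^ 2 * bracket w ^ 2) * (bracket v + s * bracket w) := by
      refine avg_le (hd.integrable_J hp v w) fun σ => ?_
      have h2 := hp.sq_post_le' v w σ
      have c1 := hcap (post (kc m₁ e) v w σ)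
      have p1 := bracket_pos (post (kc m₁ e) v w σ)
      set a := bracket v
      set b := bracket w
      set x := bracket (post (kc m₁ e) v w σ)
      have hms : m₁ ≤ s ^ 2 := by rw [hs]; nlinarith
      have hx2 : x ^ 2 ≤ a ^ 2 + s ^ 2 * b ^ 2 := h2.trans (by gcongr)
      have hz : 0 ≤ a * (s * b) := by positivity
      have hx : x ≤ a + s * b := abs_le_of_sq_le_sq' (by nlinarith) (by positivity) |>.2
      have e1 := mul_le_mul hx2 hx p1.le (by positivity)
      calc _ ≤ x ^ 3 := c1
        _ = x ^ 2 * x := by ring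
        _ ≤ _ := e1
    set a := bracket v
    set b := bracket w
    have hdiff : gainJ m₁ e (capW 3 R) v w - a ^ 3 ≤ 3 * (s ^ 3 * (a ^ 2 * b ^ 3)) := by
      have t1 : a ^ 2 * (s * b) ≤ s ^ 3 * (a ^ 2 * b ^ 3) := by
        have : s * b ≤ s ^ 3 * b ^ 3 := by
          rw [← mul_pow]
          exact le_self_pow₀ (one_le_mul_of_one_le_of_one_le hs1 w2) (by norm_num)
        nlinarith [sq_nonneg a]
      have t2 : a * (s ^ 2 * b ^ 2) ≤ s ^ 3 * (a ^ 2 * b ^ 3) := by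
        have h1 : s ^ 2 * b ^ 2 ≤ s ^ 3 * b ^ 3 := by
          rw [← mul_pow, ← mul_pow]
          exact pow_le_pow_right₀ (one_le_mul_of_one_le_of_one_le hs1 w2) (by norm_num)
        have h2 : a ≤ a ^ 2 := by nlinarith
        calc a * (s ^ 2 * b ^ 2) ≤ a ^ 2 * (s ^ 3 * b ^ 3) := by gcongr
          _ = _ := by ring
      have t3 : s ^ 3 * b ^ 3 ≤ s ^ 3 * (a ^ 2 * b ^ 3) := by
        have h1 : 1 ≤ a ^ 2 := one_le_pow₀ w1
        have h2 : 0 ≤ s ^ 3 * b ^ 3 := by positivity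
        nlinarith
      linarith
    calc _ ≤ ‖v - w‖ * (3 * (s ^ 3 * (a ^ 2 * b ^ 3))) := by gcongr
      _ ≤ (2 * (a * b)) * (3 * (s ^ 3 * (a ^ 2 * b ^ 3))) := by gcongr
      _ = _ := by ring

/-- For fourth powers the excess (a² + b²)² - a⁴ - b⁴ = 2a²b² becomes at most 4a³b³ after
multiplication by |v - w|. The fourth moment thus does not appear on the right, and it grows at most
linearly in time. -/
lemma Params.weakRHS_quartic (hp : Params τ ε lam m₁ e) {F f : V → ℝ} (hF : Mom 5 F)
    (hF0 : 0 ≤ᵐ[volume] F) (hf : Mom 3 f) (hf0 : 0 ≤ᵐ[volume] f) {r R : ℝ}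
    (hR0 : 0 ≤ R) (hR : r ^ 4 ≤ R) :
    weakRHS τ ε lam m₁ e ((ballS r).indicator F) ((ballS r).indicator f) (capW 4 R) ≤
      (τ * 2 * nrm 3 f + 1 / lam * (2 * (2 * m₁ + m₁ ^ 2)) * nrm 5 F) * nrm 3 f := by
  have hm := hp.hm₁
  have hl := hp.hlam
  have hτ := hp.hτ
  have hd := dom_capW (k := 4) hR0
  have hcap : ∀ v, capW 4 R v ≤ bracket v ^ 4 := fun v => min_le_left _ _
  have h := hd.weakRHS_upper hp (i := 3) (j := 3) (l := 5) (A := 2) (J := 2 * (2 * m₁ + m₁ ^ 2))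
    (r := r) (by norm_num) (by positivity)
    (hF.of_le (by norm_num)) hF hF0 (hf.of_le (by norm_num)) hf
    (hf.indicator (measurableSet_ballS r)) hf0 (fun v hv w hw => ?_) (fun v hv w hw => ?_)
  · refine h.trans (mul_le_mul_of_nonneg_left (nrm_indicator_le hf (measurableSet_ballS r)) ?_)
    have := nrm_nonneg 3 f
    have := nrm_nonneg 5 F
    positivity
  · rw [qK, hd.granular_eq hp, capW_eq hR hv, capW_eq hR hw]
    have n := norm_sub_le_bracket_mul v w
    have w1 := bracket_pos v
    have w2 := bracket_pos w
    have hG : gainA ε (capW 4 R) v w ≤ (bracket v ^ 2 + bracket w ^ 2) ^ 2 := by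
      refine avg_le (hd.integrable_A hp v w) fun σ => ?_
      have hs := hp.sq_post_le v w σ
      have c1 := hcap (post (zc ε) v w σ)
      have c2 := hcap (post' (zc ε) v w σ)
      set x := bracket (post (zc ε) v w σ)
      set y := bracket (post' (zc ε) v w σ)
      have := pow_le_pow_left₀ (by positivity) hs 2
      nlinarith [mul_nonneg (sq_nonneg x) (sq_nonneg y)]
    set a := bracket v
    set b := bracket w
    calc _ ≤ ‖v - w‖ * (2 * (a ^ 2 * b ^ 2)) := by
          refine mul_le_mul_of_nonneg_left ?_ (norm_nonneg _); linarith
      _ ≤ (2 * (a * b)) * (2 * (a ^ 2 * b ^ 2)) := by gcongr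
      _ = _ := by ring
  · rw [lK, hd.scattering_eq hp, capW_eq hR hv]
    have n := norm_sub_le_bracket_mul v w
    have w1 := one_le_bracket v
    have w2 := one_le_bracket w
    have hG : gainJ m₁ e (capW 4 R) v w ≤ (bracket v ^ 2 + m₁ * bracket w ^ 2) ^ 2 := by
      refine avg_le (hd.integrable_J hp v w) fun σ => ?_
      have h2 := hp.sq_post_le' v w σ
      have c1 := hcap (post (kc m₁ e) v w σ)
      have := pow_le_pow_left₀ (by positivity) h2 2
      calc _ ≤ _ := c1
        _ = (bracket (post (kc m₁ e) v w σ) ^ 2) ^ 2 := by ring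
        _ ≤ _ := this
    set a := bracket v
    set b := bracket w
    have hdiff : gainJ m₁ e (capW 4 R) v w - a ^ 4 ≤ (2 * m₁ + m₁ ^ 2) * (a ^ 2 * b ^ 4) := by
      have t1 : a ^ 2 * b ^ 2 ≤ a ^ 2 * b ^ 4 := by
        gcongr
        norm_num
      have t2 : b ^ 4 ≤ a ^ 2 * b ^ 4 := by
        have h1 : 1 ≤ a ^ 2 := one_le_pow₀ w1
        have h2 : 0 ≤ b ^ 4 := by positivity
        nlinarith
      have s1 := mul_le_mul_of_nonneg_left t1 (show (0 : ℝ) ≤ 2 * m₁ by positivity)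
      have s2 := mul_le_mul_of_nonneg_left t2 (show (0 : ℝ) ≤ m₁ ^ 2 by positivity)
      linarith
    calc _ ≤ ‖v - w‖ * ((2 * m₁ + m₁ ^ 2) * (a ^ 2 * b ^ 4)) := by gcongr
      _ ≤ (2 * (a * b)) * ((2 * m₁ + m₁ ^ 2) * (a ^ 2 * b ^ 4)) := by gcongr
      _ = _ := by ring

end estimates

/-! ### Densities of push-forwards -/

/-- For each fixed parameter p the map v ↦ v + c(p) preserves Lebesgue measure, so the density is
the integral of H(p, x - c(p)) over p. No Jacobian and no inversion of the collision map is needed.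
-/
lemma exists_density_of_shift {P : Type*} [MeasurableSpace P] {μ : Measure P} [SFinite μ]
    {c : P → V} (hc : Measurable c) (H : P × V → ℝ) :
    ∃ z : V → ℝ, ∀ ψ : V → ℝ, Measurable ψ →
      Integrable (fun y : P × V => H y * ψ (y.2 + c y.1)) (μ.prod volume) →
      Integrable (fun x => z x * ψ x) ∧
        ∫ x, z x * ψ x = ∫ y, H y * ψ (y.2 + c y.1) ∂(μ.prod volume) := by
  have hΦ : MeasurePreserving (fun y : P × V => (y.1, y.2 - c y.1)) (μ.prod volume)
      (μ.prod volume) := by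
    refine (MeasurePreserving.id μ).skew_product (g := fun p x => x - c p)
      (by unfold Function.uncurry; fun_prop) (Filter.Eventually.of_forall fun p => ?_)
    exact (measurePreserving_sub_right (volume : Measure V) (c p)).map_eq
  refine ⟨fun x => ∫ p, H (p, x - c p) ∂μ, fun ψ hψ hi => ?_⟩
  have hK : Integrable (fun y : P × V => H (y.1, y.2 - c y.1) * ψ y.2) (μ.prod volume) := by
    have := hΦ.integrable_comp_of_integrable hi
    refine this.congr (Filter.Eventually.of_forall fun y => ?_)
    simp
  have e : ∀ x, (∫ p, H (p, x - c p) ∂μ) * ψ x = ∫ p, H (p, x - c p) * ψ x ∂μ :=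
    fun x => (integral_mul_const _ _).symm
  simp only [e]
  refine ⟨hK.integral_prod_right, ?_⟩
  rw [← integral_prod_symm _ hK]
  conv_rhs => rw [← hΦ.map_eq]
  rw [integral_map hΦ.measurable.aemeasurable (by rw [hΦ.map_eq]; exact hi.aestronglyMeasurable)]
  simp

/-- The passage from (v, w) to (v, v - w): the angle and the relative velocity q become the
parameter of `exists_density_of_shift`, and v the translated variable. -/
lemma measurePreserving_relative :
    MeasurePreserving (fun y : (Sph × V) × V => (y.1.1, (y.2, y.2 - y.1.2)))
      ((surface.prod volume).prod volume) (surface.prod volume) := by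
  have h1 : MeasurePreserving (fun p : V × V => (p.1, p.1 - p.2)) volume volume :=
    (MeasurePreserving.id (volume : Measure V)).skew_product (g := fun v q => v - q)
      (by unfold Function.uncurry; fun_prop) (Filter.Eventually.of_forall fun v =>
        Measure.map_sub_left_eq_self (volume : Measure V) v)
  have h2 : MeasurePreserving (fun p : V × V => (p.2, p.2 - p.1)) volume volume :=
    h1.comp Measure.measurePreserving_swap
  have h3 := (MeasurePreserving.id surface).prod h2
  exact h3.comp (measurePreserving_prodAssoc surface (volume : Measure V) (volume : Measure V))

/-- The weight of the collision integrals. -/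
def collW (f g : V → ℝ) (y : Sph × (V × V)) : ℝ :=
  1 / (4 * Real.pi) * (f y.2.1 * g y.2.2 * ‖y.2.1 - y.2.2‖)

lemma integrable_collW {f g : V → ℝ} (hf : Mom 3 f) (hg : Mom 3 g) {h : Sph × (V × V) → ℝ}
    (hm : Measurable h) {D : ℝ}
    (hb : ∀ y, |h y| ≤ D * (bracket y.2.1 ^ 2 * bracket y.2.2 ^ 2)) :
    Integrable (fun y => collW f g y * h y) (surface.prod volume) := by
  have hpi := Real.pi_pos
  have hdom := ((integrable_prod_nrm hf hg (1 / (4 * Real.pi) * (2 * D))).comp_snd surface)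
  refine hdom.mono' ?_ (Filter.Eventually.of_forall fun y => ?_)
  · have h1 : AEStronglyMeasurable (fun p : V × V => f p.1 * g p.2 * ‖p.1 - p.2‖) :=
      ((hf.aesm.comp_fst).mul (hg.aesm.comp_snd)).mul
        (by fun_prop : Measurable fun p : V × V => ‖p.1 - p.2‖).aestronglyMeasurable
    exact ((h1.comp_snd (μ := surface)).const_mul (1 / (4 * Real.pi))).mul hm.aestronglyMeasurable
  · have n := norm_sub_le_bracket_mul y.2.1 y.2.2
    have w1 := bracket_pos y.2.1
    have w2 := bracket_pos y.2.2
    rw [collW, Real.norm_eq_abs, abs_mul, abs_mul, abs_mul, abs_mul, abs_norm,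
      abs_of_pos (show 0 < 1 / (4 * Real.pi) by positivity)]
    have h0 := (abs_nonneg _).trans (hb y)
    calc _ ≤ 1 / (4 * Real.pi) * (|f y.2.1| * |g y.2.2| * (2 * (bracket y.2.1 * bracket y.2.2))) *
          (D * (bracket y.2.1 ^ 2 * bracket y.2.2 ^ 2)) := by
          refine mul_le_mul ?_ (hb y) (abs_nonneg _) (by positivity)
          gcongr
      _ = _ := by ring

lemma exists_density_of_collision {f g : V → ℝ} (hf : Mom 3 f) (hg : Mom 3 g) {c : Sph × V → V}
    (hc : Measurable c) {D : ℝ}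
    (hb : ∀ y : Sph × (V × V), bracket (y.2.1 + c (y.1, y.2.1 - y.2.2)) ^ 2 ≤
      D * (bracket y.2.1 ^ 2 * bracket y.2.2 ^ 2)) :
    ∃ z : V → ℝ, ∀ (C : ℝ) (ψ : V → ℝ), Dom C ψ → Integrable (fun x => z x * ψ x) ∧
        ∫ x, z x * ψ x = ∫ y : Sph × (V × V), collW f g y * ψ (y.2.1 + c (y.1, y.2.1 - y.2.2))
          ∂(surface.prod volume) := by
  have hrel := measurePreserving_relative
  obtain ⟨z, hz⟩ := exists_density_of_shift (μ := surface.prod volume) hc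
    fun y => collW f g (y.1.1, (y.2, y.2 - y.1.2))
  refine ⟨z, fun C ψ hψ => ?_⟩
  have hm : Measurable fun y : Sph × (V × V) => y.2.1 + c (y.1, y.2.1 - y.2.2) := by fun_prop
  have hi : Integrable (fun y : Sph × (V × V) =>
      collW f g y * ψ (y.2.1 + c (y.1, y.2.1 - y.2.2))) (surface.prod volume) := by
    refine integrable_collW hf hg (hψ.meas.comp hm) (D := C * D) fun y => ?_
    have := mul_le_mul_of_nonneg_left (hb y) hψ.nonneg
    rw [mul_assoc]
    exact (hψ.le _).trans this
  have hi2 := hrel.integrable_comp_of_integrable hi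
  obtain ⟨h1, h2⟩ := hz ψ hψ.meas (hi2.congr (Filter.Eventually.of_forall fun y => by simp))
  refine ⟨h1, h2.trans ?_⟩
  conv_rhs => rw [← hrel.map_eq]
  rw [integral_map hrel.measurable.aemeasurable (by rw [hrel.map_eq]; exact hi.aestronglyMeasurable)]
  simp

lemma measurable_fst_comp {f : V → ℝ} (h : Measurable f) :
    Measurable fun y : Sph × (V × V) => f y.2.1 := by fun_prop

section operator
variable {τ ε lam m₁ e : ℝ}

/-- The weak right-hand side is represented by a function. -/
lemma Params.exists_density (hp : Params τ ε lam m₁ e) {F f : V → ℝ} (hF : Mom 3 F)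
    (hf : Mom 3 f) : ∃ z : V → ℝ, Mom 2 z ∧
      ∀ (C : ℝ) (ψ : V → ℝ), Dom C ψ → ∫ v, z v * ψ v = weakRHS τ ε lam m₁ e F f ψ := by
  have hm := hp.hm₁.le
  have ones : ∀ y : Sph × (V × V), 1 ≤ bracket y.2.1 ^ 2 ∧ 1 ≤ bracket y.2.2 ^ 2 := fun y =>
    ⟨one_le_bracket_pow 2 _, one_le_bracket_pow 2 _⟩
  have bpost : ∀ y : Sph × (V × V), bracket (post (zc ε) y.2.1 y.2.2 y.1) ^ 2 ≤
      2 * (bracket y.2.1 ^ 2 * bracket y.2.2 ^ 2) := fun y => by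
    have := hp.sq_post_le y.2.1 y.2.2 y.1
    have := bracket_pow_pos 2 (post' (zc ε) y.2.1 y.2.2 y.1)
    linarith [add_le_two_mul (ones y).1 (ones y).2]
  have bpost' : ∀ y : Sph × (V × V), bracket (post' (zc ε) y.2.1 y.2.2 y.1) ^ 2 ≤
      2 * (bracket y.2.1 ^ 2 * bracket y.2.2 ^ 2) := fun y => by
    have := hp.sq_post_le y.2.1 y.2.2 y.1
    have := bracket_pow_pos 2 (post (zc ε) y.2.1 y.2.2 y.1)
    linarith [add_le_two_mul (ones y).1 (ones y).2]
  have bpostJ : ∀ y : Sph × (V × V), bracket (post (kc m₁ e) y.2.1 y.2.2 y.1) ^ 2 ≤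
      (1 + m₁) * (bracket y.2.1 ^ 2 * bracket y.2.2 ^ 2) := fun y => by
    have h := hp.sq_post_le' y.2.1 y.2.2 y.1
    obtain ⟨h1, h2⟩ := ones y
    set a := bracket y.2.1 ^ 2
    set b := bracket y.2.2 ^ 2
    nlinarith [mul_nonneg hm (mul_nonneg (sub_nonneg.2 h1) (by linarith : (0 : ℝ) ≤ b)),
      mul_nonneg (sub_nonneg.2 h2) (by linarith : (0 : ℝ) ≤ a)]
  have bv : ∀ y : Sph × (V × V), bracket y.2.1 ^ 2 ≤
      1 * (bracket y.2.1 ^ 2 * bracket y.2.2 ^ 2) := fun y => by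
    obtain ⟨h1, h2⟩ := ones y; nlinarith
  have bw : ∀ y : Sph × (V × V), bracket y.2.2 ^ 2 ≤
      1 * (bracket y.2.1 ^ 2 * bracket y.2.2 ^ 2) := fun y => by
    obtain ⟨h1, h2⟩ := ones y; nlinarith
  have mpost : ∀ κ : ℝ, Measurable fun y : Sph × (V × V) => post κ y.2.1 y.2.2 y.1 := fun κ =>
    (measurable_post κ).comp measurable_swap
  have mpost' : ∀ κ : ℝ, Measurable fun y : Sph × (V × V) => post' κ y.2.1 y.2.2 y.1 := fun κ =>
    (measurable_post' κ).comp measurable_swap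
  have e1 : ∀ (κ : ℝ) (y : Sph × (V × V)), y.2.1 + κ • (‖y.2.1 - y.2.2‖ • (y.1 : V) -
      (y.2.1 - y.2.2)) = post κ y.2.1 y.2.2 y.1 := fun κ y => rfl
  -- The partner velocity is also a translate of v, because w = v - q.
  have e2 : ∀ (κ : ℝ) (y : Sph × (V × V)), y.2.1 + (-(y.2.1 - y.2.2) - κ • (‖y.2.1 - y.2.2‖ •
      (y.1 : V) - (y.2.1 - y.2.2))) = post' κ y.2.1 y.2.2 y.1 := fun κ y => by
    unfold post'; module
  have e3 : ∀ y : Sph × (V × V), y.2.1 + (-(y.2.1 - y.2.2)) = y.2.2 := fun y => by module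
  obtain ⟨z1, h1⟩ := exists_density_of_collision hf hf
    (c := fun p => zc ε • (‖p.2‖ • (p.1 : V) - p.2)) (by fun_prop) (D := 2)
    (fun y => by simp only [e1]; exact bpost y)
  obtain ⟨z2, h2⟩ := exists_density_of_collision hf hf
    (c := fun p => -p.2 - zc ε • (‖p.2‖ • (p.1 : V) - p.2)) (by fun_prop) (D := 2)
    (fun y => by simp only [e2]; exact bpost' y)
  obtain ⟨z3, h3⟩ := exists_density_of_collision hf hf (c := fun _ => 0) (by fun_prop) (D := 1)
    (fun y => by simp only [add_zero]; exact bv y)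
  obtain ⟨z4, h4⟩ := exists_density_of_collision hf hf (c := fun p => -p.2) (by fun_prop) (D := 1)
    (fun y => by simp only [e3]; exact bw y)
  obtain ⟨z5, h5⟩ := exists_density_of_collision hf hF
    (c := fun p => kc m₁ e • (‖p.2‖ • (p.1 : V) - p.2)) (by fun_prop) (D := 1 + m₁)
    (fun y => by simp only [e1]; exact bpostJ y)
  obtain ⟨z6, h6⟩ := exists_density_of_collision hf hF (c := fun _ => 0) (by fun_prop) (D := 1)
    (fun y => by simp only [add_zero]; exact bv y)
  simp only [e1, e2, e3, add_zero] at h1 h2 h3 h4 h5 h6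
  set z : V → ℝ := fun v => τ / 2 * (z1 v + z2 v - z3 v - z4 v) + 1 / lam * (z5 v - z6 v) with hz
  have hzψ : ∀ (ψ : V → ℝ) (v : V), z v * ψ v = τ / 2 * (z1 v * ψ v + z2 v * ψ v - z3 v * ψ v -
      z4 v * ψ v) + 1 / lam * (z5 v * ψ v - z6 v * ψ v) := fun ψ v => by simp only [hz]; ring
  refine ⟨z, ?_, fun C ψ hψ => ?_⟩
  -- The weight ⟨v⟩² is itself an admissible test function, so the integrability of the six products
  -- gives the second moment of the density.
  · have i1 := (h1 1 _ dom_sq).1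
    have i2 := (h2 1 _ dom_sq).1
    have i3 := (h3 1 _ dom_sq).1
    have i4 := (h4 1 _ dom_sq).1
    have i5 := (h5 1 _ dom_sq).1
    have i6 := (h6 1 _ dom_sq).1
    refine ((((i1.add i2).sub i3).sub i4).const_mul (τ / 2) |>.add
      ((i5.sub i6).const_mul (1 / lam))).congr (Filter.Eventually.of_forall fun v => ?_)
    simp only [hzψ (fun v => bracket v ^ 2) v, Pi.add_apply, Pi.sub_apply]
  · obtain ⟨i1, j1⟩ := h1 C ψ hψ
    obtain ⟨i2, j2⟩ := h2 C ψ hψ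
    obtain ⟨i3, j3⟩ := h3 C ψ hψ
    obtain ⟨i4, j4⟩ := h4 C ψ hψ
    obtain ⟨i5, j5⟩ := h5 C ψ hψ
    obtain ⟨i6, j6⟩ := h6 C ψ hψ
    have hk := hψ.ker hp
    have hC := hψ.nonneg
    have db : ∀ {P : Sph × (V × V) → V} {D : ℝ},
        (∀ y, bracket (P y) ^ 2 ≤ D * (bracket y.2.1 ^ 2 * bracket y.2.2 ^ 2)) → ∀ y,
        |ψ (P y)| ≤ C * D * (bracket y.2.1 ^ 2 * bracket y.2.2 ^ 2) := fun hP y => by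
      rw [mul_assoc]; exact (hψ.le _).trans (mul_le_mul_of_nonneg_left (hP y) hC)
    have t1 := integrable_collW hf hf (hψ.meas.comp (mpost (zc ε))) (db bpost)
    have t2 := integrable_collW hf hf (hψ.meas.comp (mpost' (zc ε))) (db bpost')
    have t3 := integrable_collW hf hf (measurable_fst_comp hψ.meas) (db bv)
    have t4 := integrable_collW hf hf (hψ.meas.comp (measurable_snd.comp measurable_snd)) (db bw)
    have t5 := integrable_collW hf hF (hψ.meas.comp (mpost (kc m₁ e))) (db bpostJ)
    have t6 := integrable_collW hf hF (measurable_fst_comp hψ.meas) (db bv)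
    simp only [Function.comp_apply] at t1 t2 t3 t4 t5 t6
    have q12 : Integrable (fun y => collW f f y * ψ (post (zc ε) y.2.1 y.2.2 y.1) +
      collW f f y * ψ (post' (zc ε) y.2.1 y.2.2 y.1)) (surface.prod volume) := t1.add t2
    have q123 : Integrable (fun y => collW f f y * ψ (post (zc ε) y.2.1 y.2.2 y.1) +
      collW f f y * ψ (post' (zc ε) y.2.1 y.2.2 y.1) - collW f f y * ψ y.2.1)
      (surface.prod volume) := q12.sub t3
    have q1234 : Integrable (fun y => collW f f y * ψ (post (zc ε) y.2.1 y.2.2 y.1) +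
      collW f f y * ψ (post' (zc ε) y.2.1 y.2.2 y.1) - collW f f y * ψ y.2.1 -
      collW f f y * ψ y.2.2) (surface.prod volume) := q123.sub t4
    have q56 : Integrable (fun y => collW f F y * ψ (post (kc m₁ e) y.2.1 y.2.2 y.1) -
      collW f F y * ψ y.2.1) (surface.prod volume) := t5.sub t6
    have fq : form (qK ε ψ) f f = (∫ x, z1 x * ψ x) + (∫ x, z2 x * ψ x) - (∫ x, z3 x * ψ x) -
        ∫ x, z4 x * ψ x := by
      rw [j1, j2, j3, j4, ← integral_add t1 t2, ← integral_sub q12 t3, ← integral_sub q123 t4,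
        integral_prod_symm _ q1234, form]
      refine integral_congr_ae (Filter.Eventually.of_forall fun p => ?_)
      simp only [qK, hψ.granular_eq hp]
      rw [gainA, sub_sub, ← avg_sub_const (hψ.integrable_A hp _ _), avg, ← integral_const_mul,
        ← integral_const_mul, ← integral_const_mul]
      refine integral_congr_ae (Filter.Eventually.of_forall fun σ => ?_)
      simp only [collW]; ring
    have fl : form (lK m₁ e ψ) f F = (∫ x, z5 x * ψ x) - ∫ x, z6 x * ψ x := by
      rw [j5, j6, ← integral_sub t5 t6, integral_prod_symm _ q56, form]
      refine integral_congr_ae (Filter.Eventually.of_forall fun p => ?_)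
      simp only [lK, hψ.scattering_eq hp]
      rw [gainJ, ← avg_sub_const (hψ.integrable_J hp _ _), avg, ← integral_const_mul,
        ← integral_const_mul, ← integral_const_mul]
      refine integral_congr_ae (Filter.Eventually.of_forall fun σ => ?_)
      simp only [collW]; ring
    have k12 : Integrable (fun x => z1 x * ψ x + z2 x * ψ x) := i1.add i2
    have k123 : Integrable (fun x => z1 x * ψ x + z2 x * ψ x - z3 x * ψ x) := k12.sub i3
    have k1234 : Integrable (fun x => z1 x * ψ x + z2 x * ψ x - z3 x * ψ x - z4 x * ψ x) :=
      k123.sub i4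
    have k56 : Integrable (fun x => z5 x * ψ x - z6 x * ψ x) := i5.sub i6
    rw [hk.weakRHS_eq hF hf, fq, fl, ← integral_add i1 i2, ← integral_sub k12 i3,
      ← integral_sub k123 i4, ← integral_sub i5 i6, ← integral_const_mul, ← integral_const_mul,
      ← integral_add (k1234.const_mul _) (k56.const_mul _)]
    refine integral_congr_ae (Filter.Eventually.of_forall fun v => ?_)
    exact hzψ ψ v

end operator

/-! ### Gronwall inequalities -/

lemma hasDerivWithinAt_Ici_of_Icc {φ : ℝ → ℝ} {d T t : ℝ} (h : HasDerivWithinAt φ d (Icc 0 T) t)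
    (ht : t ∈ Ico 0 T) : HasDerivWithinAt φ d (Ici t) t :=
  h.mono_of_mem_nhdsWithin (Icc_mem_nhdsGE_of_mem ht)

/-- The differential form of Gronwall's inequality. -/
lemma le_gronwallBound_of_deriv_le {φ φ' : ℝ → ℝ} {T δ K η : ℝ}
    (h : ∀ t ∈ Icc 0 T, HasDerivWithinAt φ (φ' t) (Icc 0 T) t) (h0 : φ 0 ≤ δ)
    (hb : ∀ t ∈ Ico 0 T, φ' t ≤ K * φ t + η) : ∀ t ∈ Icc 0 T, φ t ≤ gronwallBound δ K η t := by
  intro t ht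
  have := le_gronwallBound_of_liminf_deriv_right_le (f := φ) (f' := φ') (δ := δ) (K := K) (ε := η)
    (a := 0) (b := T) (fun s hs => (h s hs).continuousWithinAt) (fun x hx r hr => ?_) h0 hb t ht
  · simpa using this
  · have := (hasDerivWithinAt_Ici_of_Icc (h x (Ico_subset_Icc_self hx)) hx).liminf_right_slope_le hr
    refine this.mono fun z hz => ?_
    rwa [slope_def_field, div_eq_inv_mul] at hz

lemma monotone_of_deriv_nonneg {φ φ' : ℝ → ℝ} {T : ℝ}
    (h : ∀ t ∈ Icc 0 T, HasDerivWithinAt φ (φ' t) (Icc 0 T) t) (hb : ∀ t ∈ Icc 0 T, 0 ≤ φ' t) :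
    ∀ t ∈ Icc 0 T, φ 0 ≤ φ t := by
  intro t ht
  have := le_gronwallBound_of_deriv_le (φ := fun t => - φ t) (φ' := fun t => - φ' t) (T := T)
    (δ := - φ 0) (K := 0) (η := 0) (fun t ht => (h t ht).neg) le_rfl
    (fun t ht => by have := hb t (Ico_subset_Icc_self ht); linarith) t ht
  rw [gronwallBound_K0] at this
  linarith

/-- The integral form of Gronwall's inequality, with an integrable forcing term. -/
lemma gronwall_integral {y k : ℝ → ℝ} {a β T : ℝ} (hβ : 0 ≤ β) (hT : 0 ≤ T)
    (hy : ContinuousOn y (Icc 0 T)) (hk : IntervalIntegrable k volume 0 T)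
    (h : ∀ t ∈ Icc 0 T, y t ≤ a + ∫ s in 0..t, (β * y s + k s)) :
    ∀ t ∈ Icc 0 T, y t ≤ Real.exp (β * t) * (a + ∫ s in 0..t, Real.exp (-(β * s)) * k s) := by
  intro t ht
  have hy' : IntervalIntegrable y volume 0 T := by
    rw [← uIcc_of_le hT] at hy; exact hy.intervalIntegrable
  have hz : IntervalIntegrable (fun s => β * y s + k s) volume 0 T := (hy'.const_mul β).add hk
  set Z : ℝ → ℝ := fun t => a + ∫ s in 0..t, (β * y s + k s) with hZ
  have hsub : uIcc 0 t ⊆ uIcc 0 T := by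
    rw [uIcc_of_le hT, uIcc_of_le ht.1]; exact Icc_subset_Icc_right ht.2
  -- Since k is only integrable, the majorant Z is only absolutely continuous; exp(-βs)Z is
  -- differentiated almost everywhere and recovered by the fundamental theorem for such functions.
  have hint := hz.absolutelyContinuousOnInterval_intervalIntegral (c := 0) left_mem_uIcc
  have hconst : AbsolutelyContinuousOnInterval (fun _ : ℝ => a) 0 T :=
    ContDiffOn.absolutelyContinuousOnInterval contDiffOn_const
  have hexp : AbsolutelyContinuousOnInterval (fun s : ℝ => Real.exp (-(β * s))) 0 T :=
    ContDiffOn.absolutelyContinuousOnInterval (by fun_prop)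
  have hZac : AbsolutelyContinuousOnInterval Z 0 T := hconst.fun_add hint
  have hW := (hexp.fun_mul hZac).mono hsub
  have hftc := hW.integral_deriv_eq_sub
  have hle : ∫ x in 0..t, deriv (fun s => Real.exp (-(β * s)) * Z s) x ≤
      ∫ s in 0..t, Real.exp (-(β * s)) * k s := by
    have hk' : IntervalIntegrable k volume 0 t := hk.mono_set hsub
    refine intervalIntegral.integral_mono_ae_restrict ht.1 hW.intervalIntegrable_deriv
      (hk'.continuousOn_mul (by fun_prop)) ?_
    rw [Filter.EventuallyLE, ae_restrict_iff' measurableSet_Icc]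
    filter_upwards [hz.ae_hasDerivAt_integral] with x hx hxt
    have hxT : x ∈ uIcc 0 T := hsub (by rwa [uIcc_of_le ht.1])
    have hd : HasDerivAt Z (β * y x + k x) x := (hx hxT 0 left_mem_uIcc).const_add a
    have he : HasDerivAt (fun s => Real.exp (-(β * s))) (Real.exp (-(β * x)) * -(β * 1)) x :=
      (((hasDerivAt_id x).const_mul β).neg).exp
    rw [(he.fun_mul hd).deriv]
    have hyZ : y x ≤ Z x := h x (by rwa [uIcc_of_le hT] at hxT)
    have hp := Real.exp_pos (-(β * x))
    have := mul_le_mul_of_nonneg_left (mul_le_mul_of_nonneg_left hyZ hβ) hp.le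
    linarith
  rw [hftc] at hle
  have hZ0 : Z 0 = a := by simp [hZ]
  simp only [mul_zero, neg_zero, Real.exp_zero, one_mul, hZ0] at hle
  have e1 : Real.exp (β * t) * Real.exp (-(β * t)) = 1 := by rw [← Real.exp_add]; simp
  calc y t ≤ Z t := h t ht
    _ = Real.exp (β * t) * (Real.exp (-(β * t)) * Z t) := by rw [← mul_assoc, e1, one_mul]
    _ ≤ _ := by gcongr; linarith

/-! ### The energy space -/

/-- The space `L¹_2`. -/
abbrev X : Type := L1 2

lemma two_eq : (2 : ℝ) = ((2 : ℕ) : ℝ) := by norm_num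

lemma three_eq : (3 : ℝ) = ((3 : ℕ) : ℝ) := by norm_num

lemma momX (f : X) : Mom 2 f := mom_coe two_eq f

lemma normX (f : X) : ‖f‖ = nrm 2 f := norm_eq_nrm two_eq f

lemma norm_subX (f g : X) : ‖f - g‖ = nrm 2 (fun v => f v - g v) := norm_sub_eq_nrm two_eq f g

/-- The moment of `f ∈ L¹_2` against a test function. -/
def pair {C : ℝ} {ψ : V → ℝ} (h : Dom C ψ) : X →L[ℝ] ℝ :=
  LinearMap.mkContinuous
    { toFun := fun f => ∫ v, f v * ψ v
      map_add' := fun f g => by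
        rw [← integral_add ((momX f).mul_dom h.meas h.le) ((momX g).mul_dom h.meas h.le)]
        refine integral_congr_ae ?_
        filter_upwards [coe_add' f g] with v hv
        rw [hv]; ring
      map_smul' := fun c f => by
        rw [RingHom.id_apply, smul_eq_mul, ← integral_const_mul]
        refine integral_congr_ae ?_
        filter_upwards [coe_smul' c f] with v hv
        rw [hv]; ring } C (fun f => by
      rw [normX]; exact abs_integral_mul_le (momX f) h.le)

lemma pair_apply {C : ℝ} {ψ : V → ℝ} (h : Dom C ψ) (f : X) : pair h f = ∫ v, f v * ψ v := rfl

/-- The extremal test function sgn(z)⟨v⟩² is merely measurable, which `Dom` allows. The version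
restricted to smooth functions is `nrm_le_of_test`. -/
lemma normX_le_of_dual {z : X} {A : ℝ} (h : ∀ ψ, Dom 1 ψ → ∫ v, z v * ψ v ≤ A) : ‖z‖ ≤ A := by
  have hz : Measurable (z : V → ℝ) := (Lp.stronglyMeasurable z).measurable
  have hd : Dom 1 (fun v => (if 0 ≤ z v then (1 : ℝ) else -1) * bracket v ^ 2) := by
    refine ⟨(Measurable.ite (measurableSet_le measurable_const hz) measurable_const
      measurable_const).mul (measurable_bracket.pow_const 2), fun v => ?_⟩
    rw [abs_mul, abs_of_pos (bracket_pow_pos 2 v)]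
    split_ifs <;> simp
  refine le_of_eq_of_le ?_ (h _ hd)
  rw [normX, nrm]
  congr 1; ext v
  split_ifs with h0
  · rw [abs_of_nonneg h0]; ring
  · rw [abs_of_neg (not_le.1 h0)]; ring

lemma nonnegX_of_dual {z : X} (h : ∀ ψ, Dom 1 ψ → (∀ v, 0 ≤ ψ v) → 0 ≤ ∫ v, z v * ψ v) :
    0 ≤ z := by
  rw [L_nonneg_iff]
  refine ae_nonneg_of_forall_setIntegral_nonneg (momX z).integrable fun s hs _ => ?_
  have hd : Dom 1 (s.indicator fun _ => (1 : ℝ)) :=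
    dom_of_bounded (measurable_const.indicator hs) fun v => by
      by_cases hv : v ∈ s <;> simp [hv]
  have := h _ hd fun v => indicator_nonneg (fun _ _ => zero_le_one) v
  rw [← integral_indicator hs]
  refine this.trans_eq (integral_congr_ae (Filter.Eventually.of_forall fun v => ?_))
  by_cases hv : v ∈ s <;> simp [hv]

lemma normX_of_nonneg {z : X} (h : 0 ≤ z) : ‖z‖ = ∫ v, z v * bracket v ^ 2 := by
  rw [normX, nrm]
  refine integral_congr_ae ?_
  filter_upwards [(L_nonneg_iff z).1 h] with v hv
  have hv' : 0 ≤ z v := hv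
  simp only [abs_of_nonneg hv']

/-! ### Radial retraction -/

/-- The radial retraction onto the ball of radius `ρ`. -/
def retract {E : Type*} [NormedAddCommGroup E] [NormedSpace ℝ E] (ρ : ℝ) (p : E) : E :=
  (ρ / max ρ ‖p‖) • p

section retract
variable {E : Type*} [NormedAddCommGroup E] {ρ : ℝ}

lemma retract_factor_nonneg (hρ : 0 < ρ) (p : E) : 0 ≤ ρ / max ρ ‖p‖ :=
  div_nonneg hρ.le (hρ.le.trans (le_max_left _ _))

lemma retract_factor_le (hρ : 0 < ρ) (p : E) : ρ / max ρ ‖p‖ ≤ 1 :=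
  div_le_one_of_le₀ (le_max_left _ _) (hρ.le.trans (le_max_left _ _))

variable [NormedSpace ℝ E]

lemma norm_retract_le (hρ : 0 < ρ) (p : E) : ‖retract ρ p‖ ≤ ρ := by
  rw [retract, norm_smul, Real.norm_of_nonneg (retract_factor_nonneg hρ p), div_mul_eq_mul_div,
    div_le_iff₀ (hρ.trans_le (le_max_left _ _))]
  exact mul_le_mul_of_nonneg_left (le_max_right _ _) hρ.le

lemma norm_retract_le_norm (hρ : 0 < ρ) (p : E) : ‖retract ρ p‖ ≤ ‖p‖ := by
  rw [retract, norm_smul, Real.norm_of_nonneg (retract_factor_nonneg hρ p)]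
  exact mul_le_of_le_one_left (norm_nonneg _) (retract_factor_le hρ p)

lemma retract_eq (hρ : 0 < ρ) {p : E} (h : ‖p‖ ≤ ρ) : retract ρ p = p := by
  rw [retract, max_eq_left h, div_self hρ.ne', one_smul]

lemma norm_retract_sub_le (hρ : 0 < ρ) (p q : E) :
    ‖retract ρ p - retract ρ q‖ ≤ 2 * ‖p - q‖ := by
  have hp : 0 < max ρ ‖p‖ := hρ.trans_le (le_max_left _ _)
  have hq : 0 < max ρ ‖q‖ := hρ.trans_le (le_max_left _ _)
  -- Either the vector changes or the scaling factor does; each change costs at most ‖p - q‖.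
  have e : retract ρ p - retract ρ q =
      (ρ / max ρ ‖p‖) • (p - q) + (ρ / max ρ ‖p‖ - ρ / max ρ ‖q‖) • q := by
    unfold retract; module
  have h1 : ‖(ρ / max ρ ‖p‖) • (p - q)‖ ≤ ‖p - q‖ := by
    rw [norm_smul, Real.norm_of_nonneg (retract_factor_nonneg hρ p)]
    exact mul_le_of_le_one_left (norm_nonneg _) (retract_factor_le hρ p)
  have h2 : ‖(ρ / max ρ ‖p‖ - ρ / max ρ ‖q‖) • q‖ ≤ ‖p - q‖ := by
    have e2 : ρ / max ρ ‖p‖ - ρ / max ρ ‖q‖ =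
        (ρ / max ρ ‖p‖) * ((max ρ ‖q‖ - max ρ ‖p‖) / max ρ ‖q‖) := by field_simp
    have h3 : |max ρ ‖q‖ - max ρ ‖p‖| ≤ ‖p - q‖ := by
      refine (abs_max_sub_max_le_max _ _ _ _).trans ?_
      rw [sub_self, abs_zero, norm_sub_rev]
      exact max_le (norm_nonneg _) (abs_norm_sub_norm_le _ _)
    rw [norm_smul, e2, norm_mul, Real.norm_of_nonneg (retract_factor_nonneg hρ p), norm_div,
      Real.norm_of_nonneg hq.le, Real.norm_eq_abs]
    calc _ ≤ 1 * (‖p - q‖ / max ρ ‖q‖) * max ρ ‖q‖ := by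
          gcongr
          · exact retract_factor_le hρ p
          · exact le_max_right _ _
      _ = _ := by field_simp
  rw [e]
  linarith [norm_add_le ((ρ / max ρ ‖p‖) • (p - q)) ((ρ / max ρ ‖p‖ - ρ / max ρ ‖q‖) • q)]

end retract

/-- The retraction of `L¹_2` to the nonnegative part of a ball. -/
def retractPos (ρ : ℝ) (f : X) : X := retract ρ (f ⊔ 0)

lemma norm_sup_zero_le (f : X) : ‖f ⊔ 0‖ ≤ ‖f‖ := by
  have := norm_sup_sub_sup_le_norm f 0 0
  simpa using this

lemma retractPos_nonneg {ρ : ℝ} (hρ : 0 < ρ) (f : X) : 0 ≤ retractPos ρ f := by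
  have h := (L_nonneg_iff (f ⊔ 0)).1 le_sup_right
  rw [L_nonneg_iff]
  filter_upwards [h, coe_smul' (ρ / max ρ ‖f ⊔ 0‖) (f ⊔ 0)] with v h1 h2
  have h1' : 0 ≤ (f ⊔ 0 : X) v := h1
  unfold retractPos retract
  rw [h2]
  exact mul_nonneg (retract_factor_nonneg hρ _) h1'

lemma norm_retractPos_sub_le {ρ : ℝ} (hρ : 0 < ρ) (f g : X) :
    ‖retractPos ρ f - retractPos ρ g‖ ≤ 2 * ‖f - g‖ :=
  (norm_retract_sub_le hρ _ _).trans
    (mul_le_mul_of_nonneg_left (norm_sup_sub_sup_le_norm f g 0) (by norm_num))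

lemma norm_retractPos_le {ρ : ℝ} (hρ : 0 < ρ) (f : X) : ‖retractPos ρ f‖ ≤ ρ :=
  norm_retract_le hρ _

lemma norm_retractPos_le_norm {ρ : ℝ} (hρ : 0 < ρ) (f : X) : ‖retractPos ρ f‖ ≤ ‖f‖ :=
  (norm_retract_le_norm hρ _).trans (norm_sup_zero_le f)

lemma retractPos_eq {ρ : ℝ} (hρ : 0 < ρ) {f : X} (h0 : 0 ≤ f) (h : ‖f‖ ≤ ρ) :
    retractPos ρ f = f := by
  rw [retractPos, sup_eq_left.2 h0, retract_eq hρ h]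

/-! ### The truncated Cauchy problem -/

section truncated
variable {τ ε lam m₁ e : ℝ}

lemma exists_collision_operator (hp : Params τ ε lam m₁ e) {F : V → ℝ} (hF : Mom 3 F) (r : ℝ) :
    ∃ R : X → X, ∀ (g : X) (C : ℝ) (ψ : V → ℝ), Dom C ψ → ∫ v, R g v * ψ v =
      weakRHS τ ε lam m₁ e ((ballS r).indicator F) ((ballS r).indicator g) ψ := by
  have h : ∀ g : X, ∃ z : X, ∀ (C : ℝ) (ψ : V → ℝ), Dom C ψ → ∫ v, z v * ψ v =
      weakRHS τ ε lam m₁ e ((ballS r).indicator F) ((ballS r).indicator g) ψ := fun g => by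
    obtain ⟨z, hz, h⟩ := hp.exists_density (hF.indicator (measurableSet_ballS r))
      (mom_indicator_ballS (j := 1) (r := r) (momX g))
    refine ⟨toL two_eq z hz, fun C ψ hψ => ?_⟩
    rw [← h C ψ hψ]
    refine integral_congr_ae ?_
    filter_upwards [coe_toL two_eq hz] with v hv
    rw [hv]
  choose R hR using h
  exact ⟨R, hR⟩

lemma indicator_sub_fun (S : Set V) (f g : V → ℝ) :
    (fun v => S.indicator f v - S.indicator g v) = S.indicator fun v => f v - g v := by
  ext v
  by_cases h : v ∈ S <;> simp [h]

/-- Truncation trades one power of the bracket for a factor r, so the third moments demanded by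
quadratic test functions are controlled by the norm of `L¹_2`. -/
lemma Dom.abs_truncated_sub_le (hp : Params τ ε lam m₁ e) {F : V → ℝ} (hF : Mom 3 F) {r ρ : ℝ}
    (hr : 0 ≤ r) {ψ : V → ℝ} (hψ : Dom 1 ψ) {f g : X} (hf : ‖f‖ ≤ ρ) (hg : ‖g‖ ≤ ρ) :
    |weakRHS τ ε lam m₁ e ((ballS r).indicator F) ((ballS r).indicator f) ψ -
      weakRHS τ ε lam m₁ e ((ballS r).indicator F) ((ballS r).indicator g) ψ| ≤
      (τ / 2 * 8 * (r * ρ + r * ρ) + 1 / lam * (2 * (2 + m₁)) * nrm 3 F) * r * ‖f - g‖ := by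
  have hS := measurableSet_ballS r
  have hχF := hF.indicator hS
  have hχf : Mom 3 ((ballS r).indicator f) := mom_indicator_ballS (j := 1) (momX f)
  have hχg : Mom 3 ((ballS r).indicator g) := mom_indicator_ballS (j := 1) (momX g)
  have h := (hψ.ker hp).abs_weakRHS_sub_le hp hχF hχF hχf hχg
  have hτ := hp.hτ
  have hm := hp.hm₁
  have hl := hp.hlam
  have b1 : nrm 3 ((ballS r).indicator f) ≤ r * ρ := by
    have := nrm_indicator_ballS_le (j := 1) hr (momX f)
    rw [pow_one, ← normX] at this
    exact this.trans (by gcongr)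
  have b2 : nrm 3 ((ballS r).indicator g) ≤ r * ρ := by
    have := nrm_indicator_ballS_le (j := 1) hr (momX g)
    rw [pow_one, ← normX] at this
    exact this.trans (by gcongr)
  have b3 : nrm 3 (fun v => (ballS r).indicator f v - (ballS r).indicator g v) ≤ r * ‖f - g‖ := by
    rw [indicator_sub_fun, norm_subX]
    have := nrm_indicator_ballS_le (j := 1) hr ((momX f).sub (momX g))
    rwa [pow_one] at this
  have b4 := nrm_indicator_le hF hS
  have b5 : nrm 3 (fun v => (ballS r).indicator F v - (ballS r).indicator F v) = 0 := by
    simp [nrm]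
  rw [b5, mul_zero, add_zero, mul_one, mul_one] at h
  refine h.trans ?_
  rw [mul_assoc _ r]
  have := nrm_nonneg 3 (fun v => (ballS r).indicator f v - (ballS r).indicator g v)
  have := nrm_nonneg 3 F
  have := (norm_nonneg f).trans hf
  gcongr

/-- The exponential growth rate of the energy. -/
def growthC (lam m₁ : ℝ) (F : V → ℝ) : ℝ := 2 * m₁ * (1 / lam) * nrm 3 F

lemma Params.growthC_nonneg (hp : Params τ ε lam m₁ e) (F : V → ℝ) : 0 ≤ growthC lam m₁ F := by
  have := hp.hm₁
  have := hp.hlam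
  have := nrm_nonneg 3 F
  unfold growthC
  positivity

/-- `u` solves the truncated problem against all test functions of quadratic growth. -/
structure IsTruncSol (τ ε lam m₁ e : ℝ) (F : V → ℝ) (r T : ℝ) (u : ℝ → X) : Prop where
  cont : ContinuousOn u (Icc 0 T)
  nonneg : ∀ t ∈ Icc 0 T, 0 ≤ u t
  norm_le : ∀ t ∈ Icc 0 T, ‖u t‖ ≤ Real.exp (growthC lam m₁ F * T) * ‖u 0‖
  equation : ∀ (C : ℝ) (ψ : V → ℝ), Dom C ψ → ∀ t ∈ Icc 0 T,
    HasDerivWithinAt (fun s => ∫ v, u s v * ψ v)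
      (weakRHS τ ε lam m₁ e ((ballS r).indicator F) ((ballS r).indicator (u t)) ψ) (Icc 0 T) t

/-- The unknown is y = exp(ct)u, which turns u' = R(u) into y' = exp(ct)P(u) with P = R + c. The
constant c dominates the loss rate, so P maps nonnegative elements of the ball to nonnegative ones.
Composing P with the retraction makes the field globally Lipschitz and bounded, and the energy
estimate shows afterwards that the retraction was never active. -/
theorem exists_truncSol (hp : Params τ ε lam m₁ e) {F : V → ℝ} (hF : Mom 3 F)
    (hF0 : 0 ≤ᵐ[volume] F) {r : ℝ} (hr : 0 ≤ r) {T : ℝ} (hT : 0 < T) {f₀ : X} (hf₀ : 0 ≤ f₀) :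
    ∃ u : ℝ → X, u 0 = f₀ ∧ IsTruncSol τ ε lam m₁ e F r T u := by
  obtain ⟨R, hR⟩ := exists_collision_operator hp hF r
  have hb := hp.growthC_nonneg F
  set b := growthC lam m₁ F with hbdef
  -- The a priori energy bound, increased by one so that the radius is positive even for zero datum.
  set ρ : ℝ := Real.exp (b * T) * ‖f₀‖ + 1 with hρdef
  have hρ : 0 < ρ := by positivity
  -- The bound of `Dom.weakRHS_lower` on the loss rate, for densities of norm at most ρ.
  set c : ℝ := 2 * r * (τ * ρ + 1 / lam * nrm 0 F) with hcdef
  have hτ := hp.hτ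
  have hlam := hp.hlam
  have hm := hp.hm₁
  have hc : 0 ≤ c := by have := nrm_nonneg 0 F; positivity
  set P : X → X := fun g => R g + c • g with hP
  have hPψ : ∀ (g : X) {C : ℝ} {ψ : V → ℝ} (hψ : Dom C ψ), ∫ v, P g v * ψ v =
      weakRHS τ ε lam m₁ e ((ballS r).indicator F) ((ballS r).indicator g) ψ +
        c * ∫ v, g v * ψ v := fun g C ψ hψ => by
    have := (pair hψ).map_add (R g) (c • g)
    rw [map_smul, pair_apply, pair_apply, pair_apply, hR g C ψ hψ, smul_eq_mul] at this
    exact this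
  have hPpos : ∀ g : X, 0 ≤ g → ‖g‖ ≤ ρ → 0 ≤ P g := fun g hg hgρ => by
    refine nonnegX_of_dual fun ψ hψ hψ0 => ?_
    rw [hPψ g hψ]
    have hg' := (L_nonneg_iff g).1 hg
    have h1 := hψ.weakRHS_lower hp hψ0 hF hF0 (momX g) hg' hr
    have h2 : 0 ≤ ∫ v, g v * ψ v := integral_nonneg_of_ae (by
      filter_upwards [hg'] with v hv
      exact mul_nonneg hv (hψ0 v))
    have h3 : nrm 0 g ≤ ρ := (nrm_mono (by norm_num) (momX g)).trans (by rw [← normX]; exact hgρ)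
    have h4 : 2 * r * (τ * nrm 0 g + 1 / lam * nrm 0 F) ≤ c := by
      rw [hcdef]; gcongr
    have := mul_le_mul_of_nonneg_right h4 h2
    linarith
  set L₀ : ℝ := (τ / 2 * 8 * (r * ρ + r * ρ) + 1 / lam * (2 * (2 + m₁)) * nrm 3 F) * r + c
    with hL₀def
  have hL₀ : 0 ≤ L₀ := by have := nrm_nonneg 3 F; positivity
  have hPlip : ∀ f g : X, ‖f‖ ≤ ρ → ‖g‖ ≤ ρ → ‖P f - P g‖ ≤ L₀ * ‖f - g‖ := fun f g hf hg => by
    have h1 : ‖R f - R g‖ ≤ (L₀ - c) * ‖f - g‖ := by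
      refine normX_le_of_dual fun ψ hψ => ?_
      have := (pair hψ).map_sub (R f) (R g)
      rw [pair_apply, pair_apply, pair_apply, hR f 1 ψ hψ, hR g 1 ψ hψ] at this
      rw [this]
      refine (le_abs_self _).trans ((hψ.abs_truncated_sub_le hp hF hr hf hg).trans_eq ?_)
      rw [hL₀def]; ring
    have e1 : P f - P g = (R f - R g) + c • (f - g) := by
      simp only [hP, smul_sub]; abel
    rw [e1]
    refine (norm_add_le _ _).trans ?_
    rw [norm_smul, Real.norm_of_nonneg hc]
    linarith
  have hPi : ∀ f g : X, ‖P (retractPos ρ f) - P (retractPos ρ g)‖ ≤ (2 * L₀) * ‖f - g‖ :=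
    fun f g => by
    refine (hPlip _ _ (norm_retractPos_le hρ f) (norm_retractPos_le hρ g)).trans ?_
    have := mul_le_mul_of_nonneg_left (norm_retractPos_sub_le hρ f g) hL₀
    linarith
  have hPbound : ∀ f : X, ‖P (retractPos ρ f)‖ ≤ ‖P 0‖ + L₀ * ρ := fun f => by
    have h1 := hPlip _ 0 (norm_retractPos_le hρ f) (by rw [norm_zero]; exact hρ.le)
    rw [sub_zero] at h1
    have h2 := norm_add_le (P (retractPos ρ f) - P 0) (P 0)
    rw [sub_add_cancel] at h2
    have h3 := mul_le_mul_of_nonneg_left (norm_retractPos_le hρ f) hL₀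
    linarith
  set Y : ℝ → X → X := fun t y => Real.exp (c * t) • P (retractPos ρ (Real.exp (-(c * t)) • y))
    with hY
  have hexpT : ∀ t ∈ Icc (0 : ℝ) T, Real.exp (c * t) ≤ Real.exp (c * T) := fun t ht =>
    Real.exp_le_exp.2 (mul_le_mul_of_nonneg_left ht.2 hc)
  have hexpn : ∀ t ∈ Icc (0 : ℝ) T, Real.exp (-(c * t)) ≤ 1 := fun t ht =>
    Real.exp_le_one_iff.2 (neg_nonpos.2 (mul_nonneg hc ht.1))
  have hLip : LipschitzWith (2 * L₀).toNNReal (fun f => P (retractPos ρ f)) :=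
    LipschitzWith.of_dist_le_mul fun f g => by
      rw [dist_eq_norm, dist_eq_norm, Real.coe_toNNReal _ (by positivity)]
      exact hPi f g
  set L : ℝ := Real.exp (c * T) * (‖P 0‖ + L₀ * ρ) with hL
  have hL0 : 0 ≤ L := by positivity
  set K : ℝ := Real.exp (c * T) * (2 * L₀) with hK
  have hK0 : 0 ≤ K := by positivity
  -- The field is bounded by L everywhere, so a ball of radius LT is never left and one application
  -- covers the whole of [0,T].
  have hPL : IsPicardLindelof Y (⟨0, left_mem_Icc.2 hT.le⟩ : Icc (0 : ℝ) T) f₀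
      (L * T).toNNReal 0 L.toNNReal K.toNNReal := by
    refine ⟨fun t ht => ?_, fun x _ => ?_, fun t ht x _ => ?_, ?_⟩
    · refine LipschitzOnWith.of_dist_le_mul fun x _ y _ => ?_
      rw [dist_eq_norm, dist_eq_norm, Real.coe_toNNReal _ hK0, hY]
      simp only []
      rw [← smul_sub, norm_smul, Real.norm_of_nonneg (Real.exp_pos _).le]
      have h1 := hPi (Real.exp (-(c * t)) • x) (Real.exp (-(c * t)) • y)
      rw [← smul_sub, norm_smul, Real.norm_of_nonneg (Real.exp_pos _).le] at h1
      have h2 : Real.exp (-(c * t)) * ‖x - y‖ ≤ ‖x - y‖ :=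
        mul_le_of_le_one_left (norm_nonneg _) (hexpn t ht)
      have h3 := mul_le_mul_of_nonneg_left h2 (show 0 ≤ 2 * L₀ by positivity)
      calc _ ≤ Real.exp (c * T) * ((2 * L₀) * ‖x - y‖) :=
            mul_le_mul (hexpT t ht) (h1.trans h3) (norm_nonneg _) (Real.exp_pos _).le
        _ = _ := by rw [hK]; ring
    · have h1 : Continuous fun t : ℝ => Real.exp (-(c * t)) • x := by fun_prop
      have h2 : Continuous fun t : ℝ => Real.exp (c * t) := by fun_prop
      exact (h2.smul (hLip.continuous.comp h1)).continuousOn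
    · rw [Real.coe_toNNReal _ hL0, hY]
      simp only []
      rw [norm_smul, Real.norm_of_nonneg (Real.exp_pos _).le]
      exact mul_le_mul (hexpT t ht) (hPbound _) (norm_nonneg _) (Real.exp_pos _).le
    · rw [Real.coe_toNNReal _ hL0, Real.coe_toNNReal _ (by positivity)]
      simp [hT.le]
  obtain ⟨y, hy0, hy⟩ := hPL.exists_eq_forall_mem_Icc_hasDerivWithinAt₀
  simp only [] at hy0
  have hycont : ContinuousOn y (Icc 0 T) := fun t ht => (hy t ht).continuousWithinAt
  have hpair : ∀ {C : ℝ} {ψ : V → ℝ} (hψ : Dom C ψ), ∀ t ∈ Icc 0 T,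
      HasDerivWithinAt (fun s => ∫ v, y s v * ψ v) (∫ v, Y t (y t) v * ψ v) (Icc 0 T) t :=
    fun hψ t ht => (pair hψ).hasFDerivAt.comp_hasDerivWithinAt t (hy t ht)
  have hYψ : ∀ {C : ℝ} {ψ : V → ℝ} (hψ : Dom C ψ) (t : ℝ) (x : X), ∫ v, Y t x v * ψ v =
      Real.exp (c * t) * ∫ v, P (retractPos ρ (Real.exp (-(c * t)) • x)) v * ψ v :=
    fun hψ t x => (pair hψ).map_smul _ _
  have hynn : ∀ t ∈ Icc 0 T, 0 ≤ y t := fun t ht => by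
    refine nonnegX_of_dual fun ψ hψ hψ0 => ?_
    have h1 := monotone_of_deriv_nonneg (hpair hψ) (fun s hs => ?_) t ht
    · refine le_trans ?_ h1
      rw [hy0]
      refine integral_nonneg_of_ae ?_
      filter_upwards [(L_nonneg_iff f₀).1 hf₀] with v hv
      exact mul_nonneg hv (hψ0 v)
    · rw [hYψ hψ]
      refine mul_nonneg (Real.exp_pos _).le (integral_nonneg_of_ae ?_)
      have := (L_nonneg_iff _).1 (hPpos _ (retractPos_nonneg hρ (Real.exp (-(c * s)) • y s))
        (norm_retractPos_le hρ _))
      filter_upwards [this] with v hv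
      exact mul_nonneg hv (hψ0 v)
  set u : ℝ → X := fun t => Real.exp (-(c * t)) • y t with hu
  have hee : ∀ t : ℝ, Real.exp (c * t) * Real.exp (-(c * t)) = 1 := fun t => by
    rw [← Real.exp_add]; simp
  -- For nonnegative y the norm is the moment against ⟨v⟩², hence differentiable. The retraction
  -- does not increase norms, so the energy estimate closes before it is known to be inactive. The
  -- part c of the rate disappears on returning to u.
  have hynorm : ∀ t ∈ Icc 0 T, ‖y t‖ ≤ ‖f₀‖ * Real.exp ((c + b) * t) := by
    have h := le_gronwallBound_of_deriv_le (T := T) (δ := ‖f₀‖) (K := c + b) (η := 0)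
      (hpair dom_sq) ?_ ?_
    · intro t ht
      have := h t ht
      rwa [← normX_of_nonneg (hynn t ht), gronwallBound_ε0] at this
    · rw [← hy0]
      exact (normX_of_nonneg (hynn 0 (left_mem_Icc.2 hT.le))).ge
    · intro t ht
      rw [← normX_of_nonneg (hynn t (Ico_subset_Icc_self ht)), hYψ dom_sq, hPψ _ dom_sq, add_zero]
      set g := retractPos ρ (Real.exp (-(c * t)) • y t) with hg
      have hg0 := retractPos_nonneg hρ (Real.exp (-(c * t)) • y t)
      have h1 := hp.weakRHS_energy hF hF0 (momX g) ((L_nonneg_iff _).1 hg0) r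
      have h2 : ‖g‖ ≤ Real.exp (-(c * t)) * ‖y t‖ := by
        have := norm_retractPos_le_norm hρ (Real.exp (-(c * t)) • y t)
        rwa [norm_smul, Real.norm_of_nonneg (Real.exp_pos _).le] at this
      rw [← normX_of_nonneg hg0]
      rw [← normX] at h1
      have h3 : 2 * m₁ * (1 / lam) * nrm 3 F = b := rfl
      rw [h3] at h1
      have h4 := mul_le_mul_of_nonneg_left h2 (add_nonneg hb hc)
      calc _ ≤ Real.exp (c * t) * ((b + c) * (Real.exp (-(c * t)) * ‖y t‖)) := by
            refine mul_le_mul_of_nonneg_left ?_ (Real.exp_pos _).le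
            linarith
        _ = (Real.exp (c * t) * Real.exp (-(c * t))) * ((c + b) * ‖y t‖) := by ring
        _ = _ := by rw [hee, one_mul]
  have hunorm' : ∀ t ∈ Icc 0 T, ‖u t‖ ≤ Real.exp (b * T) * ‖f₀‖ := fun t ht => by
    rw [hu]; simp only []
    rw [norm_smul, Real.norm_of_nonneg (Real.exp_pos _).le]
    calc _ ≤ Real.exp (-(c * t)) * (‖f₀‖ * Real.exp ((c + b) * t)) :=
          mul_le_mul_of_nonneg_left (hynorm t ht) (Real.exp_pos _).le
      _ = (Real.exp (c * t) * Real.exp (-(c * t))) * (Real.exp (b * t) * ‖f₀‖) := by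
          rw [add_mul, Real.exp_add]; ring
      _ = Real.exp (b * t) * ‖f₀‖ := by rw [hee, one_mul]
      _ ≤ _ := by
          refine mul_le_mul_of_nonneg_right (Real.exp_le_exp.2 ?_) (norm_nonneg _)
          exact mul_le_mul_of_nonneg_left ht.2 hb
  have hu0 : u 0 = f₀ := by simp [hu, hy0]
  have hunn : ∀ t ∈ Icc 0 T, 0 ≤ u t := fun t ht => by
    rw [L_nonneg_iff]
    filter_upwards [(L_nonneg_iff _).1 (hynn t ht), coe_smul' (Real.exp (-(c * t))) (y t)]
      with v h1 h2
    have h1' : 0 ≤ y t v := h1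
    rw [hu]; simp only []
    rw [h2]
    exact mul_nonneg (Real.exp_pos _).le h1'
  refine ⟨u, hu0, ⟨?_, hunn, fun t ht => by rw [hu0]; exact hunorm' t ht, fun C ψ hψ t ht => ?_⟩⟩
  · have h : Continuous fun t : ℝ => Real.exp (-(c * t)) := by fun_prop
    exact h.continuousOn.smul hycont
  · have hret : retractPos ρ (u t) = u t := retractPos_eq hρ (hunn t ht) (by
      have := hunorm' t ht; linarith)
    have he : HasDerivWithinAt (fun s : ℝ => Real.exp (-(c * s)))
        (Real.exp (-(c * t)) * -(c * 1)) (Icc 0 T) t :=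
      ((((hasDerivAt_id t).const_mul c).neg).exp).hasDerivWithinAt
    have hd := he.fun_mul (hpair hψ t ht)
    have e1 : ∀ s, ∫ v, u s v * ψ v = Real.exp (-(c * s)) * ∫ v, y s v * ψ v := fun s =>
      (pair hψ).map_smul _ _
    simp only [e1]
    refine hd.congr_deriv ?_
    have e2 : retractPos ρ (Real.exp (-(c * t)) • y t) = u t := hret
    rw [hYψ hψ, e2, hPψ _ hψ, e1]
    have := hee t
    have e3 : Real.exp (-(c * t)) * (Real.exp (c * t) * (weakRHS τ ε lam m₁ e
        ((ballS r).indicator F) ((ballS r).indicator (u t)) ψ +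
        c * (Real.exp (-(c * t)) * ∫ v, y t v * ψ v))) = (weakRHS τ ε lam m₁ e
        ((ballS r).indicator F) ((ballS r).indicator (u t)) ψ +
        c * (Real.exp (-(c * t)) * ∫ v, y t v * ψ v)) := by
      rw [← mul_assoc, mul_comm (Real.exp (-(c * t))), this, one_mul]
    rw [e3]
    ring

end truncated

/-! ### Limits of truncations -/

lemma exists_nat_mem_ballS (v : V) : ∃ N : ℕ, ∀ n ≥ N, v ∈ ballS (n : ℝ) := by
  obtain ⟨N, hN⟩ := exists_nat_ge (bracket v)
  exact ⟨N, fun n hn => hN.trans (by exact_mod_cast hn)⟩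

lemma tendsto_tail {k : ℕ} {f : V → ℝ} (hf : Mom k f) :
    Filter.Tendsto (fun n : ℕ => nrm k ((ballS (n : ℝ))ᶜ.indicator f)) Filter.atTop (nhds 0) := by
  have : (0 : ℝ) = ∫ _ : V, (0 : ℝ) := by simp
  rw [this]
  refine tendsto_integral_of_dominated_convergence (fun v => |f v| * bracket v ^ k)
    (fun n => (hf.indicator (measurableSet_ballS _).compl).integrable_abs.aestronglyMeasurable)
    hf.integrable_abs (fun n => Filter.Eventually.of_forall fun v => ?_)
    (Filter.Eventually.of_forall fun v => ?_)
  · have hb := bracket_pow_pos k v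
    rw [Real.norm_eq_abs, abs_mul, abs_abs, abs_of_pos hb]
    refine mul_le_mul_of_nonneg_right ?_ hb.le
    by_cases h : v ∈ (ballS (n : ℝ))ᶜ
    · rw [indicator_of_mem h]
    · rw [indicator_of_notMem h, abs_zero]; exact abs_nonneg _
  · obtain ⟨N, hN⟩ := exists_nat_mem_ballS v
    refine tendsto_const_nhds.congr' ?_
    filter_upwards [Filter.eventually_ge_atTop N] with n hn
    rw [indicator_of_notMem (show v ∉ (ballS (n : ℝ))ᶜ from fun h => h (hN n hn))]
    simp

lemma nrm_eq_add_compl {k : ℕ} {f : V → ℝ} (hf : Mom k f) {S : Set V} (hS : MeasurableSet S) :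
    nrm k f = nrm k (S.indicator f) + nrm k (Sᶜ.indicator f) := by
  unfold nrm
  rw [← integral_add (hf.indicator hS).integrable_abs (hf.indicator hS.compl).integrable_abs]
  congr 1; ext v
  by_cases h : v ∈ S
  · have h' : v ∉ Sᶜ := fun hh => hh h
    simp [h]
  · simp [h]

/-- Fatou's lemma as the cap is removed. -/
lemma mom_of_capW {k : ℕ} {f : V → ℝ} (hf : AEStronglyMeasurable f volume) (hf0 : 0 ≤ᵐ[volume] f)
    {A : ℝ} (hi : ∀ n : ℕ, Integrable (fun v => f v * capW k n v)) {N : ℕ}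
    (h : ∀ n : ℕ, N ≤ n → ∫ v, f v * capW k n v ≤ A) : Mom k f ∧ nrm k f ≤ A := by
  have hnn : ∀ n : ℕ, 0 ≤ᵐ[volume] fun v => f v * capW k n v := fun n => by
    filter_upwards [hf0] with v hv
    exact mul_nonneg hv (capW_nonneg (Nat.cast_nonneg n) v)
  have hA : 0 ≤ A := (integral_nonneg_of_ae (hnn N)).trans (h N le_rfl)
  have hlim : ∀ v, Filter.Tendsto (fun n : ℕ => ENNReal.ofReal (f v * capW k n v)) Filter.atTop
      (nhds (ENNReal.ofReal (f v * bracket v ^ k))) := fun v => by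
    obtain ⟨N, hN⟩ := exists_nat_ge (bracket v ^ k)
    refine tendsto_const_nhds.congr' ?_
    filter_upwards [Filter.eventually_ge_atTop N] with n hn
    have : bracket v ^ k ≤ (n : ℝ) := hN.trans (by exact_mod_cast hn)
    rw [capW, min_eq_left this]
  have hl : ∫⁻ v, ENNReal.ofReal (f v * bracket v ^ k) ≤ ENNReal.ofReal A := by
    have h1 := lintegral_liminf_le' (μ := volume) (u := Filter.atTop)
      (f := fun (n : ℕ) v => ENNReal.ofReal (f v * capW k n v))
      (fun n => (hi n).aestronglyMeasurable.aemeasurable.ennreal_ofReal)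
    have h2 : ∀ v, Filter.liminf (fun n : ℕ => ENNReal.ofReal (f v * capW k n v)) Filter.atTop =
        ENNReal.ofReal (f v * bracket v ^ k) := fun v => (hlim v).liminf_eq
    simp only [h2] at h1
    refine h1.trans (Filter.liminf_le_of_frequently_le' (Filter.Eventually.frequently ?_))
    filter_upwards [Filter.eventually_ge_atTop N] with n hn
    rw [← ofReal_integral_eq_lintegral_ofReal (hi n) (hnn n)]
    exact ENNReal.ofReal_le_ofReal (h n hn)
  have hae : 0 ≤ᵐ[volume] fun v => f v * bracket v ^ k := by
    filter_upwards [hf0] with v hv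
    exact mul_nonneg hv (bracket_pow_pos k v).le
  have hm : Mom k f := by
    refine ⟨hf.mul (measurable_bracket.pow_const k).aestronglyMeasurable, ?_⟩
    rw [hasFiniteIntegral_iff_ofReal hae]
    exact hl.trans_lt ENNReal.ofReal_lt_top
  refine ⟨hm, ?_⟩
  have e : nrm k f = ∫ v, f v * bracket v ^ k := by
    refine integral_congr_ae ?_
    filter_upwards [hf0] with v hv
    have hv' : 0 ≤ f v := hv
    simp only [abs_of_nonneg hv']
  rw [e, ← ENNReal.ofReal_le_ofReal_iff hA, ofReal_integral_eq_lintegral_ofReal hm hae]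
  exact hl

/-! ### Duality with smooth test functions -/

/-- Smooth test functions bounded by the quadratic weight. -/
structure SqTest (ψ : V → ℝ) : Prop where
  test : IsTest ψ
  le : ∀ v, |ψ v| ≤ bracket v ^ 2

lemma SqTest.dom {ψ : V → ℝ} (h : SqTest ψ) : Dom 1 ψ :=
  ⟨h.test.1.continuous.measurable, fun v => by rw [one_mul]; exact h.le v⟩

lemma contDiff_bracket_sq : ContDiff ℝ (⊤ : ℕ∞) fun v => bracket v ^ 2 := by
  simp only [bracket_sq]
  exact contDiff_const.add (contDiff_norm_sq ℝ)

open scoped Convolution in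
lemma exists_sqTest_approx {s : V → ℝ} (hs : Measurable s) (hb : ∀ v, |s v| ≤ 1)
    (hc : HasCompactSupport s) : ∃ ψ : ℕ → V → ℝ, (∀ n, SqTest (ψ n)) ∧
      ∀ᵐ v, Filter.Tendsto (fun n => ψ n v) Filter.atTop (nhds (s v * bracket v ^ 2)) := by
  let φ : ℕ → ContDiffBump (0 : V) := fun n =>
    ⟨1 / (n + 1), 2 * (1 / (n + 1)), by positivity, by
      have : (0 : ℝ) < 1 / (n + 1) := by positivity
      linarith⟩
  have hφ : Filter.Tendsto (fun n => (φ n).rOut) Filter.atTop (nhds 0) := by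
    have := (tendsto_one_div_add_atTop_nhds_zero_nat (𝕜 := ℝ)).const_mul 2
    simpa [φ] using this
  have hloc : LocallyIntegrable s volume := by
    refine (locallyIntegrable_const (1 : ℝ)).mono hs.aestronglyMeasurable
      (Filter.Eventually.of_forall fun v => ?_)
    rw [norm_one]; exact hb v
  set q : ℕ → V → ℝ := fun n => (φ n).normed volume ⋆[ContinuousLinearMap.lsmul ℝ ℝ, volume] s
  have hq1 : ∀ n v, |q n v| ≤ 1 := fun n v => by
    have := dist_convolution_le (μ := (volume : Measure V)) (x₀ := v) (z₀ := (0 : ℝ)) zero_le_one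
      (φ n).support_normed_eq.subset (φ n).nonneg_normed (φ n).integral_normed
      hs.aestronglyMeasurable (fun x _ => by rw [dist_zero_right]; exact hb x)
    rwa [dist_zero_right] at this
  have hq2 : ∀ n, ContDiff ℝ (⊤ : ℕ∞) (q n) := fun n =>
    HasCompactSupport.contDiff_convolution_left _ (φ n).hasCompactSupport_normed
      (φ n).contDiff_normed hloc
  have hq3 : ∀ n, HasCompactSupport (q n) := fun n =>
    (φ n).hasCompactSupport_normed.convolution _ hc
  -- Only s is mollified and the smooth weight is multiplied in afterwards. The bound by ⟨v⟩² thus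
  -- holds without a loss in the constant.
  refine ⟨fun n v => q n v * bracket v ^ 2, fun n => ⟨⟨(hq2 n).mul contDiff_bracket_sq,
    (hq3 n).mul_right⟩, fun v => ?_⟩, ?_⟩
  · rw [abs_mul, abs_of_pos (bracket_pow_pos 2 v)]
    exact mul_le_of_le_one_left (bracket_pow_pos 2 v).le (hq1 n v)
  · filter_upwards [ContDiffBump.ae_convolution_tendsto_right_of_locallyIntegrable (φ := φ) (K := 2)
      hφ (Filter.Eventually.of_forall fun n => le_rfl) hloc] with v hv
    exact hv.mul_const _

/-- The sign of h cut off to a ball is approximated almost everywhere by mollification; dominated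
convergence gives the bound on the ball, and the tail vanishes as the ball grows. -/
lemma nrm_le_of_test {h : V → ℝ} (hh : Mom 2 h) {A : ℝ}
    (H : ∀ ψ, SqTest ψ → ∫ v, h v * ψ v ≤ A) : nrm 2 h ≤ A := by
  set g := hh.aesm.mk h with hg
  have hgm : Measurable g := hh.aesm.stronglyMeasurable_mk.measurable
  have hgh : h =ᵐ[volume] g := hh.aesm.ae_eq_mk
  have key : ∀ n : ℕ, nrm 2 ((ballS (n : ℝ)).indicator h) ≤ A := fun n => by
    set s : V → ℝ := (ballS (n : ℝ)).indicator fun v => if 0 ≤ g v then (1 : ℝ) else -1 with hs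
    have hsm : Measurable s := (Measurable.ite (measurableSet_le measurable_const hgm)
      measurable_const measurable_const).indicator (measurableSet_ballS _)
    have hs1 : ∀ v, |s v| ≤ 1 := fun v => by
      by_cases hv : v ∈ ballS (n : ℝ)
      · rw [hs, indicator_of_mem hv]; split_ifs <;> simp
      · rw [hs, indicator_of_notMem hv]; simp
    have hsc : HasCompactSupport s := by
      refine HasCompactSupport.of_support_subset_isCompact (isCompact_closedBall (0 : V) n) ?_
      intro v hv
      have : v ∈ ballS (n : ℝ) := by
        by_contra h0
        exact hv (indicator_of_notMem h0 _)
      rw [mem_closedBall_zero_iff]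
      exact (norm_le_bracket v).trans this
    obtain ⟨ψ, hψ, hlim⟩ := exists_sqTest_approx hsm hs1 hsc
    have hconv : Filter.Tendsto (fun j => ∫ v, h v * ψ j v) Filter.atTop
        (nhds (∫ v, h v * (s v * bracket v ^ 2))) := by
      refine tendsto_integral_of_dominated_convergence (fun v => |h v| * bracket v ^ 2)
        (fun j => (hh.mul_dom (hψ j).dom.meas (hψ j).dom.le).aestronglyMeasurable)
        hh.integrable_abs (fun j => Filter.Eventually.of_forall fun v => ?_) ?_
      · rw [Real.norm_eq_abs, abs_mul]
        exact mul_le_mul_of_nonneg_left ((hψ j).le v) (abs_nonneg _)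
      · filter_upwards [hlim] with v hv
        exact hv.const_mul _
    have e : nrm 2 ((ballS (n : ℝ)).indicator h) = ∫ v, h v * (s v * bracket v ^ 2) := by
      refine integral_congr_ae ?_
      filter_upwards [hgh] with v hv
      by_cases hm : v ∈ ballS (n : ℝ)
      · simp only [hs, indicator_of_mem hm]
        rw [hv]
        split_ifs with h0
        · rw [abs_of_nonneg h0]; ring
        · rw [abs_of_neg (not_le.1 h0)]; ring
      · simp only [hs, indicator_of_notMem hm]; simp
    rw [e]
    exact le_of_tendsto' hconv fun j => H _ (hψ j)
  have hlim := (tendsto_tail hh).const_add A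
  rw [add_zero] at hlim
  refine ge_of_tendsto' hlim fun n => ?_
  rw [nrm_eq_add_compl hh (measurableSet_ballS n)]
  linarith [key n]

/-! ### Propagation of moments for the truncated problem -/

section moments
variable {τ ε lam m₁ e : ℝ}

lemma integral_capW_le {k : ℕ} {f : V → ℝ} (hf : Mom k f) (hf2 : Mom 2 f) (hf0 : 0 ≤ᵐ[volume] f)
    {R : ℝ} (hR : 0 ≤ R) : ∫ v, f v * capW k R v ≤ nrm k f := by
  have hd := dom_capW (k := k) hR
  refine integral_mono_ae (hf2.mul_dom hd.meas hd.le) hf.integrable_abs ?_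
  filter_upwards [hf0] with v hv
  have hv' : 0 ≤ f v := hv
  rw [abs_of_nonneg hv']
  exact mul_le_mul_of_nonneg_left (min_le_left _ _) hv'

lemma nrm_indicator_le_capW {k : ℕ} {f : V → ℝ} {r R : ℝ} (hfk : Mom k ((ballS r).indicator f))
    (hf2 : Mom 2 f) (hf0 : 0 ≤ᵐ[volume] f) (hR0 : 0 ≤ R) (hR : r ^ k ≤ R) :
    nrm k ((ballS r).indicator f) ≤ ∫ v, f v * capW k R v := by
  have hd := dom_capW (k := k) hR0
  refine integral_mono_ae hfk.integrable_abs (hf2.mul_dom hd.meas hd.le) ?_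
  filter_upwards [hf0] with v hv
  have hv' : 0 ≤ f v := hv
  by_cases hm : v ∈ ballS r
  · rw [indicator_of_mem hm, capW_eq hR hm, abs_of_nonneg hv']
  · rw [indicator_of_notMem hm, abs_zero, zero_mul]
    exact mul_nonneg hv' (capW_nonneg hR0 v)

/-- The exponential growth rate of the third moment. -/
def cubicC (τ lam m₁ : ℝ) (F : V → ℝ) (M : ℝ) : ℝ :=
  τ * 2 * M + 1 / lam * (6 * (1 + m₁) ^ 3) * nrm 4 F

/-- The capped weight is an admissible test function and satisfies a Gronwall inequality whose rate
depends neither on the cap nor on r. Removing the cap yields the moment. -/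
lemma IsTruncSol.cubic (hp : Params τ ε lam m₁ e) {F : V → ℝ} (hF : Mom 4 F)
    (hF0 : 0 ≤ᵐ[volume] F) {r T : ℝ} {u : ℝ → X}
    (h : IsTruncSol τ ε lam m₁ e F r T u) (h0 : Mom 3 (u 0)) {M : ℝ}
    (hM : ∀ t ∈ Icc 0 T, ‖u t‖ ≤ M) : ∀ t ∈ Icc 0 T, Mom 3 (u t) ∧
      nrm 3 (u t) ≤ nrm 3 (u 0) * Real.exp (cubicC τ lam m₁ F M * T) := by
  intro t ht
  have hT : 0 ≤ T := ht.1.trans ht.2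
  have hm := hp.hm₁
  have hl := hp.hlam
  have hτ := hp.hτ
  have hM0 : 0 ≤ M := (norm_nonneg _).trans (hM t ht)
  have hK : 0 ≤ cubicC τ lam m₁ F M := by
    have := nrm_nonneg 4 F
    unfold cubicC; positivity
  obtain ⟨N, hN⟩ := exists_nat_ge (r ^ 3)
  refine mom_of_capW (N := N) (momX _).aesm ((L_nonneg_iff _).1 (h.nonneg t ht))
    (fun n => (momX _).mul_dom (dom_capW (Nat.cast_nonneg n)).meas
      (dom_capW (Nat.cast_nonneg n)).le) fun n hn => ?_
  have hn0 : (0 : ℝ) ≤ n := Nat.cast_nonneg n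
  have hnr : r ^ 3 ≤ (n : ℝ) := hN.trans (by exact_mod_cast hn)
  have hg := le_gronwallBound_of_deriv_le (T := T) (δ := nrm 3 (u 0)) (K := cubicC τ lam m₁ F M)
    (η := 0) (h.equation _ _ (dom_capW (k := 3) hn0))
    (integral_capW_le h0 (momX _) ((L_nonneg_iff _).1 (h.nonneg 0 (left_mem_Icc.2 hT))) hn0)
    (fun s hs => ?_) t ht
  · rw [gronwallBound_ε0] at hg
    refine hg.trans (mul_le_mul_of_nonneg_left (Real.exp_le_exp.2 ?_) (nrm_nonneg _ _))
    exact mul_le_mul_of_nonneg_left ht.2 hK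
  · have hs' := Ico_subset_Icc_self hs
    have hnn := (L_nonneg_iff _).1 (h.nonneg s hs')
    have h1 := hp.weakRHS_cubic hF hF0 (momX (u s)) hnn hn0 hnr
    have h2 := nrm_indicator_le_capW (k := 3) (r := r) (mom_indicator_ballS (j := 1) (momX (u s)))
      (momX _) hnn hn0 hnr
    have h3 := hM s hs'
    rw [← normX] at h1
    rw [add_zero]
    refine h1.trans (mul_le_mul ?_ h2 (nrm_nonneg _ _) hK)
    unfold cubicC
    gcongr

/-- The linear growth rate of the fourth moment. -/
def quarticC (τ lam m₁ : ℝ) (F : V → ℝ) (M : ℝ) : ℝ :=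
  (τ * 2 * M + 1 / lam * (2 * (2 * m₁ + m₁ ^ 2)) * nrm 5 F) * M

lemma IsTruncSol.quartic (hp : Params τ ε lam m₁ e) {F : V → ℝ} (hF : Mom 5 F)
    (hF0 : 0 ≤ᵐ[volume] F) {r : ℝ} {T : ℝ} {u : ℝ → X}
    (h : IsTruncSol τ ε lam m₁ e F r T u) (h0 : Mom 4 (u 0)) {M : ℝ}
    (hM : ∀ t ∈ Icc 0 T, Mom 3 (u t) ∧ nrm 3 (u t) ≤ M) : ∀ t ∈ Icc 0 T, Mom 4 (u t) ∧
      nrm 4 (u t) ≤ nrm 4 (u 0) + quarticC τ lam m₁ F M * T := by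
  intro t ht
  have hT : 0 ≤ T := ht.1.trans ht.2
  have hm := hp.hm₁
  have hl := hp.hlam
  have hτ := hp.hτ
  have hM0 : 0 ≤ M := (nrm_nonneg _ _).trans (hM t ht).2
  have hK : 0 ≤ quarticC τ lam m₁ F M := by
    have := nrm_nonneg 5 F
    unfold quarticC; positivity
  obtain ⟨N, hN⟩ := exists_nat_ge (r ^ 4)
  refine mom_of_capW (N := N) (momX _).aesm ((L_nonneg_iff _).1 (h.nonneg t ht))
    (fun n => (momX _).mul_dom (dom_capW (Nat.cast_nonneg n)).meas
      (dom_capW (Nat.cast_nonneg n)).le) fun n hn => ?_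
  have hn0 : (0 : ℝ) ≤ n := Nat.cast_nonneg n
  have hnr : r ^ 4 ≤ (n : ℝ) := hN.trans (by exact_mod_cast hn)
  have hg := le_gronwallBound_of_deriv_le (T := T) (δ := nrm 4 (u 0)) (K := 0)
    (η := quarticC τ lam m₁ F M) (h.equation _ _ (dom_capW (k := 4) hn0))
    (integral_capW_le h0 (momX _) ((L_nonneg_iff _).1 (h.nonneg 0 (left_mem_Icc.2 hT))) hn0)
    (fun s hs => ?_) t ht
  · rw [gronwallBound_K0] at hg
    refine hg.trans (add_le_add_right (mul_le_mul_of_nonneg_left ht.2 hK) _)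
  · have hs' := Ico_subset_Icc_self hs
    have hnn := (L_nonneg_iff _).1 (h.nonneg s hs')
    obtain ⟨h3, h4⟩ := hM s hs'
    have h1 := hp.weakRHS_quartic hF hF0 h3 hnn hn0 hnr
    rw [zero_mul, zero_add]
    have := nrm_nonneg 5 F
    refine h1.trans (mul_le_mul ?_ h4 (nrm_nonneg _ _) (by positivity))
    gcongr

end moments

/-! ### The stability estimate against a truncated solution -/

section stability
variable {τ ε lam m₁ e : ℝ}

lemma IsTest.exists_bound {ψ : V → ℝ} (h : IsTest ψ) : ∃ C, ∀ v, |ψ v| ≤ C :=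
  h.2.exists_bound_of_continuous h.1.continuous

lemma IsTest.measurable {ψ : V → ℝ} (h : IsTest ψ) : Measurable ψ := h.1.continuous.measurable

/-- The weak right-hand side depends continuously on the density. -/
lemma IsTest.continuous_weakRHS (hp : Params τ ε lam m₁ e) {ψ : V → ℝ} (h : IsTest ψ) {F : V → ℝ}
    (hF : Mom 2 F) {S : Set V} (hS : MeasurableSet S) :
    Continuous fun f : X => weakRHS τ ε lam m₁ e (S.indicator F) (S.indicator f) ψ := by
  obtain ⟨C, hC⟩ := h.exists_bound
  have hk := ker_of_bounded hp h.measurable hC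
  have hC0 : 0 ≤ C := (abs_nonneg _).trans (hC 0)
  have hτ := hp.hτ
  have hl := hp.hlam
  refine continuous_iff_continuousAt.2 fun g => ?_
  rw [ContinuousAt, tendsto_iff_norm_sub_tendsto_zero]
  have hlim : Filter.Tendsto (fun f : X => (τ / 2 * (8 * C) * (‖f‖ + ‖g‖) +
      1 / lam * (4 * C) * nrm 2 F) * ‖f - g‖) (nhds g) (nhds 0) := by
    have : Continuous fun f : X => (τ / 2 * (8 * C) * (‖f‖ + ‖g‖) +
      1 / lam * (4 * C) * nrm 2 F) * ‖f - g‖ := by fun_prop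
    have h2 := this.tendsto g
    simpa using h2
  refine squeeze_zero (fun _ => norm_nonneg _) (fun f => ?_) hlim
  have hb := hk.abs_weakRHS_sub_le hp (hF.indicator hS) (hF.indicator hS)
    ((momX f).indicator hS) ((momX g).indicator hS)
  have e0 : nrm 2 (fun v => S.indicator F v - S.indicator F v) = 0 := by simp [nrm]
  rw [e0, mul_zero, add_zero, indicator_sub_fun] at hb
  have b1 := nrm_indicator_le (momX f) hS
  have b2 := nrm_indicator_le (momX g) hS
  have b3 := nrm_indicator_le hF hS
  have b4 := nrm_indicator_le ((momX f).sub (momX g)) hS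
  rw [← norm_subX] at b4
  rw [← normX] at b1 b2
  refine hb.trans ?_
  have := nrm_nonneg 2 (S.indicator fun v => f v - g v)
  have := nrm_nonneg 2 F
  gcongr

/-- The error made by truncating the collision operator. -/
def truncErr (τ lam m₁ : ℝ) (F : V → ℝ) (M r : ℝ) (f : V → ℝ) : ℝ :=
  (τ / 2 * 8 * (M + M) + 1 / lam * (2 * (2 + m₁)) * nrm 3 F) * nrm 3 ((ballS r)ᶜ.indicator f) +
    1 / lam * (2 * (2 + m₁)) * M * nrm 3 ((ballS r)ᶜ.indicator F)

lemma nrm_indicator_sub_le {k : ℕ} {f : V → ℝ} (hf : Mom k f) {S S' : Set V}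
    (hS : MeasurableSet S) (hS' : MeasurableSet S') {r : ℝ} (h : ballS r ⊆ S)
    (h' : ballS r ⊆ S') :
    nrm k (fun v => S.indicator f v - S'.indicator f v) ≤ nrm k ((ballS r)ᶜ.indicator f) := by
  refine nrm_le_of_abs_le (hf.indicator (measurableSet_ballS r).compl)
    ((hf.indicator hS).sub (hf.indicator hS')) (Filter.Eventually.of_forall fun v => ?_)
  by_cases h1 : v ∈ ballS r
  · simp [h1, h h1, h' h1]
  · by_cases h2 : v ∈ S <;> by_cases h3 : v ∈ S' <;> simp [h1, h2, h3]

lemma truncErr_nonneg (hp : Params τ ε lam m₁ e) (F : V → ℝ) {M : ℝ} (hM : 0 ≤ M) (r : ℝ)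
    (f : V → ℝ) : 0 ≤ truncErr τ lam m₁ F M r f := by
  have hm := hp.hm₁
  have hl := hp.hlam
  have hτ := hp.hτ
  have := nrm_nonneg 3 F
  have := nrm_nonneg 3 ((ballS r)ᶜ.indicator f)
  have := nrm_nonneg 3 ((ballS r)ᶜ.indicator F)
  unfold truncErr
  positivity

lemma Dom.weakRHS_le_trunc (hp : Params τ ε lam m₁ e) {ψ : V → ℝ} (hψ : Dom 1 ψ) {F f : V → ℝ}
    (hF : Mom 3 F) (hf : Mom 3 f) {M : ℝ} (hM : nrm 3 f ≤ M) {r : ℝ} {S B : Set V}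
    (hS : MeasurableSet S) (hb : MeasurableSet B) (hrS : ballS r ⊆ S) (hrB : ballS r ⊆ B) :
    weakRHS τ ε lam m₁ e (S.indicator F) (S.indicator f) ψ ≤
      weakRHS τ ε lam m₁ e (B.indicator F) (B.indicator f) ψ + truncErr τ lam m₁ F M r f := by
  have hτ := hp.hτ
  have hl := hp.hlam
  have hm := hp.hm₁
  have h := (hψ.ker hp).abs_weakRHS_sub_le hp (hF.indicator hS) (hF.indicator hb)
    (hf.indicator hS) (hf.indicator hb)
  have h1 := (le_abs_self _).trans h
  have b1 := (nrm_indicator_le hf hS).trans hM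
  have b2 := (nrm_indicator_le hf hb).trans hM
  have b3 := nrm_indicator_le hF hS
  have b4 := nrm_indicator_sub_le hf hS hb hrS hrB
  have b5 := nrm_indicator_sub_le hF hS hb hrS hrB
  have n1 := nrm_nonneg 3 (fun v => S.indicator f v - B.indicator f v)
  have n2 := nrm_nonneg 3 (fun v => S.indicator F v - B.indicator F v)
  have n3 := nrm_nonneg 3 (S.indicator F)
  have n4 := nrm_nonneg 3 F
  have n5 := (nrm_nonneg 3 _).trans hM
  have n6 := nrm_nonneg 3 (B.indicator f)
  rw [mul_one, mul_one] at h1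
  rw [← sub_le_iff_le_add']
  refine h1.trans ?_
  unfold truncErr
  gcongr

/-- The growth rate in the stability estimate. -/
def stabRate (τ lam m₁ : ℝ) (F : V → ℝ) (M : ℝ) : ℝ :=
  12 * τ * M + 2 * m₁ * (1 / lam) * nrm 3 F

/-- The set S covers two uses: a larger truncation compared with a smaller one, and S = `univ` for a
solution of the full equation. Only smooth tests of w are assumed, its third moment is bounded only
for almost every time, and it has no sign. -/
theorem IsTruncSol.stability (hp : Params τ ε lam m₁ e) {F : V → ℝ} (hF : Mom 3 F)
    (hF0 : 0 ≤ᵐ[volume] F) {r : ℝ} (hr : 0 ≤ r) {T : ℝ} (hT : 0 ≤ T) {u w : ℝ → X}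
    (hu : IsTruncSol τ ε lam m₁ e F r T u) (hw : ContinuousOn w (Icc 0 T)) {S : Set V}
    (hS : MeasurableSet S) {ρ : ℝ} (hρr : ρ ≤ r) (hρS : ballS ρ ⊆ S)
    (hweq : ∀ ψ, SqTest ψ → ∀ t ∈ Icc 0 T, HasDerivWithinAt (fun s => ∫ v, w s v * ψ v)
      (weakRHS τ ε lam m₁ e (S.indicator F) (S.indicator (w t)) ψ) (Icc 0 T) t)
    {M : ℝ} (hM : ∀ t ∈ Icc 0 T, Mom 3 (u t) ∧ nrm 3 (u t) ≤ M)
    (hMw : ∀ᵐ t, t ∈ Icc 0 T → Mom 3 (w t) ∧ nrm 3 (w t) ≤ M)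
    {η : ℝ → ℝ} (hη : IntervalIntegrable η volume 0 T)
    (hηw : ∀ᵐ t, t ∈ Icc 0 T → truncErr τ lam m₁ F M ρ (w t) ≤ η t) :
    ∀ t ∈ Icc 0 T, ‖w t - u t‖ ≤
      Real.exp (stabRate τ lam m₁ F M * T) * (‖w 0 - u 0‖ + ∫ s in 0..T, η s) := by
  have hτ := hp.hτ
  have hl := hp.hlam
  have hm := hp.hm₁
  have hM0 : 0 ≤ M := (nrm_nonneg _ _).trans (hM 0 (left_mem_Icc.2 hT)).2
  have hb0 : 0 ≤ stabRate τ lam m₁ F M := by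
    have := nrm_nonneg 3 F
    unfold stabRate; positivity
  set b := stabRate τ lam m₁ F M with hb
  -- The coefficient of the defect N - φ. It grows with r, but enters only through the integrating
  -- factor exp(cs), which cancels at the end.
  set c : ℝ := 2 * r * (τ * M + 1 / lam * nrm 0 F) with hc
  have hc0 : 0 ≤ c := by have := nrm_nonneg 0 F; positivity
  set N : ℝ → ℝ := fun t => ‖w t - u t‖ with hN
  have hNc : ContinuousOn N (Icc 0 T) := (hw.sub hu.cont).norm
  have hNi : IntervalIntegrable N volume 0 T := by
    rw [← uIcc_of_le hT] at hNc; exact hNc.intervalIntegrable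
  have hexp : Continuous fun s : ℝ => Real.exp (c * s) := by fun_prop
  -- the integral inequality
  have key : ∀ t ∈ Icc 0 T, Real.exp (c * t) * N t ≤
      N 0 + ∫ s in 0..t, ((c + b) * (Real.exp (c * s) * N s) + Real.exp (c * s) * η s) := by
    intro t ht
    have hsub : Icc 0 t ⊆ Icc 0 T := Icc_subset_Icc_right ht.2
    set A := N 0 + ∫ s in 0..t, ((c + b) * (Real.exp (c * s) * N s) + Real.exp (c * s) * η s)
      with hA
    have hdual : nrm 2 (fun v => w t v - u t v) ≤ Real.exp (-(c * t)) * A := by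
      refine nrm_le_of_test ((momX _).sub (momX _)) fun ψ hψ => ?_
      have hd := hψ.dom
      have hsplit : ∀ s, ∫ v, (w s v - u s v) * ψ v = (∫ v, w s v * ψ v) - ∫ v, u s v * ψ v :=
        fun s => by
          rw [← integral_sub ((momX (w s)).mul_dom hd.meas hd.le)
            ((momX (u s)).mul_dom hd.meas hd.le)]
          congr 1; ext v; ring
      set φ : ℝ → ℝ := fun s => ∫ v, (w s v - u s v) * ψ v with hφ
      have hφN : ∀ s, φ s ≤ N s := fun s => by
        have := (le_abs_self _).trans (abs_integral_mul_le ((momX (w s)).sub (momX (u s))) hd.le)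
        rw [one_mul, ← norm_subX] at this
        exact this
      set Dw : ℝ → ℝ := fun s => weakRHS τ ε lam m₁ e (S.indicator F) (S.indicator (w s)) ψ
      set Du : ℝ → ℝ := fun s =>
        weakRHS τ ε lam m₁ e ((ballS r).indicator F) ((ballS r).indicator (u s)) ψ
      have hφd : ∀ s ∈ Icc 0 T, HasDerivWithinAt φ (Dw s - Du s) (Icc 0 T) s := fun s hs => by
        have := (hweq ψ hψ s hs).fun_sub (hu.equation 1 ψ hd s hs)
        simp only [← hsplit] at this
        exact this
      have hφc : ContinuousOn φ (Icc 0 T) := fun s hs => (hφd s hs).continuousWithinAt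
      have hDwc : ContinuousOn Dw (Icc 0 T) :=
        (hψ.test.continuous_weakRHS hp (hF.of_le (by norm_num)) hS).comp_continuousOn hw
      have hDuc : ContinuousOn Du (Icc 0 T) :=
        (hψ.test.continuous_weakRHS hp (hF.of_le (by norm_num))
          (measurableSet_ballS r)).comp_continuousOn hu.cont
      have hderiv : ∀ s ∈ Icc 0 T, HasDerivWithinAt (fun s => Real.exp (c * s) * φ s)
          (Real.exp (c * s) * (c * φ s + (Dw s - Du s))) (Icc 0 T) s := fun s hs => by
        have he : HasDerivWithinAt (fun s : ℝ => Real.exp (c * s))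
            (Real.exp (c * s) * (c * 1)) (Icc 0 T) s :=
          (((hasDerivAt_id s).const_mul c).exp).hasDerivWithinAt
        refine (he.fun_mul (hφd s hs)).congr_deriv ?_
        ring
      have hcont : ContinuousOn (fun s => Real.exp (c * s) * (c * φ s + (Dw s - Du s)))
          (Icc 0 T) :=
        hexp.continuousOn.mul ((continuousOn_const.mul hφc).add (hDwc.sub hDuc))
      have hint : IntervalIntegrable (fun s => Real.exp (c * s) * (c * φ s + (Dw s - Du s)))
          volume 0 t := by
        have := hcont.mono hsub
        rw [← uIcc_of_le ht.1] at this
        exact this.intervalIntegrable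
      have hftc := intervalIntegral.integral_eq_sub_of_hasDerivAt_of_le ht.1
        ((hexp.continuousOn.mul hφc).mono hsub)
        (fun s hs => (hderiv s (hsub (Ioo_subset_Icc_self hs))).hasDerivAt
          (Icc_mem_nhds hs.1 (hs.2.trans_le ht.2))) hint
      have hrhs : IntervalIntegrable (fun s => (c + b) * (Real.exp (c * s) * N s) +
          Real.exp (c * s) * η s) volume 0 t := by
        have hs2 : uIcc 0 t ⊆ uIcc 0 T := by
          rw [uIcc_of_le hT, uIcc_of_le ht.1]; exact hsub
        exact ((((hNi.mono_set hs2).continuousOn_mul hexp.continuousOn).const_mul (c + b)).add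
          ((hη.mono_set hs2).continuousOn_mul hexp.continuousOn))
      have hmono : ∫ s in 0..t, Real.exp (c * s) * (c * φ s + (Dw s - Du s)) ≤
          ∫ s in 0..t, ((c + b) * (Real.exp (c * s) * N s) + Real.exp (c * s) * η s) := by
        refine intervalIntegral.integral_mono_ae_restrict ht.1 hint hrhs ?_
        rw [Filter.EventuallyLE, ae_restrict_iff' measurableSet_Icc]
        filter_upwards [hMw, hηw] with s hs1 hs2 hst
        have hsT := hsub hst
        obtain ⟨w3, wM⟩ := hs1 hsT
        obtain ⟨u3, uM⟩ := hM s hsT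
        have e1 := hd.weakRHS_le_trunc hp hF w3 wM hS (measurableSet_ballS r) hρS
          (fun v hv => le_trans hv hρr)
        have e2 := hd.stability hp hF hF0 u3 ((L_nonneg_iff _).1 (hu.nonneg s hsT)) (w3.sub u3) hr
        have e3 : (fun v => u s v + (w s v - u s v)) = w s := by ext v; ring
        rw [e3] at e2
        have e4 := hs2 hsT
        have e5 : 2 * r * (τ * nrm 0 (u s) + 1 / lam * nrm 0 F) ≤ c := by
          have : nrm 0 (u s) ≤ M := (nrm_mono (by norm_num) u3).trans uM
          rw [hc]; gcongr
        have e6 : nrm 2 (fun v => w s v - u s v) = N s := (norm_subX _ _).symm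
        -- The third moments of u and of w are at most M, that of their difference at most 2M; hence
        -- 4τM + 8τM in the rate.
        have e7 : stabC τ lam m₁ F (u s) (fun v => w s v - u s v) ≤ b := by
          have := nrm_sub_le w3 u3
          have h1 : 4 * τ * nrm 3 (u s) ≤ 4 * τ * M := by gcongr
          have h2 : 4 * τ * nrm 3 (fun v => w s v - u s v) ≤ 4 * τ * (M + M) := by
            gcongr; linarith
          rw [hb, stabRate, stabC]
          linarith
        rw [e6] at e2
        have e8 := mul_le_mul_of_nonneg_right e5 (sub_nonneg.2 (hφN s))
        have e9 := mul_le_mul_of_nonneg_right e7 (norm_nonneg (w s - u s))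
        -- The term cφ from the integrating factor combines with the defect c(N - φ) to cN. The
        -- right side no longer depends on ψ, so the supremum over ψ can be taken after integration.
        have e10 : c * φ s + (Dw s - Du s) ≤ (c + b) * N s + η s := by
          have e11 : Dw s ≤ weakRHS τ ε lam m₁ e ((ballS r).indicator F)
            ((ballS r).indicator (w s)) ψ + truncErr τ lam m₁ F M ρ (w s) := e1
          have e12 : weakRHS τ ε lam m₁ e ((ballS r).indicator F) ((ballS r).indicator (w s)) ψ -
            Du s ≤ 2 * r * (τ * nrm 0 (u s) + 1 / lam * nrm 0 F) * (N s - φ s) +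
              stabC τ lam m₁ F (u s) (fun v => w s v - u s v) * N s := e2
          have e13 : stabC τ lam m₁ F (u s) (fun v => w s v - u s v) * N s ≤ b * N s := e9
          linarith
        have := mul_le_mul_of_nonneg_left e10 (Real.exp_pos (c * s)).le
        linarith
      rw [hftc] at hmono
      replace hmono : Real.exp (c * t) * φ t - Real.exp (c * 0) * φ 0 ≤ _ := hmono
      rw [mul_zero, Real.exp_zero, one_mul] at hmono
      have h0 := hφN 0
      have h1 : Real.exp (c * t) * φ t ≤ A := by rw [hA]; linarith
      have h2 : Real.exp (-(c * t)) * Real.exp (c * t) = 1 := by rw [← Real.exp_add]; simp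
      calc φ t = Real.exp (-(c * t)) * (Real.exp (c * t) * φ t) := by rw [← mul_assoc, h2, one_mul]
        _ ≤ _ := mul_le_mul_of_nonneg_left h1 (Real.exp_pos _).le
    rw [← norm_subX] at hdual
    have h2 : Real.exp (c * t) * Real.exp (-(c * t)) = 1 := by rw [← Real.exp_add]; simp
    calc _ ≤ Real.exp (c * t) * (Real.exp (-(c * t)) * A) :=
          mul_le_mul_of_nonneg_left hdual (Real.exp_pos _).le
      _ = A := by rw [← mul_assoc, h2, one_mul]
  intro t ht
  have hsub : uIcc 0 t ⊆ uIcc 0 T := by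
    rw [uIcc_of_le hT, uIcc_of_le ht.1]; exact Icc_subset_Icc_right ht.2
  have hη0 : ∀ᵐ s, s ∈ Icc 0 T → 0 ≤ η s := by
    filter_upwards [hηw] with s hs hsT
    exact (truncErr_nonneg hp F hM0 ρ _).trans (hs hsT)
  have hg := gronwall_integral (add_nonneg hc0 hb0) hT (hexp.continuousOn.mul hNc)
    (hη.continuousOn_mul hexp.continuousOn) key t ht
  have hE : Real.exp ((c + b) * t) = Real.exp (c * t) * Real.exp (b * t) := by
    rw [add_mul, Real.exp_add]
  rw [hE, mul_assoc] at hg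
  -- The factor exp(ct) is divided out, and only the rate b survives.
  have hg2 := le_of_mul_le_mul_left hg (Real.exp_pos _)
  have hI : ∫ s in 0..t, Real.exp (-((c + b) * s)) * (Real.exp (c * s) * η s) ≤
      ∫ s in 0..T, η s := by
    have h1 : ∫ s in 0..t, Real.exp (-((c + b) * s)) * (Real.exp (c * s) * η s) ≤
        ∫ s in 0..t, η s := by
      refine intervalIntegral.integral_mono_ae_restrict ht.1
        (((hη.mono_set hsub).continuousOn_mul hexp.continuousOn).continuousOn_mul (by fun_prop))
        (hη.mono_set hsub) ?_
      rw [Filter.EventuallyLE, ae_restrict_iff' measurableSet_Icc]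
      filter_upwards [hη0] with s hs hst
      have h0 := hs ⟨hst.1, hst.2.trans ht.2⟩
      rw [← mul_assoc, ← Real.exp_add]
      refine mul_le_of_le_one_left h0 (Real.exp_le_one_iff.2 ?_)
      have := mul_nonneg hb0 hst.1
      linarith
    refine h1.trans (intervalIntegral.integral_mono_interval le_rfl ht.1 ht.2 ?_ hη)
    rw [Filter.EventuallyLE, ae_restrict_iff' measurableSet_Ioc]
    filter_upwards [hη0] with s hs hst
    exact hs (Ioc_subset_Icc_self hst)
  have hI0 : 0 ≤ ∫ s in 0..T, η s := by
    refine intervalIntegral.integral_nonneg_of_ae_restrict hT ?_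
    rw [Filter.EventuallyLE, ae_restrict_iff' measurableSet_Icc]
    exact hη0
  refine hg2.trans ?_
  refine (mul_le_mul_of_nonneg_left (add_le_add_right hI (N 0)) (Real.exp_pos _).le).trans ?_
  refine mul_le_mul_of_nonneg_right (Real.exp_le_exp.2 ?_) (add_nonneg (norm_nonneg _) hI0)
  exact mul_le_mul_of_nonneg_left ht.2 hb0

end stability

/-! ### Passage to the limit in the truncation -/

section limit
variable {τ ε lam m₁ e : ℝ}

/-- The truncation radii. -/
def cutR (k : ℕ) : ℝ := ((k : ℝ) + 1) ^ 2

lemma cutR_pos (k : ℕ) : 0 < cutR k := by unfold cutR; positivity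

lemma add_one_le_cutR (k : ℕ) : (k : ℝ) + 1 ≤ cutR k := by
  have : (0 : ℝ) ≤ k := k.cast_nonneg
  unfold cutR; nlinarith

lemma cutR_mono {k l : ℕ} (h : k ≤ l) : cutR k ≤ cutR l := by
  have : (k : ℝ) ≤ l := by exact_mod_cast h
  unfold cutR; gcongr

/-- A family of solutions of truncated problems with uniformly bounded third moments. -/
structure IsApprox (τ ε lam m₁ e : ℝ) (F f₀ : V → ℝ) (T M N : ℝ) (u : ℕ → ℝ → X) : Prop where
  sol : ∀ k, IsTruncSol τ ε lam m₁ e F (cutR k) T (u k)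
  cubic : ∀ k, ∀ t ∈ Icc 0 T, Mom 3 (u k t) ∧ nrm 3 (u k t) ≤ M
  quartic : ∀ k, ∀ t ∈ Icc 0 T, Mom 4 (u k t) ∧ nrm 4 (u k t) ≤ N * (k + 1)
  init : ∀ k, u k 0 =ᵐ[volume] (ballS ((k : ℝ) + 1)).indicator f₀

lemma exists_isApprox (hp : Params τ ε lam m₁ e) {F : V → ℝ} (hF : Mom 5 F)
    (hF0 : 0 ≤ᵐ[volume] F) {f₀ : V → ℝ} (h3 : Mom 3 f₀) (h0 : 0 ≤ᵐ[volume] f₀) {T : ℝ}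
    (hT : 0 < T) : ∃ (M N : ℝ) (u : ℕ → ℝ → X), 0 ≤ M ∧ 0 ≤ N ∧
      IsApprox τ ε lam m₁ e F f₀ T M N u := by
  have h2 : Mom 2 f₀ := h3.of_le (by norm_num)
  have hi : ∀ k : ℕ, Mom 2 ((ballS ((k : ℝ) + 1)).indicator f₀) := fun k =>
    h2.indicator (measurableSet_ballS _)
  have hc : ∀ k : ℕ, toL two_eq _ (hi k) =ᵐ[volume] (ballS ((k : ℝ) + 1)).indicator f₀ :=
    fun k => coe_toL two_eq (hi k)
  have hnn : ∀ k : ℕ, 0 ≤ toL two_eq _ (hi k) := fun k => by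
    rw [L_nonneg_iff]
    filter_upwards [hc k, h0] with v hv hv0
    rw [hv]
    by_cases hS : v ∈ ballS ((k : ℝ) + 1)
    · rw [indicator_of_mem hS]; exact hv0
    · rw [indicator_of_notMem hS]; exact le_rfl
  choose u hu0 hu using fun k : ℕ =>
    exists_truncSol hp (hF.of_le (by norm_num)) hF0 (cutR_pos k).le hT (hnn k)
  have hinit : ∀ k, u k 0 =ᵐ[volume] (ballS ((k : ℝ) + 1)).indicator f₀ := fun k => by
    rw [hu0]; exact hc k
  have hm2 : ∀ k, ∀ t ∈ Icc 0 T, ‖u k t‖ ≤ Real.exp (growthC lam m₁ F * T) * nrm 2 f₀ :=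
    fun k t ht => by
      refine ((hu k).norm_le t ht).trans ?_
      rw [normX, nrm_congr (hinit k)]
      exact mul_le_mul_of_nonneg_left (nrm_indicator_le h2 (measurableSet_ballS _))
        (Real.exp_pos _).le
  set M₂ := Real.exp (growthC lam m₁ F * T) * nrm 2 f₀
  have hm30 : ∀ k, Mom 3 (u k 0) ∧ nrm 3 (u k 0) ≤ nrm 3 f₀ := fun k =>
    ⟨(h3.indicator (measurableSet_ballS _)).congr (hinit k).symm, by
      rw [nrm_congr (hinit k)]
      exact nrm_indicator_le h3 (measurableSet_ballS _)⟩
  have hm3 : ∀ k, ∀ t ∈ Icc 0 T, Mom 3 (u k t) ∧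
      nrm 3 (u k t) ≤ nrm 3 f₀ * Real.exp (cubicC τ lam m₁ F M₂ * T) := fun k t ht => by
    obtain ⟨a, b⟩ := (hu k).cubic hp (hF.of_le (by norm_num)) hF0 (hm30 k).1 (hm2 k) t ht
    exact ⟨a, b.trans (mul_le_mul_of_nonneg_right (hm30 k).2 (Real.exp_pos _).le)⟩
  set M₃ := nrm 3 f₀ * Real.exp (cubicC τ lam m₁ F M₂ * T) with hM₃
  have hM₃0 : 0 ≤ M₃ := mul_nonneg (nrm_nonneg _ _) (Real.exp_pos _).le
  have hq : 0 ≤ quarticC τ lam m₁ F M₃ := by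
    have := hp.hτ
    have := hp.hlam
    have := hp.hm₁
    have := nrm_nonneg 5 F
    unfold quarticC; positivity
  have hn3 := nrm_nonneg 3 f₀
  refine ⟨M₃, nrm 3 f₀ + quarticC τ lam m₁ F M₃ * T, u, hM₃0, by positivity, hu, hm3, ?_, hinit⟩
  intro k t ht
  have hk : (0 : ℝ) ≤ k := k.cast_nonneg
  have a0 : Mom 4 (u k 0) := (mom_indicator_ballS (j := 1) h3).congr (hinit k).symm
  have b0 : nrm 4 (u k 0) ≤ (k + 1) * nrm 3 f₀ := by
    rw [nrm_congr (hinit k)]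
    -- The datum has only three moments; cutting it at radius k+1 buys a fourth one at the price of
    -- a factor k+1.
    have := nrm_indicator_ballS_le (j := 1) (by positivity : (0 : ℝ) ≤ k + 1) h3
    rwa [pow_one] at this
  obtain ⟨a, b⟩ := (hu k).quartic hp hF hF0 a0 (hm3 k) t ht
  refine ⟨a, b.trans ?_⟩
  have := mul_nonneg (mul_nonneg hq hT.le) hk
  linarith

lemma nrm_tail_le {f : V → ℝ} {i : ℕ} (hf : Mom (i + 1) f) (k : ℕ) :
    nrm i ((ballS (cutR k))ᶜ.indicator f) ≤ nrm (i + 1) f / (k + 1) :=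
  (nrm_indicator_compl_ballS_le (cutR_pos k) hf).trans
    (div_le_div_of_nonneg_left (nrm_nonneg _ _) (by positivity) (add_one_le_cutR k))

variable {F f₀ : V → ℝ} {T M N : ℝ} {u : ℕ → ℝ → X}

/-- Stability is applied with the more strongly truncated u k as the perturbed curve and u l as the
reference. The third-moment tail of u k is at most N(k+1)/(k+1)², which explains the square in
`cutR`. -/
lemma IsApprox.exists_cauchy (hp : Params τ ε lam m₁ e) (hF : Mom 4 F) (hF0 : 0 ≤ᵐ[volume] F)
    (h3 : Mom 3 f₀) (hT : 0 ≤ T) (hM0 : 0 ≤ M) (hN0 : 0 ≤ N)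
    (h : IsApprox τ ε lam m₁ e F f₀ T M N u) :
    ∃ D, 0 ≤ D ∧ ∀ k l, k ≤ l → ∀ t ∈ Icc 0 T, ‖u k t - u l t‖ ≤ D / (k + 1) := by
  have hF3 : Mom 3 F := hF.of_le (by norm_num)
  have hτ := hp.hτ
  have hl := hp.hlam
  have hm := hp.hm₁
  have n3 := nrm_nonneg 3 F
  have n4 := nrm_nonneg 4 F
  have n0 := nrm_nonneg 3 f₀
  set a := τ / 2 * 8 * (M + M) + 1 / lam * (2 * (2 + m₁)) * nrm 3 F with ha
  set b := 1 / lam * (2 * (2 + m₁)) * M with hb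
  have ha0 : 0 ≤ a := by positivity
  have hb0 : 0 ≤ b := by positivity
  refine ⟨Real.exp (stabRate τ lam m₁ F M * T) * (nrm 3 f₀ + T * (a * N + b * nrm 4 F)),
    by positivity, fun k l hkl t ht => ?_⟩
  have hk : (0 : ℝ) < k + 1 := by positivity
  have hB := measurableSet_ballS (cutR k)
  have herr : ∀ s ∈ Icc 0 T, truncErr τ lam m₁ F M (cutR k) (u k s) ≤
      (a * N + b * nrm 4 F) / (k + 1) := fun s hs => by
    obtain ⟨q, qN⟩ := h.quartic k s hs
    have e1 : nrm 3 ((ballS (cutR k))ᶜ.indicator (u k s)) ≤ N / (k + 1) := by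
      refine (nrm_indicator_compl_ballS_le (cutR_pos k) q).trans ?_
      rw [div_le_div_iff₀ (cutR_pos k) hk]
      refine (mul_le_mul_of_nonneg_right qN hk.le).trans_eq ?_
      unfold cutR; ring
    have e2 := nrm_tail_le hF k
    unfold truncErr
    rw [← ha, ← hb, add_div, mul_div_assoc, mul_div_assoc]
    gcongr
  have hst := (h.sol l).stability hp hF3 hF0 (cutR_pos l).le hT (h.sol k).cont hB (cutR_mono hkl)
    subset_rfl (fun ψ hψ s hs => (h.sol k).equation 1 ψ hψ.dom s hs) (h.cubic l)
    (Filter.Eventually.of_forall (h.cubic k))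
    (η := fun _ => (a * N + b * nrm 4 F) / (k + 1)) intervalIntegrable_const
    (Filter.Eventually.of_forall herr) t ht
  have h0 : ‖u k 0 - u l 0‖ ≤ nrm 3 f₀ / (k + 1) := by
    have hs : ballS ((k : ℝ) + 1) ⊆ ballS ((l : ℝ) + 1) := by
      have h1 : (k : ℝ) + 1 ≤ l + 1 := by gcongr
      exact fun v hv => le_trans hv h1
    rw [norm_subX]
    have e : (fun v => u k 0 v - u l 0 v) =ᵐ[volume] fun v =>
        (ballS ((k : ℝ) + 1)).indicator f₀ v - (ballS ((l : ℝ) + 1)).indicator f₀ v := by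
      filter_upwards [h.init k, h.init l] with v h1 h2
      rw [h1, h2]
    rw [nrm_congr e]
    exact (nrm_indicator_sub_le (h3.of_le (by norm_num)) (measurableSet_ballS _)
      (measurableSet_ballS _) subset_rfl hs).trans (nrm_indicator_compl_ballS_le hk h3)
  refine hst.trans ?_
  rw [intervalIntegral.integral_const, sub_zero, smul_eq_mul, mul_div_assoc]
  refine mul_le_mul_of_nonneg_left ?_ (Real.exp_pos _).le
  rw [add_div (nrm 3 f₀), mul_div_assoc T]
  gcongr

lemma IsApprox.exists_limit (hp : Params τ ε lam m₁ e) (hF : Mom 4 F) (hF0 : 0 ≤ᵐ[volume] F)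
    (h3 : Mom 3 f₀) (hT : 0 ≤ T) (hM0 : 0 ≤ M) (hN0 : 0 ≤ N)
    (h : IsApprox τ ε lam m₁ e F f₀ T M N u) :
    ∃ (f : C(Icc 0 T, X)) (D : ℝ), ∀ k, ∀ t : Icc 0 T, ‖u k t - f t‖ ≤ D / (k + 1) := by
  obtain ⟨D, hD0, hD⟩ := h.exists_cauchy hp hF hF0 h3 hT hM0 hN0
  have hlim : Filter.Tendsto (fun k : ℕ => D / ((k : ℝ) + 1)) Filter.atTop (nhds 0) := by
    have := (tendsto_one_div_add_atTop_nhds_zero_nat (𝕜 := ℝ)).const_mul D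
    rw [mul_zero] at this
    exact this.congr fun k => by rw [mul_one_div]
  have hcau : ∀ t : Icc 0 T, CauchySeq fun k => u k t := fun t =>
    cauchySeq_of_le_tendsto_0' _ (fun k l hkl => by
      rw [dist_eq_norm]; exact hD k l hkl t t.2) hlim
  choose U hU using fun t => cauchySeq_tendsto_of_complete (hcau t)
  have hb : ∀ k, ∀ t : Icc 0 T, ‖u k t - U t‖ ≤ D / (k + 1) := fun k t =>
    le_of_tendsto ((tendsto_const_nhds.sub (hU t)).norm)
      (Filter.eventually_atTop.2 ⟨k, fun l hl => hD k l hl t t.2⟩)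
  have hunif : TendstoUniformly (fun k (t : Icc 0 T) => u k t) U Filter.atTop := by
    rw [Metric.tendstoUniformly_iff]
    intro δ hδ
    filter_upwards [hlim.eventually_lt_const hδ] with k hk t
    rw [dist_comm, dist_eq_norm]
    exact (hb k t).trans_lt hk
  exact ⟨⟨U, hunif.continuous (Filter.Frequently.of_forall fun k =>
    continuousOn_iff_continuous_domRestrict.1 (h.sol k).cont)⟩, D, hb⟩

end limit

/-! ### Properties of the limit and its equation -/

section limitEquation
variable {τ ε lam m₁ e : ℝ} {F f₀ : V → ℝ} {T M N D : ℝ} {u : ℕ → ℝ → X} {f : C(Icc 0 T, X)}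

lemma tendsto_div_add_one (D : ℝ) :
    Filter.Tendsto (fun k : ℕ => D / ((k : ℝ) + 1)) Filter.atTop (nhds 0) := by
  have := (tendsto_one_div_add_atTop_nhds_zero_nat (𝕜 := ℝ)).const_mul D
  rw [mul_zero] at this
  exact this.congr fun k => by rw [mul_one_div]

lemma tendsto_of_rate (hD : ∀ k, ∀ t : Icc 0 T, ‖u k t - f t‖ ≤ D / (k + 1)) (t : Icc 0 T) :
    Filter.Tendsto (fun k => u k t) Filter.atTop (nhds (f t)) :=
  tendsto_iff_norm_sub_tendsto_zero.2
    (squeeze_zero (fun _ => norm_nonneg _) (fun k => hD k t) (tendsto_div_add_one D))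

lemma IsApprox.limit_nonneg (h : IsApprox τ ε lam m₁ e F f₀ T M N u)
    (hD : ∀ k, ∀ t : Icc 0 T, ‖u k t - f t‖ ≤ D / (k + 1)) (t : Icc 0 T) : 0 ≤ f t :=
  ge_of_tendsto' (tendsto_of_rate hD t) fun k => (h.sol k).nonneg t t.2

lemma IsApprox.limit_cubic (h : IsApprox τ ε lam m₁ e F f₀ T M N u)
    (hD : ∀ k, ∀ t : Icc 0 T, ‖u k t - f t‖ ≤ D / (k + 1)) (t : Icc 0 T) :
    Mom 3 (f t) ∧ nrm 3 (f t) ≤ M := by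
  have hd : ∀ n : ℕ, Dom n (capW 3 n) := fun n => dom_capW n.cast_nonneg
  refine mom_of_capW (N := 0) (momX (f t)).aesm ((L_nonneg_iff _).1 (h.limit_nonneg hD t))
    (fun n => (momX (f t)).mul_dom (hd n).meas (hd n).le) fun n _ => ?_
  have hc := (((pair (hd n)).continuous.tendsto _).comp (tendsto_of_rate hD t))
  refine le_of_tendsto' hc fun k => ?_
  obtain ⟨a, b⟩ := h.cubic k t t.2
  exact (integral_capW_le a (momX _) ((L_nonneg_iff _).1 ((h.sol k).nonneg t t.2))
    n.cast_nonneg).trans b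

lemma IsApprox.limit_init (h : IsApprox τ ε lam m₁ e F f₀ T M N u) (h3 : Mom 3 f₀)
    (hD : ∀ k, ∀ t : Icc 0 T, ‖u k t - f t‖ ≤ D / (k + 1)) (h0 : (0 : ℝ) ∈ Icc 0 T) :
    f ⟨0, h0⟩ =ᵐ[volume] f₀ := by
  have h2 : Mom 2 f₀ := h3.of_le (by norm_num)
  have hlim : Filter.Tendsto (fun k => u k 0) Filter.atTop (nhds (toL two_eq f₀ h2)) := by
    refine tendsto_iff_norm_sub_tendsto_zero.2
      (squeeze_zero (fun _ => norm_nonneg _) (fun k => ?_) (tendsto_div_add_one (nrm 3 f₀)))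
    rw [norm_subX]
    have e : (fun v => u k 0 v - toL two_eq f₀ h2 v) =ᵐ[volume] fun v =>
        (ballS ((k : ℝ) + 1)).indicator f₀ v - univ.indicator f₀ v := by
      filter_upwards [h.init k, coe_toL two_eq h2] with v h1 h2
      rw [h1, h2, indicator_univ]
    rw [nrm_congr e]
    exact (nrm_indicator_sub_le h2 (measurableSet_ballS _) MeasurableSet.univ subset_rfl
      (subset_univ _)).trans (nrm_indicator_compl_ballS_le (by positivity) h3)
  rw [tendsto_nhds_unique (tendsto_of_rate hD ⟨0, h0⟩) hlim]
  exact coe_toL two_eq h2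

/-- The right-hand sides of the truncated equations converge uniformly. -/
lemma IsApprox.exists_weakRHS_rate (hp : Params τ ε lam m₁ e) (hF : Mom 3 F)
    (hT : 0 ≤ T) (h : IsApprox τ ε lam m₁ e F f₀ T M N u)
    (hD : ∀ k, ∀ t : Icc 0 T, ‖u k t - f t‖ ≤ D / (k + 1)) {ψ : V → ℝ} (hψ : IsTest ψ) :
    ∃ E, ∀ k, ∀ t : Icc 0 T, |weakRHS τ ε lam m₁ e ((ballS (cutR k)).indicator F)
      ((ballS (cutR k)).indicator (u k t)) ψ - weakRHS τ ε lam m₁ e F (f t) ψ| ≤ E / (k + 1) := by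
  obtain ⟨C, hC⟩ := hψ.exists_bound
  have hker := ker_of_bounded hp hψ.measurable hC
  have hC0 : 0 ≤ C := (abs_nonneg _).trans (hC 0)
  have hτ := hp.hτ
  have hl := hp.hlam
  have hF2 : Mom 2 F := hF.of_le (by norm_num)
  have hM0 : 0 ≤ M := (nrm_nonneg _ _).trans (h.limit_cubic hD ⟨0, left_mem_Icc.2 hT⟩).2
  refine ⟨(τ / 2 * (8 * C) * (M + M) + 1 / lam * (4 * C) * nrm 2 F) * (M + D) +
    1 / lam * (4 * C) * M * nrm 3 F, fun k t => ?_⟩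
  have hB := measurableSet_ballS (cutR k)
  obtain ⟨u3, uM⟩ := h.cubic k t t.2
  obtain ⟨f3, fM⟩ := h.limit_cubic hD t
  have u2 := momX (u k t)
  have f2 := momX (f t)
  have b1 : nrm 2 ((ballS (cutR k)).indicator (u k t)) ≤ M :=
    (nrm_indicator_le u2 hB).trans ((nrm_mono (by norm_num) u3).trans uM)
  have b2 : nrm 2 (f t) ≤ M := (nrm_mono (by norm_num) f3).trans fM
  have b3 := nrm_indicator_le hF2 hB
  have tail : ∀ {g : V → ℝ}, Mom 3 g →
      nrm 2 (fun v => (ballS (cutR k)).indicator g v - g v) ≤ nrm 3 g / (k + 1) := fun {g} hg => by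
    have := nrm_indicator_sub_le (hg.of_le (by norm_num : 2 ≤ 3)) hB MeasurableSet.univ subset_rfl
      (subset_univ _)
    rw [indicator_univ] at this
    exact this.trans (nrm_tail_le hg k)
  have b4 : nrm 2 (fun v => (ballS (cutR k)).indicator (u k t) v - f t v) ≤
      (M + D) / (k + 1) := by
    have e : (fun v => (ballS (cutR k)).indicator (u k t) v - f t v) = fun v =>
        ((ballS (cutR k)).indicator (u k t) v - u k t v) + (u k t v - f t v) := by
      ext v; ring
    rw [e, add_div]
    refine (nrm_add_le ((u2.indicator hB).sub u2) (u2.sub f2)).trans (add_le_add ?_ ?_)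
    · exact (tail u3).trans (by gcongr)
    · rw [← norm_subX]; exact hD k t
  have b5 := tail hF
  refine (hker.abs_weakRHS_sub_le hp (hF2.indicator hB) hF2 (u2.indicator hB) f2).trans ?_
  have n1 := nrm_nonneg 2 (fun v => (ballS (cutR k)).indicator (u k t) v - f t v)
  have n2 := nrm_nonneg 2 F
  have n3 := nrm_nonneg 2 (fun v => (ballS (cutR k)).indicator F v - F v)
  rw [add_div, mul_div_assoc, mul_div_assoc]
  gcongr

/-- The limit is taken in the integrated equation, where uniform convergence of the right-hand sides
suffices. The limiting right-hand side is continuous in time, so the integral identity can be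
differentiated at every time. -/
lemma IsApprox.limit_equation (hp : Params τ ε lam m₁ e) (hF : Mom 3 F)
    (hT : 0 ≤ T) (h : IsApprox τ ε lam m₁ e F f₀ T M N u)
    (hD : ∀ k, ∀ t : Icc 0 T, ‖u k t - f t‖ ≤ D / (k + 1)) {ψ : V → ℝ} (hψ : IsTest ψ)
    (t : Icc 0 T) : HasDerivWithinAt (fun s : ℝ => ∫ v, f (projIcc 0 T hT s) v * ψ v)
      (weakRHS τ ε lam m₁ e F (f t) ψ) (Icc 0 T) t := by
  obtain ⟨C, hC⟩ := hψ.exists_bound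
  have hd := dom_of_bounded hψ.measurable hC
  obtain ⟨E, hE⟩ := h.exists_weakRHS_rate hp hF hT hD hψ
  have hF2 : Mom 2 F := hF.of_le (by norm_num)
  have hfc : Continuous fun s : ℝ => f (projIcc 0 T hT s) := f.continuous.comp continuous_projIcc
  set W : ℝ → ℝ := fun s => weakRHS τ ε lam m₁ e F (f (projIcc 0 T hT s)) ψ with hW
  have hWc : Continuous W := by
    have := (hψ.continuous_weakRHS hp hF2 MeasurableSet.univ).comp hfc
    simp only [indicator_univ, Function.comp_def] at this
    exact this
  set φ : ℝ → ℝ := fun s => ∫ v, f (projIcc 0 T hT s) v * ψ v with hφ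
  have hpr : ∀ {s : ℝ} (hs : s ∈ Icc 0 T), projIcc 0 T hT s = ⟨s, hs⟩ :=
    fun hs => projIcc_of_mem hT hs
  have key : ∀ s ∈ Icc 0 T, φ s = φ 0 + ∫ r in 0..s, W r := fun s hs => by
    set Wk : ℕ → ℝ → ℝ := fun k r => weakRHS τ ε lam m₁ e ((ballS (cutR k)).indicator F)
      ((ballS (cutR k)).indicator (u k r)) ψ with hWk
    have hsub : Icc 0 s ⊆ Icc 0 T := Icc_subset_Icc_right hs.2
    have hWkc : ∀ k, IntervalIntegrable (Wk k) volume 0 s := fun k => by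
      have : ContinuousOn (Wk k) (Icc 0 s) :=
        ((hψ.continuous_weakRHS hp hF2 (measurableSet_ballS _)).comp_continuousOn
          (h.sol k).cont).mono hsub
      rw [← uIcc_of_le hs.1] at this
      exact this.intervalIntegrable
    have hftc : ∀ k, ∫ r in 0..s, Wk k r = (∫ v, u k s v * ψ v) - ∫ v, u k 0 v * ψ v :=
      fun k => intervalIntegral.integral_eq_sub_of_hasDerivAt_of_le hs.1
        (fun r hr => ((h.sol k).equation C ψ hd r (hsub hr)).continuousWithinAt.mono hsub)
        (fun r hr => ((h.sol k).equation C ψ hd r (hsub (Ioo_subset_Icc_self hr))).hasDerivAt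
          (Icc_mem_nhds hr.1 (hr.2.trans_le hs.2))) (hWkc k)
    have l1 : Filter.Tendsto (fun k => ∫ r in 0..s, Wk k r) Filter.atTop
        (nhds (∫ r in 0..s, W r)) := by
      rw [tendsto_iff_norm_sub_tendsto_zero]
      refine squeeze_zero (fun _ => norm_nonneg _) (fun k => ?_) (tendsto_div_add_one (E * s))
      rw [← intervalIntegral.integral_sub (hWkc k) (hWc.intervalIntegrable _ _)]
      have := intervalIntegral.norm_integral_le_of_norm_le_const (a := 0) (b := s)
        (f := fun r => Wk k r - W r) (C := E / (k + 1)) fun r hr => by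
          rw [uIoc_of_le hs.1] at hr
          have hr' := hsub (Ioc_subset_Icc_self hr)
          have := hE k ⟨r, hr'⟩
          rw [Real.norm_eq_abs, hW]
          simp only [hpr hr']
          exact this
      rw [sub_zero, abs_of_nonneg hs.1] at this
      exact this.trans_eq (by ring)
    have l2 : ∀ {r : ℝ}, r ∈ Icc 0 T → Filter.Tendsto (fun k => ∫ v, u k r v * ψ v) Filter.atTop
        (nhds (φ r)) := fun {r} hr => by
      have := ((pair hd).continuous.tendsto _).comp (tendsto_of_rate hD ⟨r, hr⟩)
      rw [hφ]
      simp only [hpr hr]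
      exact this
    have := tendsto_nhds_unique l1
      (((l2 hs).sub (l2 (left_mem_Icc.2 hT))).congr fun k => (hftc k).symm)
    rw [this]; ring
  have hder : HasDerivWithinAt (fun s => φ 0 + ∫ r in 0..s, W r) (W t) (Icc 0 T) t :=
    ((hWc.integral_hasStrictDerivAt 0 (t : ℝ)).hasDerivAt.const_add (φ 0)).hasDerivWithinAt
  have hWt : W t = weakRHS τ ε lam m₁ e F (f t) ψ := by
    rw [hW]; simp only [projIcc_val]
  rw [← hWt]
  exact hder.congr key (key t t.2)

end limitEquation

/-! ### Bochner measurability in `L¹_3` -/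

section bochner

/-- Truncation in the velocity variable, as a map from `L¹_2` to `L¹_3`. -/
def cutL (r : ℝ) (f : X) : L1 3 :=
  toL three_eq ((ballS r).indicator f) (mom_indicator_ballS (j := 1) (momX f))

lemma continuous_cutL {r : ℝ} (hr : 0 ≤ r) : Continuous (cutL r) := by
  refine (LipschitzWith.of_dist_le_mul (K := ⟨r, hr⟩) fun f g => ?_).continuous
  rw [dist_eq_norm, dist_eq_norm, norm_sub_eq_nrm three_eq, norm_subX]
  have e : (fun v => cutL r f v - cutL r g v) =ᵐ[volume]
      (ballS r).indicator fun v => f v - g v := by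
    have h1 : cutL r f =ᵐ[volume] (ballS r).indicator f := coe_toL three_eq _
    have h2 : cutL r g =ᵐ[volume] (ballS r).indicator g := coe_toL three_eq _
    rw [← indicator_sub_fun]
    filter_upwards [h1, h2] with v h1 h2
    rw [h1, h2]
  rw [nrm_congr e]
  have := nrm_indicator_ballS_le (j := 1) hr ((momX f).sub (momX g))
  rwa [pow_one] at this

/-- A continuous curve in `L¹_2` with bounded third moments belongs to `L^∞(0,T; L¹_3)`. -/
lemma exists_bochner {T M : ℝ} {w : ℝ → X} (hw : Continuous w)
    (hM : ∀ t, Mom 3 (w t) ∧ nrm 3 (w t) ≤ M) :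
    ∃ g : ℝ → L1 3, MemLp g ⊤ (volume.restrict (Ioo 0 T)) ∧ ∀ t, w t =ᵐ[volume] g t := by
  have hc : ∀ t, toL three_eq (w t) (hM t).1 =ᵐ[volume] w t := fun t => coe_toL three_eq _
  refine ⟨fun t => toL three_eq (w t) (hM t).1, memLp_top_of_bound (C := M) ?_
    (Filter.Eventually.of_forall fun t => ?_), fun t => (hc t).symm⟩
  -- The curve is only continuous in `L¹_2`, but its velocity cut-offs are continuous in `L¹_3` and
  -- converge there pointwise in time.
  · refine aestronglyMeasurable_of_tendsto_ae Filter.atTop (f := fun (n : ℕ) t => cutL n (w t))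
      (fun n => ((continuous_cutL n.cast_nonneg).comp hw).aestronglyMeasurable)
      (Filter.Eventually.of_forall fun t => ?_)
    rw [tendsto_iff_norm_sub_tendsto_zero]
    refine squeeze_zero (fun _ => norm_nonneg _) (fun n => ?_) (tendsto_tail (hM t).1)
    rw [norm_sub_eq_nrm three_eq]
    have h1 : cutL n (w t) =ᵐ[volume] (ballS n).indicator (w t) := coe_toL three_eq _
    have e : (fun v => cutL n (w t) v - toL three_eq (w t) (hM t).1 v) =ᵐ[volume] fun v =>
        (ballS n).indicator (w t) v - univ.indicator (w t) v := by
      filter_upwards [h1, hc t] with v h1 h2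
      rw [h1, h2, indicator_univ]
    rw [nrm_congr e]
    exact nrm_indicator_sub_le (hM t).1 (measurableSet_ballS _) MeasurableSet.univ subset_rfl
      (subset_univ _)
  · rw [norm_eq_nrm three_eq, nrm_congr (hc t)]
    exact (hM t).2

end bochner

/-! ### Convergence of the approximations to an arbitrary solution -/

section uniqueness
variable {τ ε lam m₁ e : ℝ} {F f₀ : V → ℝ} {T M N D : ℝ} {u : ℕ → ℝ → X} {f : C(Icc 0 T, X)}

lemma continuous_nrm_indicator {S : Set V} (hS : MeasurableSet S) :
    Continuous fun g : L1 3 => nrm 3 (S.indicator g) := by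
  refine (LipschitzWith.of_le_add fun f g => ?_).continuous
  have hf := mom_coe three_eq f
  have hg := mom_coe three_eq g
  have e : S.indicator f = fun v => S.indicator g v + S.indicator (fun v => f v - g v) v := by
    ext v
    by_cases h : v ∈ S <;> simp [h]
  rw [e, dist_eq_norm, norm_sub_eq_nrm three_eq]
  exact (nrm_add_le (hg.indicator hS) ((hf.sub hg).indicator hS)).trans
    (add_le_add_right (nrm_indicator_le (hf.sub hg) hS) _)

/-- The approximations converge to every solution. -/
lemma IsApprox.tendsto_solution (hp : Params τ ε lam m₁ e) (hF : Mom 3 F) (hF0 : 0 ≤ᵐ[volume] F)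
    (hT : 0 < T) (h : IsApprox τ ε lam m₁ e F f₀ T M N u) {φ₀ : L1 3}
    (hinit : Filter.Tendsto (fun k => u k 0) Filter.atTop
      (nhds (f ⟨0, left_mem_Icc.2 hT.le⟩)))
    (hf : IsSolution τ ε lam m₁ e F hT φ₀ f) (t : Icc 0 T) :
    Filter.Tendsto (fun k => u k t) Filter.atTop (nhds (f t)) := by
  obtain ⟨g, hg, hfg⟩ := hf.bounded
  set B := (eLpNorm g ⊤ (volume.restrict (Ioo 0 T))).toReal with hB
  have hgB : ∀ᵐ s ∂(volume.restrict (Ioo 0 T)), ‖g s‖ ≤ B := by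
    filter_upwards [ae_le_eLpNormEssSup (f := g) (μ := volume.restrict (Ioo 0 T))] with s hs
    rw [← eLpNorm_exponent_top] at hs
    have := ENNReal.toReal_mono hg.2.ne hs
    rwa [toReal_enorm] at this
  set M' := max M B with hM'
  have hM'0 : 0 ≤ M' :=
    ((nrm_nonneg 3 _).trans (h.cubic 0 0 (left_mem_Icc.2 hT.le)).2).trans (le_max_left _ _)
  set w : ℝ → X := fun s => f (projIcc 0 T hT.le s) with hw
  have hwc : Continuous w := f.continuous.comp continuous_projIcc
  have toIcc : ∀ {p : ℝ → Prop}, (∀ᵐ s ∂(volume.restrict (Ioo 0 T)), p s) →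
      ∀ᵐ s, s ∈ Icc 0 T → p s := fun {p} hp => by
    rw [Measure.restrict_congr_set Ioo_ae_eq_Icc, ae_restrict_iff' measurableSet_Icc] at hp
    exact hp
  have hwM : ∀ᵐ s, s ∈ Icc 0 T → Mom 3 (w s) ∧ nrm 3 (w s) ≤ M' := by
    filter_upwards [toIcc hfg, toIcc hgB] with s h1 h2 hs
    refine ⟨(mom_coe three_eq (g s)).congr (h1 hs).symm, ?_⟩
    rw [nrm_congr (h1 hs), ← norm_eq_nrm three_eq]
    exact (h2 hs).trans (le_max_right _ _)
  have hτ := hp.hτ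
  have hl := hp.hlam
  have hm := hp.hm₁
  have n3 := nrm_nonneg 3 F
  set a := τ / 2 * 8 * (M' + M') + 1 / lam * (2 * (2 + m₁)) * nrm 3 F with ha
  set b := 1 / lam * (2 * (2 + m₁)) * M' with hb
  have ha0 : 0 ≤ a := by positivity
  have hb0 : 0 ≤ b := by positivity
  -- The error is expressed through the Bochner representative g: strong measurability in `L¹_3`
  -- makes it measurable in time. It is bounded and tends to zero pointwise, without a rate, so
  -- dominated convergence handles its time integral.
  set η : ℕ → ℝ → ℝ := fun k s => truncErr τ lam m₁ F M' (cutR k) (g s) with hη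
  have hηm : ∀ k, AEStronglyMeasurable (η k) (volume.restrict (Ioo 0 T)) := fun k =>
    Continuous.comp_aestronglyMeasurable (g := fun x : L1 3 => truncErr τ lam m₁ F M' (cutR k) x)
      (((continuous_nrm_indicator (measurableSet_ballS _).compl).const_mul _).add_const _) hg.1
  have hηb : ∀ k, ∀ᵐ s ∂(volume.restrict (Ioo 0 T)), ‖η k s‖ ≤ a * B + b * nrm 3 F := fun k => by
    filter_upwards [hgB] with s hs
    rw [Real.norm_of_nonneg (truncErr_nonneg hp F hM'0 _ _)]
    have h1 := nrm_indicator_le (mom_coe three_eq (g s)) (measurableSet_ballS (cutR k)).compl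
    have h2 := nrm_indicator_le hF (measurableSet_ballS (cutR k)).compl
    rw [← norm_eq_nrm three_eq] at h1
    have h3 := h1.trans hs
    change truncErr τ lam m₁ F M' (cutR k) (g s) ≤ _
    unfold truncErr
    rw [← ha, ← hb]
    gcongr
  have hcut : Filter.Tendsto (fun k : ℕ => (k + 1) ^ 2) Filter.atTop Filter.atTop :=
    (Filter.tendsto_pow_atTop two_ne_zero).comp (Filter.tendsto_add_atTop_nat 1)
  have htail : ∀ {x : V → ℝ}, Mom 3 x → Filter.Tendsto
      (fun k => nrm 3 ((ballS (cutR k))ᶜ.indicator x)) Filter.atTop (nhds 0) := fun hx => by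
    refine ((tendsto_tail hx).comp hcut).congr fun k => ?_
    simp [cutR]
  have hηlim : ∀ s, Filter.Tendsto (fun k => η k s) Filter.atTop (nhds 0) := fun s => by
    have := ((htail (mom_coe three_eq (g s))).const_mul a).add ((htail hF).const_mul b)
    rw [mul_zero, mul_zero, add_zero] at this
    exact this
  have toIoc : (volume : Measure ℝ).restrict (uIoc 0 T) = volume.restrict (Ioo 0 T) := by
    rw [uIoc_of_le hT.le]; exact (Measure.restrict_congr_set Ioo_ae_eq_Ioc).symm
  have hηi : ∀ k, IntervalIntegrable (η k) volume 0 T := fun k => by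
    rw [intervalIntegrable_iff, IntegrableOn, toIoc]
    exact Integrable.mono' (integrable_const _) (hηm k) (hηb k)
  have hIlim : Filter.Tendsto (fun k => ∫ s in 0..T, η k s) Filter.atTop (nhds 0) := by
    have := intervalIntegral.tendsto_integral_filter_of_dominated_convergence
      (μ := volume) (a := 0) (b := T) (F := η) (f := fun _ => (0 : ℝ)) (l := Filter.atTop)
      (fun _ => a * B + b * nrm 3 F)
      (Filter.Eventually.of_forall fun k => by rw [toIoc]; exact hηm k)
      (Filter.Eventually.of_forall fun k => by
        have := hηb k
        rwa [← toIoc, ae_restrict_iff' measurableSet_uIoc] at this)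
      intervalIntegrable_const (Filter.Eventually.of_forall fun s _ => hηlim s)
    simpa using this
  have hst : ∀ k, ‖f t - u k t‖ ≤ Real.exp (stabRate τ lam m₁ F M' * T) *
      (‖w 0 - u k 0‖ + ∫ s in 0..T, η k s) := fun k => by
    have := (h.sol k).stability hp hF hF0 (cutR_pos k).le hT.le hwc.continuousOn
      MeasurableSet.univ le_rfl (subset_univ _) (fun ψ hψ s hs => by
        have := hf.equation ψ hψ.test ⟨s, hs⟩
        rw [indicator_univ, indicator_univ]
        simp only [hw, projIcc_of_mem hT.le hs]
        exact this)
      (fun s hs => ⟨(h.cubic k s hs).1, (h.cubic k s hs).2.trans (le_max_left _ _)⟩) hwM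
      (hηi k) (by
        filter_upwards [toIcc hfg] with s hs hsT
        rw [hη]
        unfold truncErr
        rw [nrm_congr (f := (ballS (cutR k))ᶜ.indicator (w s))
          (g := (ballS (cutR k))ᶜ.indicator (g s))]
        filter_upwards [hs hsT] with v hv
        by_cases hvS : v ∈ (ballS (cutR k))ᶜ
        · rw [indicator_of_mem hvS, indicator_of_mem hvS]; exact hv
        · rw [indicator_of_notMem hvS, indicator_of_notMem hvS]) t t.2
    simpa only [hw, projIcc_val] using this
  have h0 : Filter.Tendsto (fun k => ‖w 0 - u k 0‖) Filter.atTop (nhds 0) := by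
    have e : w 0 = f ⟨0, left_mem_Icc.2 hT.le⟩ := by
      simp only [hw, projIcc_of_mem hT.le (left_mem_Icc.2 hT.le)]
    have := (tendsto_const_nhds (x := w 0)).sub hinit
    rw [e, sub_self] at this
    rw [e]
    exact tendsto_norm_zero.comp this
  rw [tendsto_iff_norm_sub_tendsto_zero]
  have := (h0.add hIlim).const_mul (Real.exp (stabRate τ lam m₁ F M' * T))
  rw [add_zero, mul_zero] at this
  exact squeeze_zero (fun _ => norm_nonneg _) (fun k => by rw [norm_sub_rev]; exact hst k) this

end uniqueness

end InelasticBoltzmann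

end

theorem theorem4p6
    (τ ε lam m₁ e Θ₁ : ℝ) (u₁ : InelasticBoltzmann.V) (F₁ : InelasticBoltzmann.V → ℝ)
    (hτ : 0 ≤ τ) (hε₀ : 0 < ε) (hε₁ : ε < 1) (hlam : 0 < lam) (hm₁ : 0 < m₁)
    (he₀ : 0 < e) (he₁ : e ≤ 1)
    (hF₁ : InelasticBoltzmann.IsHost m₁ Θ₁ u₁ F₁)
    (f₀ : InelasticBoltzmann.L1 3) (hf₀ : 0 ≤ᵐ[volume] f₀) (T : ℝ) (hT : 0 < T) :
    ∃ f : C(Icc (0 : ℝ) T, InelasticBoltzmann.L1 2),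
      InelasticBoltzmann.IsSolution τ ε lam m₁ e F₁ hT f₀ f ∧
      (∀ t, 0 ≤ᵐ[volume] f t) ∧
      ∀ g : C(Icc (0 : ℝ) T, InelasticBoltzmann.L1 2),
        InelasticBoltzmann.IsSolution τ ε lam m₁ e F₁ hT f₀ g → g = f := by
  open InelasticBoltzmann in
  have hp : Params τ ε lam m₁ e := ⟨hτ, hε₀, hε₁, hlam, hm₁, he₀, he₁⟩
  have h3 := mom_coe three_eq f₀
  obtain ⟨M, N, u, hM0, hN0, hu⟩ := exists_isApprox hp (hF₁.mom 5) hF₁.nonneg h3 hf₀ hT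
  obtain ⟨f, D, hD⟩ := hu.exists_limit hp (hF₁.mom 4) hF₁.nonneg h3 hT.le hM0 hN0
  have hinit := hu.limit_init h3 hD (left_mem_Icc.2 hT.le)
  obtain ⟨g, hg, hfg⟩ := exists_bochner (T := T) (f.continuous.comp (continuous_projIcc (h := hT.le)))
    fun t => hu.limit_cubic hD _
  refine ⟨f, ⟨⟨g, hg, Filter.Eventually.of_forall hfg⟩,
    fun ψ hψ t => hu.limit_equation hp (hF₁.mom 3) hT.le hD hψ t, hinit⟩,
    fun t => (L_nonneg_iff _).1 (hu.limit_nonneg hD t), fun w hw => ?_⟩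
  -- The same sequence u k converges to w and to f, so the two solutions agree at every time.
  refine ContinuousMap.ext fun t => tendsto_nhds_unique ?_ (tendsto_of_rate hD t)
  have h0 : w ⟨0, left_mem_Icc.2 hT.le⟩ = f ⟨0, left_mem_Icc.2 hT.le⟩ :=
    L_ext (hw.initial.trans hinit.symm)
  refine hu.tendsto_solution hp (hF₁.mom 3) hF₁.nonneg hT ?_ hw t
  rw [h0]
  exact tendsto_of_rate hD _
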